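/- Notation. Let $\mathbb C(\!(z)\!)$ and $\mathbb C(\!\{z\}\!)$ be the fields of formal and of convergent Laurent series, let $\mathcal P=\bigcup_{s\ge1}\mathbb C(\!(z^{1/s})\!)$ be the field of formal Puiseux series with its usual order $\mathrm{ord}$ in $z$, and let $\mathcal P^{-}=\bigcup_{s\ge1}z^{-1/s}\mathbb C[z^{-1/s}]$ and $\mathcal P^{+}=\bigcup_{s\ge1}\mathbb C[\![z^{1/s}]\!]$, so that $\mathcal P=\mathcal P^-\oplus\mathcal P^+$; $\mathrm{pr}^-:\mathcal P\to\mathcal P^-$ is the projection, and $\xi(f)(z)=f(e^{2\pi i}z)$. A differential module over $\mathbb C(\!\{z\}\!)$ is a finite-dimensional vector space $M$ with a $\mathbb C$-linear $\nabla_M$ satisfying the Leibniz rule; it has the matrix $G$ in a basis if $\nabla_M$ is $\frac{d}{dz}-G$ in the coordinates of this basis. $\mathrm{End}(M)$ carries $\nabla(\varphi)=\nabla_M\varphi-\varphi\nabla_M$. With $\chi(\Phi)=\dim\ker\Phi-\dim\mathrm{coker}\,\Phi$ and $\widetilde M=\mathbb C(\!(z)\!)\otimes M$, the Komatsu–Malgrange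 irregularity is $\mathrm{Irr}(M)=\chi(\nabla_{\widetilde M})-\chi(\nabla_M)$. Proposition. Let $q\in\mathcal P^{-}$, let $r\ge1$ be its ramification index, i.e. the least integer $s\ge 1$ with $q\in z^{-1/s}\mathbb C[z^{-1/s}]$, and let $p$ be the integer with $\mathrm{ord}\,q=-p/r$ (with $p=0$ if $q=0$). Let $R\in\mathbb C$ and let $M=M_{E_{q,R}}$ be a differential module over $\mathbb C(\!\{z\}\!)$ whose Hukuhara–Turrittin–Levelt normal form is the multiplicity-one cell $$E_{q,R}=\mathrm{diag}\bigl(q+R,\ \xi(q)+R,\dots,\xi^{r-1}(q)+R\bigr)z^{-1},$$ i.e. $\mathcal P\otimes M$ has the matrix $E_{q,R}$ in a suitable basis. Let $\tilde q\in\mathbb C(\!\{z^{1/r}\}\!)$ satisfy $\mathrm{pr}^-(\tilde q)=q$ and $\mathrm{ord}(\tilde q/z)<0$. Then the polynomial $$F(\zeta,z)=\prod_{k=0}^{r-1}\Bigl(\zeta-\frac{z}{\xi^{k}(\tilde q)(z)}\Bigr)$$ has coefficients in $\mathbb C\{z\}$ and so defines a plane curve germ $C_{\tilde q}=\{F=0\}$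 at $(\zeta,z)=(0,0)$. The kernels and cokernels defining $\mathrm{Irr}(\mathrm{End}_{\mathbb C(\!\{z\}\!)}(M))$ are finite-dimensional, and the Milnor number $\mu(C_{\tilde q})=\dim_{\mathbb C}\mathbb C\{\zeta,z\}/(\partial F/\partial\zeta,\partial F/\partial z)$ is finite and equals $$\mu(C_{\tilde q})=(2p+r-1)(r-1)-\mathrm{Irr}\bigl(\mathrm{End}_{\mathbb C(\!\{z\}\!)}(M)\bigr).$$ -/

import Mathlib

open scoped TensorProduct

noncomputable section

namespace IrregularSpectral

/-! ### Puiseux series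

All rings of (formal, convergent, ramified) Laurent series in `z` are realised as subalgebras of
the field of Hahn series `∑ a_x z^x` with rational exponents. -/

/-- The ambient field of Hahn series in `z` with rational exponents. -/
abbrev H : Type := HahnSeries ℚ ℂ

/-- The coefficientwise `ℂ`-algebra structure (a shortcut that keeps instance search away from other,
propositionally equal ones). -/
instance : Algebra ℂ H := HahnSeries.instAlgebra

/-- The monomial `z ^ a`. -/
def zpow (a : ℚ) : H := HahnSeries.single a 1

/-- `ℂ((z^{1/s}))` (for `s > 0`): the series all of whose exponents lie in `(1/s)ℤ`. -/
def laurent (s : ℕ) : Subalgebra ℂ H where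
  carrier := {f | ∀ a ∈ f.support, ∃ k : ℤ, a = (k : ℚ) / s}
  mul_mem' := by
    intro f g hf hg a ha
    obtain ⟨x, hx, y, hy, rfl⟩ := HahnSeries.support_mul_subset ha
    obtain ⟨k, rfl⟩ := hf x hx
    obtain ⟨l, rfl⟩ := hg y hy
    exact ⟨k + l, by push_cast; ring⟩
  add_mem' := by
    intro f g hf hg a ha
    rcases HahnSeries.support_add_subset f g ha with h | h
    · exact hf a h
    · exact hg a h
  algebraMap_mem' := by
    intro c a ha
    rw [HahnSeries.algebraMap_apply] at ha
    have h0 : a = 0 := by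
      by_contra hne
      exact ha (by simp [HahnSeries.C_apply, HahnSeries.coeff_single_of_ne hne])
    exact ⟨0, by simp [h0]⟩

/-- The ring `𝒫 = ⋃_{s > 0} ℂ((z^{1/s}))` of formal Puiseux series. -/
def puiseux : Subalgebra ℂ H where
  carrier := {f | ∃ s : ℕ, 0 < s ∧ f ∈ laurent s}
  mul_mem' := by
    rintro f g ⟨s, hs, hf⟩ ⟨t, ht, hg⟩
    have hs' : (s : ℚ) ≠ 0 := by exact_mod_cast hs.ne'
    have ht' : (t : ℚ) ≠ 0 := by exact_mod_cast ht.ne'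
    refine ⟨s * t, Nat.mul_pos hs ht, (laurent (s * t)).mul_mem ?_ ?_⟩
    · intro a ha
      obtain ⟨k, rfl⟩ := hf a ha
      exact ⟨k * t, by push_cast; field_simp⟩
    · intro a ha
      obtain ⟨k, rfl⟩ := hg a ha
      exact ⟨k * s, by push_cast; field_simp⟩
  add_mem' := by
    rintro f g ⟨s, hs, hf⟩ ⟨t, ht, hg⟩
    have hs' : (s : ℚ) ≠ 0 := by exact_mod_cast hs.ne'
    have ht' : (t : ℚ) ≠ 0 := by exact_mod_cast ht.ne'
    refine ⟨s * t, Nat.mul_pos hs ht, (laurent (s * t)).add_mem ?_ ?_⟩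
    · intro a ha
      obtain ⟨k, rfl⟩ := hf a ha
      exact ⟨k * t, by push_cast; field_simp⟩
    · intro a ha
      obtain ⟨k, rfl⟩ := hg a ha
      exact ⟨k * s, by push_cast; field_simp⟩
  algebraMap_mem' := fun c => ⟨1, one_pos, (laurent 1).algebraMap_mem c⟩

/-- Absolute convergence on the circle `|z| = ρ`. -/
def SummableAt (f : H) (ρ : ℝ) : Prop :=
  Summable fun a : ℚ => ‖f.coeff a‖ * ρ ^ (a : ℝ)

theorem summableAt_of_le {f : H} {ρ σ : ℝ} (hσ : 0 < σ) (h : σ ≤ ρ) (hf : SummableAt f ρ) :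
    SummableAt f σ := by
  have hρ : 0 < ρ := hσ.trans_le h
  by_cases h0 : f = 0
  · simp [SummableAt, h0, summable_zero]
  refine Summable.of_nonneg_of_le (fun a => by positivity) (fun a => ?_)
    (Summable.mul_left ((σ / ρ) ^ ((f.order : ℚ) : ℝ)) hf)
  by_cases ha : f.coeff a = 0
  · simp [ha]
  have hle : f.order ≤ a := HahnSeries.order_le_of_coeff_ne_zero ha
  have h1 : (σ / ρ) ^ (a : ℝ) ≤ (σ / ρ) ^ ((f.order : ℚ) : ℝ) :=
    Real.rpow_le_rpow_of_exponent_ge (by positivity) ((div_le_one hρ).2 h) (by exact_mod_cast hle)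
  have h2 : σ ^ (a : ℝ) = (σ / ρ) ^ (a : ℝ) * ρ ^ (a : ℝ) := by
    rw [← Real.mul_rpow (by positivity) hρ.le, div_mul_cancel₀ _ hρ.ne']
  rw [h2]
  calc ‖f.coeff a‖ * ((σ / ρ) ^ (a : ℝ) * ρ ^ (a : ℝ))
      = (σ / ρ) ^ (a : ℝ) * (‖f.coeff a‖ * ρ ^ (a : ℝ)) := by ring
    _ ≤ _ := by gcongr

theorem SummableAt.mul {f g : H} {ρ : ℝ} (hρ : 0 < ρ) (hf : SummableAt f ρ)
    (hg : SummableAt g ρ) : SummableAt (f * g) ρ := by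
  set u : ℚ × ℚ → ℝ :=
    fun p => (‖f.coeff p.1‖ * ρ ^ (p.1 : ℝ)) * (‖g.coeff p.2‖ * ρ ^ (p.2 : ℝ)) with hu
  have hun : ∀ p, 0 ≤ u p := fun p => by positivity
  have hsum : Summable u :=
    Summable.mul_of_nonneg hf hg (fun a => by positivity) (fun a => by positivity)
  have hs2 : Summable (fun x : Σ a : ℚ, {p : ℚ × ℚ // p.1 + p.2 = a} => u x.2) :=
    ((Equiv.sigmaFiberEquiv fun p : ℚ × ℚ => p.1 + p.2).summable_iff (f := u)).2 hsum
  refine Summable.of_nonneg_of_le (fun a => by positivity) (fun a => ?_) hs2.sigma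
  have hfib : Summable (fun p : {p : ℚ × ℚ // p.1 + p.2 = a} => u p) := hs2.sigma_factor a
  set A := Finset.antidiagonal f.isPWO_support g.isPWO_support a with hA
  have hmem : ∀ p ∈ A, p.1 + p.2 = a := fun p hp => (Finset.mem_antidiagonal.1 hp).2.2
  have h1 : ‖(f * g).coeff a‖ * ρ ^ (a : ℝ) ≤ ∑ p ∈ A, u p := by
    have : ‖(f * g).coeff a‖ ≤ ∑ p ∈ A, ‖f.coeff p.1‖ * ‖g.coeff p.2‖ := by
      rw [HahnSeries.coeff_mul]
      refine (norm_sum_le _ _).trans (le_of_eq ?_)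
      exact Finset.sum_congr rfl fun p _ => norm_mul _ _
    calc ‖(f * g).coeff a‖ * ρ ^ (a : ℝ)
        ≤ (∑ p ∈ A, ‖f.coeff p.1‖ * ‖g.coeff p.2‖) * ρ ^ (a : ℝ) := by gcongr
      _ = ∑ p ∈ A, u p := by
          rw [Finset.sum_mul]
          refine Finset.sum_congr rfl fun p hp => ?_
          have := hmem p hp
          rw [hu, ← this]
          push_cast
          rw [Real.rpow_add hρ]
          ring
  refine h1.trans ?_
  have h2 : ∑ p ∈ A, u p = ∑ p ∈ A.subtype (fun p => p.1 + p.2 = a), u p :=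
    (Finset.sum_subtype_of_mem u hmem).symm
  rw [h2]
  exact hfib.sum_le_tsum _ (fun p _ => hun p)

/-- The series converging (absolutely) for some, hence for all sufficiently small, `|z| > 0`. -/
def convergent : Subalgebra ℂ H where
  carrier := {f | ∃ ρ : ℝ, 0 < ρ ∧ SummableAt f ρ}
  mul_mem' := by
    rintro f g ⟨ρ, hρ, hf⟩ ⟨σ, hσ, hg⟩
    have h : 0 < min ρ σ := lt_min hρ hσ
    exact ⟨min ρ σ, h, (summableAt_of_le h (min_le_left _ _) hf).mul h
      (summableAt_of_le h (min_le_right _ _) hg)⟩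
  add_mem' := by
    rintro f g ⟨ρ, hρ, hf⟩ ⟨σ, hσ, hg⟩
    have h : 0 < min ρ σ := lt_min hρ hσ
    refine ⟨min ρ σ, h, Summable.of_nonneg_of_le (fun a => by positivity) (fun a => ?_)
      ((summableAt_of_le h (min_le_left _ _) hf).add
        (summableAt_of_le h (min_le_right _ _) hg))⟩
    rw [← add_mul, HahnSeries.coeff_add]
    gcongr
    exact norm_add_le _ _
  algebraMap_mem' := by
    intro c
    refine ⟨1, one_pos, summable_of_ne_finset_zero (s := {0}) fun a ha => ?_⟩
    have hne : a ≠ 0 := by simpa using ha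
    rw [HahnSeries.algebraMap_apply]
    simp [HahnSeries.C_apply, HahnSeries.coeff_single_of_ne hne]

/-- `ℂ({z^{1/s}})` (for `s > 0`), the convergent Laurent series in `z^{1/s}`. -/
def convLaurent (s : ℕ) : Subalgebra ℂ H := laurent s ⊓ convergent

theorem laurent_le_puiseux {s : ℕ} (hs : 0 < s) : laurent s ≤ puiseux := fun _ hf => ⟨s, hs, hf⟩

/-- The field `ℂ({z})` of convergent Laurent series, as a type. -/
def ConvL : Type := convLaurent 1

/-- The field `ℂ((z))` of formal Laurent series, as a type. -/
def FormalL : Type := laurent 1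

/-- The field `𝒫` of formal Puiseux series, as a type. -/
def Puiseux : Type := puiseux

instance : CommRing ConvL := inferInstanceAs (CommRing (convLaurent 1))
instance : CommRing FormalL := inferInstanceAs (CommRing (laurent 1))
instance : CommRing Puiseux := inferInstanceAs (CommRing puiseux)
instance : Algebra ℂ ConvL := inferInstanceAs (Algebra ℂ (convLaurent 1))
instance : Algebra ℂ FormalL := inferInstanceAs (Algebra ℂ (laurent 1))
instance : Algebra ℂ Puiseux := inferInstanceAs (Algebra ℂ puiseux)

/-- The inclusion of `ℂ({z})` into the ambient field. -/
def ConvL.val : ConvL →ₐ[ℂ] H := (convLaurent 1).val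

/-- The inclusion of `ℂ((z))` into the ambient field. -/
def FormalL.val : FormalL →ₐ[ℂ] H := (laurent 1).val

/-- The inclusion of `𝒫` into the ambient field. -/
def Puiseux.val : Puiseux →ₐ[ℂ] H := puiseux.val

instance : Algebra ConvL FormalL :=
  (Subalgebra.inclusion (inf_le_left : convLaurent 1 ≤ laurent 1)).toRingHom.toAlgebra

instance : IsScalarTower ℂ ConvL FormalL := IsScalarTower.of_algebraMap_eq' rfl

instance : Algebra ConvL Puiseux :=
  (Subalgebra.inclusion ((inf_le_left : convLaurent 1 ≤ laurent 1).trans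
    (laurent_le_puiseux one_pos))).toRingHom.toAlgebra

instance : IsScalarTower ℂ ConvL Puiseux := IsScalarTower.of_algebraMap_eq' rfl

/-! ### The derivation `d/dz` -/

/-- The Euler operator `z d/dz`. -/
def euler (f : H) : H where
  coeff a := (a : ℂ) * f.coeff a
  isPWO_support' := f.isPWO_support.mono fun a ha h => ha (by simp [h])

theorem euler_mul (f g : H) : euler (f * g) = euler f * g + f * euler g := by
  have hs : ∀ h : H, (euler h).support ⊆ h.support := fun h a ha h0 => ha (by simp [euler, h0])
  ext a
  rw [HahnSeries.coeff_add, HahnSeries.coeff_mul_left' f.isPWO_support (hs f),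
    HahnSeries.coeff_mul_right' g.isPWO_support (hs g), ← Finset.sum_add_distrib]
  change (a : ℂ) * (f * g).coeff a = _
  rw [HahnSeries.coeff_mul, Finset.mul_sum]
  refine Finset.sum_congr rfl fun p hp => ?_
  have := (Finset.mem_antidiagonal.1 hp).2.2
  change _ = (p.1 : ℂ) * f.coeff p.1 * g.coeff p.2 + f.coeff p.1 * ((p.2 : ℂ) * g.coeff p.2)
  rw [← this]
  push_cast
  ring

/-- `d/dz` on Hahn series: `z^a ↦ a z^{a-1}`. -/
def ddz : Derivation ℂ H H :=
  Derivation.mk'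
    { toFun := fun f => zpow (-1) * euler f
      map_add' := fun f g => by
        rw [← mul_add]
        congr 1
        ext a
        simp [euler, mul_add]
      map_smul' := fun c f => by
        ext a
        simp only [RingHom.id_apply, zpow, HahnSeries.coeff_single_mul, HahnSeries.coeff_smul,
          euler, smul_eq_mul]
        ring }
    (fun f g => by
      simp only [LinearMap.coe_mk, AddHom.coe_mk, euler_mul, smul_eq_mul]
      ring)

theorem coeff_ddz (f : H) (a : ℚ) : (ddz f).coeff a = ((a + 1 : ℚ) : ℂ) * f.coeff (a + 1) := by
  change (HahnSeries.single (-1 : ℚ) (1 : ℂ) * euler f).coeff a = _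
  rw [HahnSeries.coeff_single_mul, one_mul, sub_neg_eq_add]
  rfl

theorem ddz_mem_laurent {s : ℕ} (hs : 0 < s) {f : H} (hf : f ∈ laurent s) :
    ddz f ∈ laurent s := by
  have hs' : (s : ℚ) ≠ 0 := by exact_mod_cast hs.ne'
  intro a ha
  have h1 : f.coeff (a + 1) ≠ 0 := fun h => ha (by rw [coeff_ddz, h, mul_zero])
  obtain ⟨k, hk⟩ := hf (a + 1) h1
  refine ⟨k - s, ?_⟩
  rw [eq_sub_of_add_eq hk]
  push_cast
  field_simp

theorem ddz_mem_puiseux {f : H} (hf : f ∈ puiseux) : ddz f ∈ puiseux := by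
  obtain ⟨s, hs, h⟩ := hf
  exact ⟨s, hs, ddz_mem_laurent hs h⟩

theorem ddz_mem_convergent {f : H} (hf : f ∈ convergent) : ddz f ∈ convergent := by
  obtain ⟨ρ, hρ, hf⟩ := hf
  set e : ℝ := Real.exp 1
  have he : 0 < e := Real.exp_pos 1
  refine ⟨ρ / e, by positivity, ?_⟩
  set M : ℝ := e ^ (2 * |((f.order : ℚ) : ℝ)|)
  have hb : Summable fun b : ℚ =>
      (M * (e / ρ)) * (‖f.coeff b‖ * ρ ^ (b : ℝ)) := Summable.mul_left _ hf
  have hshift := ((Equiv.addRight (1 : ℚ)).summable_iff (f := fun b : ℚ =>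
      (M * (e / ρ)) * (‖f.coeff b‖ * ρ ^ (b : ℝ)))).2 hb
  refine Summable.of_nonneg_of_le (fun a => by positivity) (fun a => ?_) hshift
  simp only [Function.comp_apply, Equiv.coe_addRight]
  rw [coeff_ddz, norm_mul]
  obtain ⟨b, rfl⟩ : ∃ b : ℚ, a = b - 1 := ⟨a + 1, by ring⟩
  rw [sub_add_cancel]
  by_cases h0 : f.coeff b = 0
  · simp [h0]
  have hle : ((f.order : ℚ) : ℝ) ≤ (b : ℝ) := by
    exact_mod_cast HahnSeries.order_le_of_coeff_ne_zero h0
  have hnb : ‖((b : ℚ) : ℂ)‖ = |(b : ℝ)| := by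
    have : ((b : ℚ) : ℂ) = ((b : ℝ) : ℂ) := by push_cast; rfl
    rw [this, Complex.norm_real, Real.norm_eq_abs]
  have key : |(b : ℝ)| * e ^ (-(b : ℝ)) ≤ M := by
    have h1 : |(b : ℝ)| ≤ e ^ |(b : ℝ)| := by
      rw [← Real.exp_mul, one_mul]
      linarith [Real.add_one_le_exp |(b : ℝ)|]
    calc |(b : ℝ)| * e ^ (-(b : ℝ)) ≤ e ^ |(b : ℝ)| * e ^ (-(b : ℝ)) := by gcongr
      _ = e ^ (|(b : ℝ)| - b) := by rw [← Real.rpow_add he, sub_eq_add_neg]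
      _ ≤ M := by
        refine Real.rpow_le_rpow_of_exponent_le (Real.one_le_exp zero_le_one) ?_
        rcases le_total 0 (b : ℝ) with h | h
        · rw [abs_of_nonneg h, sub_self]; positivity
        · rw [abs_of_nonpos h, abs_of_nonpos (hle.trans h)]; linarith
  have hpow : (ρ / e) ^ (((b - 1 : ℚ)) : ℝ) = (e / ρ) * (e ^ (-(b : ℝ)) * ρ ^ (b : ℝ)) := by
    push_cast
    rw [Real.rpow_sub (by positivity), Real.rpow_one, Real.div_rpow hρ.le he.le,
      Real.rpow_neg he.le]
    field_simp
  rw [hnb, hpow]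
  calc |(b : ℝ)| * ‖f.coeff b‖ * (e / ρ * (e ^ (-(b : ℝ)) * ρ ^ (b : ℝ)))
      = (|(b : ℝ)| * e ^ (-(b : ℝ))) * ((e / ρ) * (‖f.coeff b‖ * ρ ^ (b : ℝ))) := by ring
    _ ≤ M * ((e / ρ) * (‖f.coeff b‖ * ρ ^ (b : ℝ))) := by gcongr
    _ = _ := by ring

/-- `d/dz` on `ℂ({z})`. -/
def dConv : Derivation ℂ ConvL ConvL :=
  Derivation.mk'
    { toFun := fun f =>
        (⟨ddz f.1, ddz_mem_laurent one_pos f.2.1, ddz_mem_convergent f.2.2⟩ : convLaurent 1)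
      map_add' := fun f g => Subtype.ext (ddz.map_add f.1 g.1)
      map_smul' := fun c f => Subtype.ext (ddz.map_smul c f.1) }
    (fun f g => Subtype.ext (ddz.leibniz f.1 g.1))

/-- `d/dz` on `ℂ((z))`. -/
def dFormal : Derivation ℂ FormalL FormalL :=
  Derivation.mk'
    { toFun := fun f => (⟨ddz f.1, ddz_mem_laurent one_pos f.2⟩ : laurent 1)
      map_add' := fun f g => Subtype.ext (ddz.map_add f.1 g.1)
      map_smul' := fun c f => Subtype.ext (ddz.map_smul c f.1) }
    (fun f g => Subtype.ext (ddz.leibniz f.1 g.1))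

/-- `d/dz` on `𝒫`. -/
def dPuiseux : Derivation ℂ Puiseux Puiseux :=
  Derivation.mk'
    { toFun := fun f => (⟨ddz f.1, ddz_mem_puiseux f.2⟩ : puiseux)
      map_add' := fun f g => Subtype.ext (ddz.map_add f.1 g.1)
      map_smul' := fun c f => Subtype.ext (ddz.map_smul c f.1) }
    (fun f g => Subtype.ext (ddz.leibniz f.1 g.1))

/-! ### Differential modules -/

/-- The structure of a differential module over `(R, D)` on the `R`-module `M`: a `ℂ`-linear
endomorphism satisfying the Leibniz rule. -/
structure Connection {R : Type*} [CommRing R] [Algebra ℂ R] (D : Derivation ℂ R R)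
    (M : Type*) [AddCommGroup M] [Module R M] [Module ℂ M] [IsScalarTower ℂ R M] where
  nabla : M →ₗ[ℂ] M
  leibniz : ∀ (f : R) (m : M), nabla (f • m) = D f • m + f • nabla m

namespace Connection

variable {R : Type*} [CommRing R] [Algebra ℂ R] {D : Derivation ℂ R R}
  {M : Type*} [AddCommGroup M] [Module R M] [Module ℂ M] [IsScalarTower ℂ R M]

/-- The differential module `End_R(M)`, with `∇(φ) = ∇ ∘ φ - φ ∘ ∇`. -/
def endConn (c : Connection D M) : Connection D (Module.End R M) where
  nabla :=
    { toFun := fun φ =>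
        { toFun := fun m => c.nabla (φ m) - φ (c.nabla m)
          map_add' := fun x y => by simp only [map_add]; abel
          map_smul' := fun f x => by
            simp only [map_smul, c.leibniz, map_add, RingHom.id_apply, smul_sub]
            abel }
      map_add' := fun φ ψ => by
        ext m
        simp only [LinearMap.coe_mk, AddHom.coe_mk, LinearMap.add_apply, map_add]
        abel
      map_smul' := fun a φ => by
        ext m
        simp only [LinearMap.coe_mk, AddHom.coe_mk, LinearMap.smul_apply, map_smul,
          RingHom.id_apply, smul_sub] }
  leibniz := fun f φ => by
    ext m
    simp only [LinearMap.coe_mk, AddHom.coe_mk, LinearMap.smul_apply, LinearMap.add_apply,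
      c.leibniz, smul_sub]
    abel

/-- The differential module `S ⊗_R M`, with `∇(s ⊗ m) = s' ⊗ m + s ⊗ ∇ m`, for an extension
`(S, DS)` of `(R, D)`. -/
def baseChange {S : Type*} [CommRing S] [Algebra ℂ S] [Algebra R S] [IsScalarTower ℂ R S]
    (DS : Derivation ℂ S S) (hD : ∀ f : R, DS (algebraMap R S f) = algebraMap R S (D f))
    (c : Connection D M) : Connection DS (S ⊗[R] M) :=
  let N : S ⊗[R] M →+ S ⊗[R] M :=
    TensorProduct.liftAddHom
      { toFun := fun s =>
          { toFun := fun m => DS s ⊗ₜ[R] m + s ⊗ₜ[R] c.nabla m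
            map_zero' := by simp
            map_add' := fun m n => by simp only [map_add, TensorProduct.tmul_add]; abel }
        map_zero' := by ext m; simp
        map_add' := fun s t => by
          ext m
          simp only [map_add, TensorProduct.add_tmul, AddMonoidHom.coe_mk, ZeroHom.coe_mk,
            AddMonoidHom.add_apply]
          abel }
      (fun r s m => by
        simp only [AddMonoidHom.coe_mk, ZeroHom.coe_mk, c.leibniz, Algebra.smul_def r s,
          Derivation.leibniz, hD, TensorProduct.tmul_add, TensorProduct.add_tmul, smul_eq_mul]
        rw [mul_comm s, ← Algebra.smul_def, ← Algebra.smul_def, ← Algebra.smul_def,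
          TensorProduct.smul_tmul, TensorProduct.smul_tmul, TensorProduct.smul_tmul]
        abel)
  have hN : ∀ (s : S) (m : M), N (s ⊗ₜ[R] m) = DS s ⊗ₜ[R] m + s ⊗ₜ[R] c.nabla m :=
    fun _ _ => rfl
  have hL : ∀ (f : S) (x : S ⊗[R] M), N (f • x) = DS f • x + f • N x := by
    intro f x
    induction x using TensorProduct.induction_on with
    | zero => simp
    | tmul s m =>
      simp only [TensorProduct.smul_tmul', hN, smul_eq_mul, Derivation.leibniz, smul_add,
        TensorProduct.add_tmul]
      rw [mul_comm s]
      abel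
    | add x y hx hy =>
      simp only [smul_add, map_add, hx, hy]
      abel
  { nabla :=
      { toFun := N
        map_add' := N.map_add
        map_smul' := fun a x => by
          have := hL (algebraMap ℂ S a) x
          rw [Derivation.map_algebraMap, zero_smul, zero_add, algebraMap_smul,
            algebraMap_smul] at this
          exact this }
    leibniz := hL }

/-- `G` is the matrix of the differential module with respect to the basis `b`: in the coordinates
given by `b`, the operator `∇` is `d/dz - G`. -/
def IsMatrix {ι : Type*} [Fintype ι] (c : Connection D M) (b : Module.Basis ι R M)
    (G : Matrix ι ι R) : Prop :=
  ∀ (m : M) (i : ι), b.repr (c.nabla m) i = D (b.repr m i) - (G.mulVec (b.repr m)) i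

end Connection

/-- A linear endomorphism has an index if its kernel and cokernel are finite-dimensional. -/
def HasIndex {V : Type*} [AddCommGroup V] [Module ℂ V] (Φ : V →ₗ[ℂ] V) : Prop :=
  Module.Finite ℂ (LinearMap.ker Φ) ∧ Module.Finite ℂ (V ⧸ LinearMap.range Φ)

/-- The index `χ(Φ) = dim Ker Φ - dim Coker Φ`. -/
def index {V : Type*} [AddCommGroup V] [Module ℂ V] (Φ : V →ₗ[ℂ] V) : ℤ :=
  (Module.finrank ℂ (LinearMap.ker Φ) : ℤ) - Module.finrank ℂ (V ⧸ LinearMap.range Φ)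

section Modules

variable {M : Type*} [AddCommGroup M] [Module ConvL M] [Module ℂ M]
  [IsScalarTower ℂ ConvL M]

/-- The formalization `ℂ((z)) ⊗ M`. -/
def formalization (c : Connection dConv M) : Connection dFormal (FormalL ⊗[ConvL] M) :=
  c.baseChange dFormal fun _ => rfl

/-- The extension of scalars `𝒫 ⊗ M`. -/
def puiseuxExtension (c : Connection dConv M) : Connection dPuiseux (Puiseux ⊗[ConvL] M) :=
  c.baseChange dPuiseux fun _ => rfl

/-- Both indices entering the irregularity are defined. -/
def HasIrr (c : Connection dConv M) : Prop :=
  HasIndex (formalization c).nabla ∧ HasIndex c.nabla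

/-- The Komatsu-Malgrange irregularity. -/
def irr (c : Connection dConv M) : ℤ :=
  index (formalization c).nabla - index c.nabla

end Modules

/-! ### Hukuhara-Turrittin-Levelt cells -/

/-- `z^{-1/s} ℂ[z^{-1/s}]`: the series in `z^{1/s}` with only negative exponents (a Hahn series
has well-ordered support, so there are finitely many of them). -/
def polar (s : ℕ) : Set H := {f | f ∈ laurent s ∧ ∀ a ∈ f.support, a < 0}

/-- `𝒫⁻ = ⋃_{s > 0} z^{-1/s} ℂ[z^{-1/s}]`. -/
def polarAll : Set H := {f | ∃ s : ℕ, 0 < s ∧ f ∈ polar s}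

/-- The least `s > 0` such that `q ∈ z^{-1/s} ℂ[z^{-1/s}]` (for `q ∈ 𝒫⁻`). -/
def ramificationIndex (q : H) : ℕ := sInf {s : ℕ | 0 < s ∧ q ∈ polar s}

/-- The projection `𝒫 → 𝒫⁻` along `𝒫 = 𝒫⁻ ⊕ 𝒫⁺`: forget all exponents `≥ 0`. -/
def prMinus (f : H) : H := HahnSeries.truncLT 0 f

/-- The Galois generator `ξ : f(z) ↦ f(e^{2πi} z)`, i.e. `z^a ↦ e^{2πi a} z^a`, on Hahn series. -/
def xi (f : H) : H where
  coeff a := Complex.exp (2 * Real.pi * Complex.I * (a : ℂ)) * f.coeff a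
  isPWO_support' := f.isPWO_support.mono fun a ha h => ha (by simp [h])

theorem xi_mem_puiseux {f : H} (hf : f ∈ puiseux) : xi f ∈ puiseux := by
  obtain ⟨s, hs, h⟩ := hf
  exact ⟨s, hs, fun a ha => h a fun h0 => ha (by simp [xi, h0])⟩

/-- `ξ` on `𝒫`. -/
def xiP (f : Puiseux) : Puiseux := (⟨xi f.1, xi_mem_puiseux f.2⟩ : puiseux)

theorem zpow_neg_one_mem : zpow (-1) ∈ puiseux := by
  refine ⟨1, one_pos, fun a ha => ⟨-1, ?_⟩⟩
  by_contra hne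
  exact ha (HahnSeries.coeff_single_of_ne (by simpa using hne))

/-- `z⁻¹ ∈ 𝒫`. -/
def zInv : Puiseux := (⟨zpow (-1), zpow_neg_one_mem⟩ : puiseux)

/-- The elementary cell `E_{q,R} = diag(q I_n + R, ξ(q) I_n + R, …, ξ^{r-1}(q) I_n + R) z⁻¹`,
where `r` is the ramification index of `q`. -/
def htlCell (q : Puiseux) {n : ℕ} (R : Matrix (Fin n) (Fin n) ℂ) :
    Matrix (Fin n × Fin (ramificationIndex (Puiseux.val q))) (Fin n × Fin (ramificationIndex (Puiseux.val q)))
      Puiseux :=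
  Matrix.blockDiagonal fun k : Fin (ramificationIndex (Puiseux.val q)) =>
    zInv • (Matrix.scalar (Fin n) (xiP^[(k : ℕ)] q) + R.map (algebraMap ℂ Puiseux))

/-- The differential module over `ℂ({z})` has the matrix `E` as its
Hukuhara-Turrittin-Levelt normal form: `E` is the matrix of `𝒫 ⊗ M` in a suitable basis. -/
def HasNormalForm {M : Type*} [AddCommGroup M] [Module ConvL M] [Module ℂ M]
    [IsScalarTower ℂ ConvL M] (c : Connection dConv M) {ι : Type*} [Fintype ι]
    (E : Matrix ι ι Puiseux) : Prop :=
  ∃ b : Module.Basis ι Puiseux (Puiseux ⊗[ConvL] M), (puiseuxExtension c).IsMatrix b E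

/-! ### Plane curve germs and the Milnor number -/

/-- Absolute convergence of `F(x₀, x₁)` on the polydisc of radius `ρ`. -/
def PolySummableAt (F : MvPowerSeries (Fin 2) ℂ) (ρ : ℝ) : Prop :=
  Summable fun n : Fin 2 →₀ ℕ => ‖MvPowerSeries.coeff n F‖ * ρ ^ n.degree

theorem polySummableAt_of_le {F : MvPowerSeries (Fin 2) ℂ} {ρ σ : ℝ} (hσ : 0 < σ) (h : σ ≤ ρ)
    (hF : PolySummableAt F ρ) : PolySummableAt F σ :=
  Summable.of_nonneg_of_le (fun n => by positivity) (fun n => by gcongr) hF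

theorem PolySummableAt.mul {F G : MvPowerSeries (Fin 2) ℂ} {ρ : ℝ} (hρ : 0 < ρ)
    (hF : PolySummableAt F ρ) (hG : PolySummableAt G ρ) : PolySummableAt (F * G) ρ := by
  classical
  have hs := summable_sum_mul_antidiagonal_of_summable_mul
    (Summable.mul_of_nonneg hF hG (fun n => by positivity) (fun n => by positivity))
  refine Summable.of_nonneg_of_le (fun n => by positivity) (fun n => ?_) hs
  rw [MvPowerSeries.coeff_mul]
  calc _ ≤ (∑ p ∈ Finset.HasAntidiagonal.antidiagonal n,
          ‖MvPowerSeries.coeff p.1 F‖ * ‖MvPowerSeries.coeff p.2 G‖) * ρ ^ n.degree := by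
        gcongr
        refine (norm_sum_le _ _).trans (le_of_eq ?_)
        exact Finset.sum_congr rfl fun p _ => norm_mul _ _
    _ = _ := by
        rw [Finset.sum_mul]
        refine Finset.sum_congr rfl fun p hp => ?_
        rw [← Finset.HasAntidiagonal.mem_antidiagonal.1 hp, map_add, pow_add]
        ring

/-- The local ring `ℂ{x₀, x₁}` of convergent power series in two variables. -/
def convPS : Subalgebra ℂ (MvPowerSeries (Fin 2) ℂ) where
  carrier := {F | ∃ ρ : ℝ, 0 < ρ ∧ PolySummableAt F ρ}
  mul_mem' := by
    rintro f g ⟨ρ, hρ, hf⟩ ⟨σ, hσ, hg⟩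
    have h : 0 < min ρ σ := lt_min hρ hσ
    exact ⟨min ρ σ, h, (polySummableAt_of_le h (min_le_left _ _) hf).mul h
      (polySummableAt_of_le h (min_le_right _ _) hg)⟩
  add_mem' := by
    rintro f g ⟨ρ, hρ, hf⟩ ⟨σ, hσ, hg⟩
    have h : 0 < min ρ σ := lt_min hρ hσ
    refine ⟨min ρ σ, h, Summable.of_nonneg_of_le (fun a => by positivity) (fun a => ?_)
      ((polySummableAt_of_le h (min_le_left _ _) hf).add
        (polySummableAt_of_le h (min_le_right _ _) hg))⟩
    rw [← add_mul, map_add]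
    gcongr
    exact norm_add_le _ _
  algebraMap_mem' := by
    classical
    intro c
    refine ⟨1, one_pos, summable_of_ne_finset_zero (s := {0}) fun a ha => ?_⟩
    have hne : a ≠ 0 := by simpa using ha
    rw [MvPowerSeries.algebraMap_apply, MvPowerSeries.coeff_C, if_neg hne]
    simp

theorem pderiv_mem_convPS (i : Fin 2) {F : MvPowerSeries (Fin 2) ℂ} (hF : F ∈ convPS) :
    MvPowerSeries.pderiv ℂ i F ∈ convPS := by
  obtain ⟨ρ, hρ, hF⟩ := hF
  refine ⟨ρ / 2, by positivity, ?_⟩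
  have hinj : Function.Injective fun n : Fin 2 →₀ ℕ => n + Finsupp.single i 1 :=
    add_left_injective _
  refine Summable.of_nonneg_of_le (fun n => by positivity) (fun n => ?_)
    ((hF.comp_injective hinj).mul_left (2 / ρ))
  simp only [Function.comp_apply, MvPowerSeries.coeff_pderiv, norm_mul, map_add,
    Finsupp.degree_single]
  have h1 : ‖((n i : ℂ) + 1)‖ ≤ 2 ^ (n.degree + 1) := by
    have h2 : ‖((n i : ℂ) + 1)‖ = ((n i + 1 : ℕ) : ℝ) := by
      rw [← Nat.cast_succ, Complex.norm_natCast]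
    rw [h2]
    have h3 : n i + 1 ≤ n.degree + 1 := by
      have := Finsupp.le_degree i n
      omega
    calc ((n i + 1 : ℕ) : ℝ) ≤ ((n.degree + 1 : ℕ) : ℝ) := by exact_mod_cast h3
      _ ≤ 2 ^ (n.degree + 1) := by exact_mod_cast (Nat.lt_two_pow_self).le
  calc ‖MvPowerSeries.coeff (n + Finsupp.single i 1) F‖ * ‖((n i : ℂ) + 1)‖ * (ρ / 2) ^ n.degree
      ≤ ‖MvPowerSeries.coeff (n + Finsupp.single i 1) F‖ * 2 ^ (n.degree + 1)
          * (ρ / 2) ^ n.degree := by gcongr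
    _ = _ := by
      rw [div_pow]
      field_simp
      ring

/-- `∂F/∂x_i` in `ℂ{x₀, x₁}`. -/
def pd (i : Fin 2) (F : convPS) : convPS := ⟨MvPowerSeries.pderiv ℂ i F, pderiv_mem_convPS i F.2⟩

/-- The Milnor algebra `ℂ{x₀, x₁} / (∂F/∂x₀, ∂F/∂x₁)` of the germ at the origin of the
curve `F = 0`. -/
abbrev MilnorAlgebra (F : convPS) : Type := convPS ⧸ Ideal.span {pd 0 F, pd 1 F}

/-- The polynomial `∏_{k < r} (ζ - z / ξ^k(f))` in `ζ`. -/
def branchPoly (r : ℕ) (f : H) : Polynomial H :=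
  ∏ k ∈ Finset.range r, (Polynomial.X - Polynomial.C (zpow 1 / xi^[k] f))

/-- The polynomial `Φ(ζ)` has coefficients in `ℂ⟦z⟧`, and `F` is its expansion in powers of
`x₀ = ζ` and `x₁ = z`. (If `F` converges, these coefficients are in `ℂ{z}`.) -/
def IsExpansion (F : MvPowerSeries (Fin 2) ℂ) (Φ : Polynomial H) : Prop :=
  (∀ i j : ℕ, MvPowerSeries.coeff (Finsupp.single 0 i + Finsupp.single 1 j) F =
      (Φ.coeff i).coeff (j : ℚ)) ∧
    ∀ (i : ℕ) (a : ℚ), (Φ.coeff i).coeff a ≠ 0 → ∃ j : ℕ, a = (j : ℚ)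

end IrregularSpectral

end

/-! Both sides of the formula are computed from the orders of the differences `ξ^k(q) - ξ^l(q)`.

Irregularity. In a Puiseux basis of eigenvectors, with matrix `B` and inverse `B'`, the connection
on endomorphisms acts on the `(k, l)` entry of `B' X B` as `z d/dz - (ξ^k(q) - ξ^l(q))`; the
constant `R` cancels. Since the coefficients of the system lie in `ℂ((z))`, the Galois generator `ξ`
permutes the eigenlines cyclically up to constants. Hence row `0` of `B' X B` determines `X`, its
entries lie in `ℂ((z^{1/r}))`, and the formal module `End(M)` becomes the sum over `l < r` of
`ℂ((z^{1/r}))` with the operators `z d/dz - (q - ξ^l(q))` (`EigenFrame.diagonalizes`). Each of these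
has index `0` on formal Laurent series. With `ord(q - ξ^l(q)) = -p_l / r`, comparing lattices gives
the index `∑ p_l - m n` from formal power series to series with a pole of order at most `m`, where
`n` is the rank (`Diagonalizes.hasIdxOn_lattice`).

On convergent lattices the index is `-m n`, whatever the system is (`hasIdx_singularOp`): on high
exponents `z d/dz` dominates the bounded coefficient operator, so a Neumann series inverts the
system up to finitely many coordinates, and the regularity of solutions makes the index independent
of the radius. Convergent Laurent series and formal power series together span all formal Laurent
series and meet in convergent power series. The parallelogram law for indices (`HasIdxOn.inf_sup`)
therefore gives the index `-∑ p_l` on convergent Laurent vectors, so that `Irr(End M) = ∑ p_l = -r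
∑_l ord(q - ξ^l(q))`.

Milnor number. Let `ζ_k = z / ξ^k(q̃)` be the roots of `F`. The Milnor number is the intersection
multiplicity of `F_ζ` and `F_z`, which is the order of their resultant, i.e. the sum of `ord F_z(γ)`
over the Puiseux roots `γ` of `F_ζ` (`finrank_quotient_span_pair`, with Newton–Puiseux in
`exists_puiseux_root`). The chain rule at such a root gives `F_z(γ) = d/dz (F(γ))`, of order `ord
F(γ) - 1`. Evaluating `∏ (γ - ζ_k)` in both ways turns `∑_γ ord F(γ)` into `∑_k ord F_ζ(ζ_k)`, so `μ
= ∑_{k ≠ l} ord(ζ_k - ζ_l) - (r - 1)` (`finrank_milnorAlgebra`).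

Finally `ord(ζ_k - ζ_l) = 1 + 2p/r + ord(ξ^k(q) - ξ^l(q))`, because `z/a - z/b = -z(a - b)/(ab)`.
Summing over the `r(r - 1)` pairs gives the formula. -/

noncomputable section

namespace IrregularSpectral

/-! ### Index of linear maps between complex vector spaces -/

section Index

variable {V W A B C A' B' C' : Type*}
  [AddCommGroup V] [Module ℂ V] [AddCommGroup W] [Module ℂ W]
  [AddCommGroup A] [Module ℂ A] [AddCommGroup B] [Module ℂ B] [AddCommGroup C] [Module ℂ C]
  [AddCommGroup A'] [Module ℂ A'] [AddCommGroup B'] [Module ℂ B'] [AddCommGroup C'] [Module ℂ C']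

/-- `T` has finite-dimensional kernel and cokernel, and index `i`. -/
structure HasIdx (T : V →ₗ[ℂ] W) (i : ℤ) : Prop where
  finite_ker : Module.Finite ℂ (LinearMap.ker T)
  finite_coker : Module.Finite ℂ (W ⧸ LinearMap.range T)
  eq : (Module.finrank ℂ (LinearMap.ker T) : ℤ) - Module.finrank ℂ (W ⧸ LinearMap.range T) = i

theorem HasIdx.hasIndex {T : V →ₗ[ℂ] V} {i : ℤ} (h : HasIdx T i) : HasIndex T :=
  ⟨h.1, h.2⟩

theorem HasIdx.index_eq {T : V →ₗ[ℂ] V} {i : ℤ} (h : HasIdx T i) : index T = i := h.3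

theorem HasIdx.congr {T : V →ₗ[ℂ] W} {i j : ℤ} (h : HasIdx T i) (hij : i = j) : HasIdx T j :=
  hij ▸ h

theorem HasIdx.unique {T : V →ₗ[ℂ] W} {i j : ℤ} (h : HasIdx T i) (h' : HasIdx T j) : i = j :=
  h.3.symm.trans h'.3

theorem finite_of_exact {f : A →ₗ[ℂ] B} {g : B →ₗ[ℂ] C} (h : Function.Exact f g)
    [Module.Finite ℂ A] [Module.Finite ℂ C] : Module.Finite ℂ B := by
  have hk : Module.Finite ℂ (LinearMap.ker g) := by
    rw [LinearMap.exact_iff.1 h]; infer_instance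
  have : IsNoetherian ℂ A := inferInstance
  have : IsNoetherian ℂ B := isNoetherian_of_range_eq_ker f g (LinearMap.exact_iff.1 h).symm
  infer_instance

theorem finrank_of_exact {f : A →ₗ[ℂ] B} {g : B →ₗ[ℂ] C} (h : Function.Exact f g)
    [Module.Finite ℂ B] :
    Module.finrank ℂ B = Module.finrank ℂ (LinearMap.range f)
      + Module.finrank ℂ (LinearMap.range g) := by
  rw [← LinearMap.finrank_range_add_finrank_ker g, LinearMap.exact_iff.1 h, add_comm]

/-- The index is additive in short exact sequences. -/
theorem HasIdx.of_exact {T₁ : A →ₗ[ℂ] A'} {T₂ : B →ₗ[ℂ] B'} {T₃ : C →ₗ[ℂ] C'}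
    {f : A →ₗ[ℂ] B} {g : B →ₗ[ℂ] C} {f' : A' →ₗ[ℂ] B'} {g' : B' →ₗ[ℂ] C'}
    (hf : Function.Injective f) (hfg : Function.Exact f g) (hg : Function.Surjective g)
    (hf' : Function.Injective f') (hfg' : Function.Exact f' g') (hg' : Function.Surjective g')
    (h₁ : f' ∘ₗ T₁ = T₂ ∘ₗ f) (h₂ : g' ∘ₗ T₂ = T₃ ∘ₗ g)
    {i j : ℤ} (hA : HasIdx T₁ i) (hC : HasIdx T₃ j) : HasIdx T₂ (i + j) := by
  obtain ⟨_, _, hi⟩ := hA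
  obtain ⟨_, _, hj⟩ := hC
  have e₁ (x) : f' (T₁ x) = T₂ (f x) := LinearMap.congr_fun h₁ x
  have e₂ (x) : g' (T₂ x) = T₃ (g x) := LinearMap.congr_fun h₂ x
  let F₁ : LinearMap.ker T₁ →ₗ[ℂ] LinearMap.ker T₂ := f.restrict fun x hx => by
    rw [LinearMap.mem_ker] at *; rw [← e₁, hx, map_zero]
  let F₂ : LinearMap.ker T₂ →ₗ[ℂ] LinearMap.ker T₃ := g.restrict fun x hx => by
    rw [LinearMap.mem_ker] at *; rw [← e₂, hx, map_zero]
  let G₁ : (A' ⧸ LinearMap.range T₁) →ₗ[ℂ] (B' ⧸ LinearMap.range T₂) :=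
    Submodule.mapQ _ _ f' (by rintro _ ⟨x, rfl⟩; exact ⟨f x, (e₁ x).symm⟩)
  let G₂ : (B' ⧸ LinearMap.range T₂) →ₗ[ℂ] (C' ⧸ LinearMap.range T₃) :=
    Submodule.mapQ _ _ g' (by rintro _ ⟨x, rfl⟩; exact ⟨g x, (e₂ x).symm⟩)
  -- The connecting map of the snake lemma. The six-term sequence of kernels and cokernels is exact,
  -- and the alternating sum of its dimensions is the assertion.
  let δ := SnakeLemma.δ' T₁ T₂ T₃ f g hfg f' g' hfg' h₁ h₂
    (LinearMap.ker T₃).subtype (fun y => by simp)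
    (LinearMap.range T₁).mkQ (fun y => by simp) hg hf'
  have ex₁ : Function.Exact F₁ F₂ := by
    rintro ⟨y, hy⟩
    constructor
    · intro h
      obtain ⟨x, rfl⟩ := (hfg y).1 (congrArg Subtype.val h)
      refine ⟨⟨x, ?_⟩, rfl⟩
      rw [LinearMap.mem_ker] at *
      exact hf' (by rw [e₁, hy, map_zero])
    · rintro ⟨⟨x, hx⟩, h⟩
      rw [← h]
      exact Subtype.ext ((hfg (f x)).2 ⟨x, rfl⟩)
  have ex₂ : Function.Exact F₂ δ := SnakeLemma.exact_δ'_right T₁ T₂ T₃ f g hfg f' g' hfg' h₁ h₂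
    (LinearMap.ker T₂).subtype (fun y => by simp)
    (LinearMap.ker T₃).subtype (fun y => by simp)
    (LinearMap.range T₁).mkQ (fun y => by simp) hg hf' F₂ rfl Subtype.val_injective
  have ex₃ : Function.Exact δ G₁ := SnakeLemma.exact_δ'_left T₁ T₂ T₃ f g hfg f' g' hfg' h₁ h₂
    (LinearMap.ker T₃).subtype (fun y => by simp)
    (LinearMap.range T₁).mkQ (fun y => by simp)
    (LinearMap.range T₂).mkQ (fun y => by simp) hg hf' G₁ rfl (Submodule.mkQ_surjective _)
  have ex₄ : Function.Exact G₁ G₂ := by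
    intro y
    obtain ⟨y, rfl⟩ := Submodule.mkQ_surjective _ y
    constructor
    · intro h
      have h : g' y ∈ LinearMap.range T₃ := by
        simpa [G₂, Submodule.Quotient.mk_eq_zero] using h
      obtain ⟨c, hc⟩ := h
      obtain ⟨b, rfl⟩ := hg c
      rw [← e₂] at hc
      obtain ⟨a, ha⟩ := (hfg' (y - T₂ b)).1 (by rw [map_sub, hc, sub_self])
      refine ⟨(LinearMap.range T₁).mkQ a, ?_⟩
      simp only [G₁, Submodule.mkQ_apply, Submodule.mapQ_apply, ha, Submodule.Quotient.mk_sub]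
      rw [(Submodule.Quotient.mk_eq_zero _).2 (LinearMap.mem_range_self T₂ b), sub_zero]
    · rintro ⟨a, ha⟩
      obtain ⟨a, rfl⟩ := Submodule.mkQ_surjective _ a
      rw [← ha]
      simp [G₁, G₂, (hfg' (f' a)).2 ⟨a, rfl⟩]
  have hF₁ : Function.Injective F₁ := fun x y h =>
    Subtype.ext (hf (congrArg Subtype.val h))
  have hG₂ : Function.Surjective G₂ := by
    intro c
    obtain ⟨c, rfl⟩ := Submodule.mkQ_surjective _ c
    obtain ⟨b, rfl⟩ := hg' c
    exact ⟨(LinearMap.range T₂).mkQ b, by simp [G₂]⟩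
  have hkB : Module.Finite ℂ (LinearMap.ker T₂) := finite_of_exact ex₁
  have hcB : Module.Finite ℂ (B' ⧸ LinearMap.range T₂) := finite_of_exact ex₄
  refine ⟨hkB, hcB, ?_⟩
  have r₁ := finrank_of_exact ex₁
  have r₂ := finrank_of_exact ex₂
  have r₃ := finrank_of_exact ex₃
  have r₄ := finrank_of_exact ex₄
  rw [LinearMap.finrank_range_of_inj hF₁] at r₁
  rw [LinearMap.range_eq_top.2 hG₂, finrank_top] at r₄
  omega

theorem HasIdx.of_finite [Module.Finite ℂ V] [Module.Finite ℂ W] (T : V →ₗ[ℂ] W) :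
    HasIdx T (Module.finrank ℂ V - Module.finrank ℂ W) := by
  refine ⟨inferInstance, inferInstance, ?_⟩
  have h₁ := LinearMap.finrank_range_add_finrank_ker T
  have h₂ := Submodule.finrank_quotient_add_finrank (LinearMap.range T)
  omega

theorem HasIdx.of_bijective {T : V →ₗ[ℂ] W} (hT : Function.Bijective T) : HasIdx T 0 := by
  have h₁ : LinearMap.ker T = ⊥ := LinearMap.ker_eq_bot.2 hT.1
  have h₂ : LinearMap.range T = ⊤ := LinearMap.range_eq_top.2 hT.2
  have : Subsingleton (W ⧸ LinearMap.range T) :=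
    Submodule.Quotient.subsingleton_iff.2 h₂
  have : Subsingleton (LinearMap.ker T) := by rw [h₁]; infer_instance
  exact ⟨inferInstance, inferInstance, by simp [Module.finrank_zero_of_subsingleton]⟩

/-- The index is invariant under linear equivalences. -/
theorem HasIdx.of_equiv {T : A →ₗ[ℂ] A'} {S : B →ₗ[ℂ] B'} {i : ℤ} (e : A ≃ₗ[ℂ] B)
    (e' : A' ≃ₗ[ℂ] B') (h : ∀ x, e' (T x) = S (e x)) (hT : HasIdx T i) : HasIdx S i := by
  -- An isomorphism of maps is a short exact sequence whose third term is zero, so additivity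
  -- applies.
  have hz : HasIdx (0 : PUnit.{1} →ₗ[ℂ] PUnit.{1}) 0 := (HasIdx.of_finite _).congr (by simp)
  refine (HasIdx.of_exact (f := e.toLinearMap) (f' := e'.toLinearMap) (g := (0 : B →ₗ[ℂ] PUnit.{1}))
    (g' := (0 : B' →ₗ[ℂ] PUnit.{1})) e.injective (fun y => ?_) (fun y => ⟨0, rfl⟩) e'.injective
    (fun y => ?_) (fun y => ⟨0, rfl⟩) (LinearMap.ext h) (by ext) hT hz).congr (add_zero i)
  · exact ⟨fun _ => ⟨e.symm y, by simp⟩, fun _ => rfl⟩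
  · exact ⟨fun _ => ⟨e'.symm y, by simp⟩, fun _ => rfl⟩

theorem HasIdx.prodMap {T : A →ₗ[ℂ] A'} {S : B →ₗ[ℂ] B'} {i j : ℤ} (hT : HasIdx T i)
    (hS : HasIdx S j) : HasIdx (T.prodMap S) (i + j) := by
  refine HasIdx.of_exact (f := LinearMap.inl ℂ A B) (g := LinearMap.snd ℂ A B)
    (f' := LinearMap.inl ℂ A' B') (g' := LinearMap.snd ℂ A' B') LinearMap.inl_injective
    Function.Exact.inl_snd LinearMap.snd_surjective LinearMap.inl_injective
    Function.Exact.inl_snd LinearMap.snd_surjective ?_ ?_ hT hS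
  · ext x <;> simp
  · ext x <;> simp

/-- The index of a finite direct sum of maps. -/
theorem HasIdx.pi {ι : Type*} [Fintype ι] {E E' : ι → Type*} [∀ l, AddCommGroup (E l)]
    [∀ l, Module ℂ (E l)] [∀ l, AddCommGroup (E' l)] [∀ l, Module ℂ (E' l)]
    {T : ∀ l, E l →ₗ[ℂ] E' l} {i : ι → ℤ} (h : ∀ l, HasIdx (T l) (i l)) :
    HasIdx (LinearMap.pi fun l => T l ∘ₗ LinearMap.proj l) (∑ l, i l) := by
  set P := LinearMap.pi fun l => T l ∘ₗ LinearMap.proj (R := ℂ) (φ := E) l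
  have hP (x l) : P x l = T l (x l) := rfl
  let eK : LinearMap.ker P ≃ₗ[ℂ] ∀ l, LinearMap.ker (T l) :=
    { toFun := fun x l => ⟨x.1 l, congrFun x.2 l⟩
      map_add' := fun x y => rfl
      map_smul' := fun c x => rfl
      invFun := fun x => ⟨fun l => (x l).1, funext fun l => (x l).2⟩
      left_inv := fun x => rfl
      right_inv := fun x => rfl }
  have hr : LinearMap.range P = Submodule.pi Set.univ fun l => LinearMap.range (T l) := by
    ext y
    simp only [LinearMap.mem_range, Submodule.mem_pi, Set.mem_univ, true_imp_iff]
    refine ⟨fun ⟨x, hx⟩ l => ⟨x l, by rw [← hx, hP]⟩, fun hy => ?_⟩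
    choose x hx using hy
    exact ⟨x, funext hx⟩
  classical
  let eC : ((∀ l, E' l) ⧸ LinearMap.range P) ≃ₗ[ℂ] ∀ l, E' l ⧸ LinearMap.range (T l) :=
    (Submodule.quotEquivOfEq _ _ hr).trans (Submodule.quotientPi _)
  have h₁ (l : ι) := (h l).finite_ker
  have h₂ (l : ι) := (h l).finite_coker
  refine ⟨Module.Finite.equiv eK.symm, Module.Finite.equiv eC.symm, ?_⟩
  rw [eK.finrank_eq, eC.finrank_eq, Module.finrank_pi_fintype, Module.finrank_pi_fintype]
  push_cast
  rw [← Finset.sum_sub_distrib]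
  exact Finset.sum_congr rfl fun l _ => (h l).eq

/-- Comparison with a pair of subspaces of finite codimension. -/
theorem HasIdx.of_finite_quotient {T : V →ₗ[ℂ] W} {S : Submodule ℂ V} {S' : Submodule ℂ W}
    (hS : ∀ x ∈ S, T x ∈ S') [Module.Finite ℂ (V ⧸ S)] [Module.Finite ℂ (W ⧸ S')] {i : ℤ}
    (h : HasIdx (T.restrict hS) i) :
    HasIdx T (i + (Module.finrank ℂ (V ⧸ S) - Module.finrank ℂ (W ⧸ S'))) := by
  refine HasIdx.of_exact (f := S.subtype) (g := S.mkQ) (f' := S'.subtype) (g' := S'.mkQ)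
    (T₃ := Submodule.mapQ S S' T hS)
    Subtype.val_injective (fun y => by simp) (Submodule.mkQ_surjective _)
    Subtype.val_injective (fun y => by simp) (Submodule.mkQ_surjective _) rfl rfl h
    (HasIdx.of_finite _)

/-- The Mayer–Vietoris sequence `0 → P ∩ Q → P ⊕ Q → P + Q → 0`, the source of the excision
argument. -/
theorem _root_.Submodule.inf_sup_exact {U : Type*} [AddCommGroup U] [Module ℂ U]
    (P Q : Submodule ℂ U) :
    Function.Injective ((Submodule.inclusion (inf_le_left : P ⊓ Q ≤ P)).prod
      (Submodule.inclusion (inf_le_right : P ⊓ Q ≤ Q))) ∧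
    Function.Exact ((Submodule.inclusion (inf_le_left : P ⊓ Q ≤ P)).prod
      (Submodule.inclusion (inf_le_right : P ⊓ Q ≤ Q)))
      ((Submodule.inclusion (le_sup_left : P ≤ P ⊔ Q)).coprod
        (-Submodule.inclusion (le_sup_right : Q ≤ P ⊔ Q))) ∧
    Function.Surjective ((Submodule.inclusion (le_sup_left : P ≤ P ⊔ Q)).coprod
        (-Submodule.inclusion (le_sup_right : Q ≤ P ⊔ Q))) := by
  refine ⟨fun x y h => Subtype.ext (congrArg (fun z => (z.1 : U)) h), ?_, ?_⟩
  · rintro ⟨⟨x, hx⟩, ⟨y, hy⟩⟩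
    constructor
    · intro h
      have h : x - y = 0 := by simpa [sub_eq_add_neg] using congrArg Subtype.val h
      obtain rfl := sub_eq_zero.1 h
      exact ⟨⟨x, hx, hy⟩, rfl⟩
    · rintro ⟨⟨z, hz⟩, h⟩
      rw [← h]
      ext
      simp
  · rintro ⟨z, hz⟩
    obtain ⟨x, hx, y, hy, rfl⟩ := Submodule.mem_sup.1 hz
    exact ⟨(⟨x, hx⟩, -⟨y, hy⟩), by ext; simp⟩

/-- Excision: if `B'' = A + B` and `A'' = A ∩ B`, the indices satisfy the parallelogram law. -/
theorem HasIdx.inf_sup {T : V →ₗ[ℂ] W} {S₁ S₂ : Submodule ℂ V} {S₁' S₂' : Submodule ℂ W}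
    (h₁ : ∀ x ∈ S₁, T x ∈ S₁') (h₂ : ∀ x ∈ S₂, T x ∈ S₂')
    (hi : ∀ x ∈ S₁ ⊓ S₂, T x ∈ S₁' ⊓ S₂') (hs : ∀ x ∈ S₁ ⊔ S₂, T x ∈ S₁' ⊔ S₂') {i j : ℤ}
    (hI : HasIdx (T.restrict hi) i) (hS : HasIdx (T.restrict hs) j) :
    HasIdx ((T.restrict h₁).prodMap (T.restrict h₂)) (i + j) := by
  obtain ⟨a, b, c⟩ := Submodule.inf_sup_exact S₁ S₂
  obtain ⟨a', b', c'⟩ := Submodule.inf_sup_exact S₁' S₂'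
  refine HasIdx.of_exact a b c a' b' c' ?_ ?_ hI hS
  · ext x <;> rfl
  · ext x <;> simp

/-- Excision only yields the index of a direct sum. The kernels of the summands embed in the kernel
of the sum and their cokernels are quotients of its cokernel, so each summand has an index of its
own. -/
theorem HasIdx.of_prodMap {T : A →ₗ[ℂ] A'} {S : B →ₗ[ℂ] B'} {i : ℤ}
    (h : HasIdx (T.prodMap S) i) : ∃ j k, HasIdx T j ∧ HasIdx S k ∧ j + k = i := by
  obtain ⟨h₁, h₂, h₃⟩ := h
  have f₁ : Module.Finite ℂ (LinearMap.ker T) := by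
    refine Module.Finite.of_injective ((LinearMap.inl ℂ A B).restrict (p := LinearMap.ker T)
      (q := LinearMap.ker (T.prodMap S)) fun x hx => ?_) fun x y h => ?_
    · rw [LinearMap.mem_ker] at *; simp [hx]
    · exact Subtype.ext (congrArg (fun z => z.1.1) h)
  have f₂ : Module.Finite ℂ (LinearMap.ker S) := by
    refine Module.Finite.of_injective ((LinearMap.inr ℂ A B).restrict (p := LinearMap.ker S)
      (q := LinearMap.ker (T.prodMap S)) fun x hx => ?_) fun x y h => ?_
    · rw [LinearMap.mem_ker] at *; simp [hx]
    · exact Subtype.ext (congrArg (fun z => z.1.2) h)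
  have f₃ : Module.Finite ℂ (A' ⧸ LinearMap.range T) := by
    refine Module.Finite.of_surjective (Submodule.mapQ (LinearMap.range (T.prodMap S))
      (LinearMap.range T) (LinearMap.fst ℂ A' B') ?_) fun x => ?_
    · rintro _ ⟨x, rfl⟩; exact ⟨x.1, rfl⟩
    · obtain ⟨x, rfl⟩ := Submodule.mkQ_surjective _ x
      exact ⟨Submodule.mkQ _ (x, 0), rfl⟩
  have f₄ : Module.Finite ℂ (B' ⧸ LinearMap.range S) := by
    refine Module.Finite.of_surjective (Submodule.mapQ (LinearMap.range (T.prodMap S))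
      (LinearMap.range S) (LinearMap.snd ℂ A' B') ?_) fun x => ?_
    · rintro _ ⟨x, rfl⟩; exact ⟨x.2, rfl⟩
    · obtain ⟨x, rfl⟩ := Submodule.mkQ_surjective _ x
      exact ⟨Submodule.mkQ _ (0, x), rfl⟩
  have hT : HasIdx T _ := ⟨f₁, f₃, rfl⟩
  have hS : HasIdx S _ := ⟨f₂, f₄, rfl⟩
  exact ⟨_, _, hT, hS, (hT.prodMap hS).unique ⟨h₁, h₂, h₃⟩⟩

/-- A map that becomes bijective after restriction to a subspace of codimension `a` and
projection along a subspace of dimension `b` has index `a - b`. -/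
theorem HasIdx.of_corner {T : V →ₗ[ℂ] W} {U : Submodule ℂ V} {Q : W →ₗ[ℂ] B}
    [Module.Finite ℂ (V ⧸ U)] [Module.Finite ℂ (LinearMap.ker Q)]
    (h : Function.Bijective (Q ∘ₗ T ∘ₗ U.subtype)) :
    HasIdx T (Module.finrank ℂ (V ⧸ U) - Module.finrank ℂ (LinearMap.ker Q)) := by
  let TU : U →ₗ[ℂ] W := T ∘ₗ U.subtype
  -- Bijectivity of `Q ∘ T` on `U` says exactly that `T` is injective on `U` with image
  -- complementary to `ker Q`; so `T(U)` has codimension `dim ker Q`.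
  have hc : IsCompl (LinearMap.range TU) (LinearMap.ker Q) := by
    refine ⟨Submodule.disjoint_def.2 ?_, codisjoint_iff.2 (eq_top_iff.2 ?_)⟩
    · rintro _ ⟨u, rfl⟩ hu
      rw [h.1 (show (Q ∘ₗ T ∘ₗ U.subtype) u = (Q ∘ₗ T ∘ₗ U.subtype) 0 by
        rw [map_zero]; exact hu), map_zero]
    · intro w _
      obtain ⟨u, hu⟩ := h.2 (Q w)
      exact Submodule.mem_sup.2 ⟨TU u, ⟨u, rfl⟩, w - TU u, by
        rw [LinearMap.mem_ker, map_sub, ← hu]; exact sub_self _, by abel⟩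
  let e := Submodule.quotientEquivOfIsCompl _ _ hc
  have : Module.Finite ℂ (W ⧸ LinearMap.range TU) := Module.Finite.equiv e.symm
  have hb : HasIdx (T.restrict (p := U) (q := LinearMap.range TU) fun x hx => ⟨⟨x, hx⟩, rfl⟩) 0 := by
    refine HasIdx.of_bijective ⟨fun x y hxy => ?_, ?_⟩
    · exact h.1 (congrArg (fun z => Q z.1) hxy)
    · rintro ⟨_, u, rfl⟩
      exact ⟨u, rfl⟩
  refine hb.of_finite_quotient.congr ?_
  rw [e.finrank_eq, zero_add]

end Index

end IrregularSpectral

end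

noncomputable section

namespace IrregularSpectral

/-! ### The index of a singular system on convergent power series -/

section Regular

variable {X : Type*} [AddCommGroup X] [Module ℂ X] {T : X →ₗ[ℂ] X} {D D' W W' : Submodule ℂ X}

/-- Regularity `hreg` makes the two kernels equal and the map of cokernels injective. As the indices
agree, the cokernels have the same dimension, and the map between them is also surjective. -/
theorem HasIdx.exists_add_of_regular {hD : ∀ x ∈ D, T x ∈ W} {hD' : ∀ x ∈ D', T x ∈ W'} {i : ℤ}
    (h : HasIdx (T.restrict hD) i) (hDD : D ≤ D') (hWW : W ≤ W')
    (hreg : ∀ x ∈ D', T x ∈ W → x ∈ D) (h' : HasIdx (T.restrict hD') i) :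
    ∀ g ∈ W', ∃ g₀ ∈ W, ∃ f ∈ D', g = g₀ + T f := by
  intro g hg
  have := h.finite_coker
  have := h'.finite_coker
  let eK : LinearMap.ker (T.restrict hD) ≃ₗ[ℂ] LinearMap.ker (T.restrict hD') :=
    LinearEquiv.ofBijective ((Submodule.inclusion hDD).restrict
      (p := LinearMap.ker (T.restrict hD)) (q := LinearMap.ker (T.restrict hD')) fun x hx =>
        Subtype.ext (congrArg Subtype.val hx :)) ⟨fun x y hxy =>
        Subtype.ext (Subtype.ext (congrArg (fun z => z.1.1) hxy)), fun x => by
      have hx : T x.1.1 = 0 := congrArg Subtype.val x.2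
      exact ⟨⟨⟨x.1.1, hreg _ x.1.2 (by rw [hx]; exact zero_mem _)⟩, Subtype.ext hx⟩, rfl⟩⟩
  let C : (W ⧸ LinearMap.range (T.restrict hD)) →ₗ[ℂ] (W' ⧸ LinearMap.range (T.restrict hD')) :=
    Submodule.mapQ _ _ (Submodule.inclusion hWW) (by
      rintro _ ⟨x, rfl⟩
      exact ⟨⟨x.1, hDD x.2⟩, rfl⟩)
  have hC : Function.Injective C := by
    refine (injective_iff_map_eq_zero _).2 fun y hy => ?_
    obtain ⟨y, rfl⟩ := Submodule.mkQ_surjective _ y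
    rw [Submodule.mkQ_apply, Submodule.mapQ_apply, Submodule.Quotient.mk_eq_zero] at hy
    obtain ⟨x, hx⟩ := hy
    have hx : T x.1 = y.1 := congrArg Subtype.val hx
    rw [Submodule.mkQ_apply, Submodule.Quotient.mk_eq_zero]
    exact ⟨⟨x.1, hreg _ x.2 (hx ▸ y.2)⟩, Subtype.ext hx⟩
  have hfr : Module.finrank ℂ (W ⧸ LinearMap.range (T.restrict hD)) =
      Module.finrank ℂ (W' ⧸ LinearMap.range (T.restrict hD')) := by
    have h1 := h.eq
    have h2 := h'.eq
    rw [eK.finrank_eq] at h1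
    omega
  obtain ⟨y, hy⟩ := (LinearMap.injective_iff_surjective_of_finrank_eq_finrank hfr).1 hC
    (Submodule.mkQ _ ⟨g, hg⟩)
  obtain ⟨y, rfl⟩ := Submodule.mkQ_surjective _ y
  rw [Submodule.mkQ_apply, Submodule.mkQ_apply, Submodule.mapQ_apply, eq_comm,
    Submodule.Quotient.eq] at hy
  obtain ⟨x, hx⟩ := hy
  refine ⟨y.1, y.2, x.1, x.2, ?_⟩
  have hx : T x.1 = g - y.1 := congrArg Subtype.val hx
  rw [hx]
  abel

/-- The same comparison of kernels and cokernels with surjectivity as an input. It carries the index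
from one fixed radius to the union of all radii. -/
theorem HasIdx.of_regular {hD : ∀ x ∈ D, T x ∈ W} {hD' : ∀ x ∈ D', T x ∈ W'} {i : ℤ}
    (h : HasIdx (T.restrict hD) i) (hDD : D ≤ D') (hWW : W ≤ W')
    (hreg : ∀ x ∈ D', T x ∈ W → x ∈ D) (hadd : ∀ g ∈ W', ∃ g₀ ∈ W, ∃ f ∈ D', g = g₀ + T f) :
    HasIdx (T.restrict hD') i := by
  have := h.finite_ker
  have := h.finite_coker
  let eK : LinearMap.ker (T.restrict hD) ≃ₗ[ℂ] LinearMap.ker (T.restrict hD') :=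
    LinearEquiv.ofBijective ((Submodule.inclusion hDD).restrict
      (p := LinearMap.ker (T.restrict hD)) (q := LinearMap.ker (T.restrict hD')) fun x hx =>
        Subtype.ext (congrArg Subtype.val hx :)) ⟨fun x y hxy =>
        Subtype.ext (Subtype.ext (congrArg (fun z => z.1.1) hxy)), fun x => by
      have hx : T x.1.1 = 0 := congrArg Subtype.val x.2
      exact ⟨⟨⟨x.1.1, hreg _ x.1.2 (by rw [hx]; exact zero_mem _)⟩, Subtype.ext hx⟩, rfl⟩⟩
  let C : (W ⧸ LinearMap.range (T.restrict hD)) →ₗ[ℂ] (W' ⧸ LinearMap.range (T.restrict hD')) :=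
    Submodule.mapQ _ _ (Submodule.inclusion hWW) (by
      rintro _ ⟨x, rfl⟩
      exact ⟨⟨x.1, hDD x.2⟩, rfl⟩)
  have hC : Function.Bijective C := by
    constructor
    · refine (injective_iff_map_eq_zero _).2 fun y hy => ?_
      obtain ⟨y, rfl⟩ := Submodule.mkQ_surjective _ y
      rw [Submodule.mkQ_apply, Submodule.mapQ_apply, Submodule.Quotient.mk_eq_zero] at hy
      obtain ⟨x, hx⟩ := hy
      have hx : T x.1 = y.1 := congrArg Subtype.val hx
      rw [Submodule.mkQ_apply, Submodule.Quotient.mk_eq_zero]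
      exact ⟨⟨x.1, hreg _ x.2 (hx ▸ y.2)⟩, Subtype.ext hx⟩
    · intro y
      obtain ⟨⟨g, hg⟩, rfl⟩ := Submodule.mkQ_surjective _ y
      obtain ⟨g₀, hg₀, f, hf, h⟩ := hadd g hg
      refine ⟨Submodule.mkQ _ ⟨g₀, hg₀⟩, ?_⟩
      rw [Submodule.mkQ_apply, Submodule.mkQ_apply, Submodule.mapQ_apply, eq_comm,
        Submodule.Quotient.eq]
      refine ⟨⟨f, hf⟩, Subtype.ext ?_⟩
      change T f = g - g₀
      rw [h]
      abel
  let eC := LinearEquiv.ofBijective C hC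
  exact ⟨Module.Finite.equiv eK, Module.Finite.equiv eC, by
    rw [← eK.finrank_eq, ← eC.finrank_eq]; exact h.eq⟩

end Regular

/-! ### Neumann series on weighted `ℓ¹` spaces and independence of the radius -/

section ConvergentIndex

variable {E : Type*} [NormedAddCommGroup E] [NormedSpace ℂ E]

/-- The `E`-valued sequences with `∑ ‖f n‖ ρ ^ n < ∞`. -/
def weighted (E : Type*) [NormedAddCommGroup E] [NormedSpace ℂ E] (ρ : ℝ) :
    Submodule ℂ (ℕ → E) where
  -- The absolute value makes all terms nonnegative, so that this is a subspace for every real `ρ`.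
  carrier := {f | Summable fun n => ‖f n‖ * |ρ| ^ n}
  zero_mem' := by simp [summable_zero]
  add_mem' := fun {f g} hf hg => by
    refine Summable.of_nonneg_of_le (fun n => by positivity) (fun n => ?_) (hf.add hg)
    rw [← add_mul, Pi.add_apply]
    gcongr
    exact norm_add_le _ _
  smul_mem' := fun c f hf => by
    refine (hf.mul_left ‖c‖).congr fun n => ?_
    rw [Pi.smul_apply, norm_smul, mul_assoc]

theorem mem_weighted {ρ : ℝ} (hρ : 0 < ρ) {f : ℕ → E} :
    f ∈ weighted E ρ ↔ Summable fun n => ‖f n‖ * ρ ^ n := by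
  change Summable _ ↔ _
  rw [abs_of_pos hρ]

theorem weighted_mono {σ ρ : ℝ} (hσ : 0 < σ) (h : σ ≤ ρ) : weighted E ρ ≤ weighted E σ := by
  intro f hf
  rw [mem_weighted hσ]
  rw [mem_weighted (hσ.trans_le h)] at hf
  exact Summable.of_nonneg_of_le (fun n => by positivity) (fun n => by gcongr) hf

/-- Young's inequality for `ℓ¹`; the shift by `m` only drops the first `m` terms of the Cauchy
product. -/
theorem summable_conv {a u : ℕ → ℝ} (ha : ∀ n, 0 ≤ a n) (hu : ∀ n, 0 ≤ u n) (hsa : Summable a)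
    (hsu : Summable u) (m : ℕ) :
    Summable (fun n => ∑ l ∈ Finset.range (n + m + 1), a (n + m - l) * u l) ∧
      ∑' n, ∑ l ∈ Finset.range (n + m + 1), a (n + m - l) * u l ≤ (∑' n, a n) * ∑' n, u n := by
  have hs : Summable fun n => ∑ l ∈ Finset.range (n + 1), u l * a (n - l) := by
    have := summable_norm_sum_mul_range_of_summable_norm (f := u) (g := a) hsu.norm hsa.norm
    refine this.congr fun n => ?_
    rw [Real.norm_of_nonneg]
    exact Finset.sum_nonneg fun i _ => mul_nonneg (hu _) (ha _)
  have ht := tsum_mul_tsum_eq_tsum_sum_range_of_summable_norm (f := u) (g := a) hsu.norm hsa.norm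
  have hinj : Function.Injective fun n : ℕ => n + m := add_left_injective m
  simp only [mul_comm (a _)]
  refine ⟨hs.comp_injective hinj, ?_⟩
  rw [mul_comm, ht]
  exact tsum_comp_le_tsum_of_inj hs
    (fun n => Finset.sum_nonneg fun i _ => mul_nonneg (hu _) (ha _)) hinj

variable (A : ℕ → E →L[ℂ] E) (m : ℕ)

/-- The operator `f ↦ z ^ m (z d/dz) f - A f` on power series with coefficients in `E`. -/
def singularOp : (ℕ → E) →ₗ[ℂ] (ℕ → E) where
  toFun f n := (if m ≤ n then ((n - m : ℕ) : ℂ) • f (n - m) else 0)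
    - ∑ l ∈ Finset.range (n + 1), A (n - l) (f l)
  map_add' f g := by
    ext n
    simp only [Pi.add_apply, map_add, Finset.sum_add_distrib, smul_add]
    split_ifs <;> abel
  map_smul' c f := by
    ext n
    simp only [Pi.smul_apply, map_smul, ← Finset.smul_sum, RingHom.id_apply, smul_sub]
    split_ifs
    · rw [smul_comm]
    · simp

/-- The part of `singularOp` on and onto high exponents. -/
def highOp (n₀ : ℕ) : (ℕ → E) →ₗ[ℂ] (ℕ → E) where
  toFun φ n := ((n + n₀ : ℕ) : ℂ) • φ n - ∑ l ∈ Finset.range (n + m + 1), A (n + m - l) (φ l)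
  map_add' f g := by
    ext n
    simp only [Pi.add_apply, map_add, Finset.sum_add_distrib, smul_add]
    abel
  map_smul' c f := by
    ext n
    simp only [Pi.smul_apply, map_smul, ← Finset.smul_sum, RingHom.id_apply, smul_sub]
    rw [smul_comm]

variable {A m}

/-- The weight is distributed as `ρ^n = ρ^{-m} ρ^{n+m-l} ρ^l`: lowering exponents by `m` costs the
factor `ρ^{-m}`. -/
theorem norm_conv_le {ρ : ℝ} (hρ : 0 < ρ) (φ : ℕ → E) (n : ℕ) :
    ‖∑ l ∈ Finset.range (n + m + 1), A (n + m - l) (φ l)‖ * ρ ^ n ≤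
      (ρ ^ m)⁻¹ * ∑ l ∈ Finset.range (n + m + 1),
        (‖A (n + m - l)‖ * ρ ^ (n + m - l)) * (‖φ l‖ * ρ ^ l) := by
  rw [Finset.mul_sum]
  refine (mul_le_mul_of_nonneg_right (norm_sum_le _ _) (by positivity)).trans ?_
  rw [Finset.sum_mul]
  refine Finset.sum_le_sum fun l hl => ?_
  have hl : l ≤ n + m := by simpa [Nat.lt_succ_iff] using hl
  have h1 : ρ ^ (n + m - l) * ρ ^ l = ρ ^ n * ρ ^ m := by
    rw [← pow_add, Nat.sub_add_cancel hl, pow_add]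
  calc ‖A (n + m - l) (φ l)‖ * ρ ^ n ≤ (‖A (n + m - l)‖ * ‖φ l‖) * ρ ^ n := by
        gcongr; exact ContinuousLinearMap.le_opNorm _ _
    _ = (ρ ^ m)⁻¹ * ((‖A (n + m - l)‖ * ‖φ l‖) * (ρ ^ n * ρ ^ m)) := by
        field_simp
    _ = _ := by rw [← h1]; ring

theorem summable_norm_conv {ρ : ℝ} (hρ : 0 < ρ) (hA : Summable fun k => ‖A k‖ * ρ ^ k)
    {φ : ℕ → E} (hφ : φ ∈ weighted E ρ) (m : ℕ) :
    Summable (fun n => ‖∑ l ∈ Finset.range (n + m + 1), A (n + m - l) (φ l)‖ * ρ ^ n) ∧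
      ∑' n, ‖∑ l ∈ Finset.range (n + m + 1), A (n + m - l) (φ l)‖ * ρ ^ n ≤
        (ρ ^ m)⁻¹ * (∑' k, ‖A k‖ * ρ ^ k) * ∑' n, ‖φ n‖ * ρ ^ n := by
  rw [mem_weighted hρ] at hφ
  obtain ⟨h1, h2⟩ := summable_conv (a := fun k => ‖A k‖ * ρ ^ k) (u := fun n => ‖φ n‖ * ρ ^ n)
    (fun n => by positivity) (fun n => by positivity) hA hφ m
  have hs := Summable.of_nonneg_of_le (fun n => by positivity)
    (fun n => norm_conv_le (A := A) (m := m) hρ φ n) (h1.mul_left (ρ ^ m)⁻¹)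
  refine ⟨hs, (hs.tsum_le_tsum (fun n => norm_conv_le hρ φ n) (h1.mul_left _)).trans ?_⟩
  rw [tsum_mul_left, mul_assoc]
  gcongr

/-- The differential part multiplies each coefficient by at least `n₀`, which exceeds the norm of
the convolution part. A nonzero solution would satisfy `n₀ ‖φ‖ ≤ c ‖φ‖` with `c < n₀`. -/
theorem highOp_injective {ρ : ℝ} (hρ : 0 < ρ) (hA : Summable fun k => ‖A k‖ * ρ ^ k) {n₀ : ℕ}
    (hn₀ : (ρ ^ m)⁻¹ * (∑' k, ‖A k‖ * ρ ^ k) < n₀) {φ : ℕ → E} (hφ : φ ∈ weighted E ρ)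
    (h0 : highOp A m n₀ φ = 0) : φ = 0 := by
  obtain ⟨h1, h2⟩ := summable_norm_conv hρ hA hφ m
  rw [mem_weighted hρ] at hφ
  have h3 (n : ℕ) : (n₀ : ℝ) * (‖φ n‖ * ρ ^ n)
      ≤ ‖∑ l ∈ Finset.range (n + m + 1), A (n + m - l) (φ l)‖ * ρ ^ n := by
    rw [← sub_eq_zero.1 (congrFun h0 n), norm_smul, Complex.norm_natCast, mul_assoc]
    gcongr
    omega
  have h4 := (hφ.mul_left (n₀ : ℝ)).tsum_le_tsum h3 h1
  rw [tsum_mul_left] at h4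
  have h5 : 0 ≤ ∑' n, ‖φ n‖ * ρ ^ n := tsum_nonneg fun n => by positivity
  have h6 : ∑' n, ‖φ n‖ * ρ ^ n = 0 := by
    by_contra hne
    have := mul_lt_mul_of_pos_right hn₀ (lt_of_le_of_ne h5 (Ne.symm hne))
    linarith
  funext n
  have := (hφ.hasSum_iff.2 h6)
  rw [hasSum_zero_iff_of_nonneg fun n => by positivity] at this
  have := congrFun this n
  simpa [hρ.ne'] using this

/-- Dividing by `n + n₀` turns the equation into `v - K v = w` with `‖K‖ < 1`, which a Neumann
series solves in the Banach space `ℓ¹`. -/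
theorem highOp_surjective [CompleteSpace E] {ρ : ℝ} (hρ : 0 < ρ)
    (hA : Summable fun k => ‖A k‖ * ρ ^ k) {n₀ : ℕ}
    (hn₀ : (ρ ^ m)⁻¹ * (∑' k, ‖A k‖ * ρ ^ k) < n₀) {γ : ℕ → E} (hγ : γ ∈ weighted E ρ) :
    ∃ φ ∈ weighted E ρ, highOp A m n₀ φ = γ := by
  have hn₀pos : (0 : ℝ) < n₀ := lt_of_le_of_lt
    (mul_nonneg (by positivity) (tsum_nonneg fun n => by positivity)) hn₀
  have hρn (n : ℕ) : ((ρ : ℂ) ^ n) ≠ 0 := pow_ne_zero _ (by exact_mod_cast hρ.ne')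
  have hnρ (n : ℕ) : ‖((ρ : ℂ) ^ n)‖ = ρ ^ n := by
    rw [norm_pow, Complex.norm_real, Real.norm_of_nonneg hρ.le]
  have hmem (v : ℕ → E) : Memℓp v 1 ↔ Summable fun n => ‖v n‖ := by
    rw [memℓp_gen_iff (by simp)]; simp
  have hnorm (v : lp (fun _ : ℕ => E) 1) : ‖v‖ = ∑' n, ‖v n‖ := by
    rw [lp.norm_eq_tsum_rpow (by simp)]; simp
  -- Rescaling by `ρ^n` identifies the weighted space with the unweighted `ℓ¹`, whose completeness
  -- is available.
  let un (v : ℕ → E) : ℕ → E := fun n => ((ρ : ℂ) ^ n)⁻¹ • v n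
  have hun (v : ℕ → E) (n : ℕ) : ‖un v n‖ * ρ ^ n = ‖v n‖ := by
    simp only [un, norm_smul, norm_inv, hnρ]
    field_simp
  have hunw (v : lp (fun _ : ℕ => E) 1) : un v ∈ weighted E ρ := by
    rw [mem_weighted hρ]
    simp only [hun]
    exact (hmem _).1 v.2
  let k₀ (v : ℕ → E) : ℕ → E := fun n =>
    (((n + n₀ : ℕ) : ℂ))⁻¹ • (ρ : ℂ) ^ n • ∑ l ∈ Finset.range (n + m + 1), A (n + m - l) (un v l)
  have hk₀ (v : ℕ → E) (n : ℕ) : ‖k₀ v n‖ ≤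
      (n₀ : ℝ)⁻¹ * (‖∑ l ∈ Finset.range (n + m + 1), A (n + m - l) (un v l)‖ * ρ ^ n) := by
    simp only [k₀, norm_smul, norm_inv, Complex.norm_natCast, hnρ]
    rw [mul_comm (ρ ^ n)]
    gcongr
    omega
  have hk₀s (v : lp (fun _ : ℕ => E) 1) : Summable fun n => ‖k₀ v n‖ :=
    Summable.of_nonneg_of_le (fun n => norm_nonneg _) (hk₀ v)
      ((summable_norm_conv hρ hA (hunw v) m).1.mul_left _)
  -- The bound for `‖K‖`; it is less than `1` by the choice of `n₀`.
  set c : ℝ := (n₀ : ℝ)⁻¹ * ((ρ ^ m)⁻¹ * ∑' k, ‖A k‖ * ρ ^ k) with hc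
  have hc1 : c < 1 := by rwa [hc, inv_mul_lt_iff₀ hn₀pos, mul_one]
  have hka (v w : ℕ → E) : k₀ (v + w) = k₀ v + k₀ w := by
    funext n
    simp only [k₀, un, Pi.add_apply, smul_add, map_add, Finset.sum_add_distrib]
  have hks (a : ℂ) (v : ℕ → E) : k₀ (a • v) = a • k₀ v := by
    funext n
    simp only [k₀, un, Pi.smul_apply, map_smul, Finset.smul_sum, smul_smul]
    exact Finset.sum_congr rfl fun l _ => by congr 1; ring
  let Kl : lp (fun _ : ℕ => E) 1 →ₗ[ℂ] lp (fun _ : ℕ => E) 1 :=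
    { toFun := fun v => ⟨k₀ v, (hmem _).2 (hk₀s v)⟩
      map_add' := fun v w => Subtype.ext (hka v w)
      map_smul' := fun a v => Subtype.ext (hks a v) }
  let K := Kl.mkContinuous c fun v => by
    rw [hnorm, hnorm]
    refine ((hk₀s v).tsum_le_tsum (hk₀ v)
      ((summable_norm_conv hρ hA (hunw v) m).1.mul_left _)).trans ?_
    rw [tsum_mul_left, hc, mul_assoc]
    refine mul_le_mul_of_nonneg_left ?_ (by positivity)
    have := (summable_norm_conv hρ hA (hunw v) m).2
    simpa only [hun] using this
  have hK : ‖K‖ < 1 := (LinearMap.mkContinuous_norm_le' _ _).trans_lt (by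
    rw [max_lt_iff]; exact ⟨hc1, one_pos⟩)
  obtain ⟨u, hu⟩ := isUnit_one_sub_of_norm_lt_one hK
  have hw : Memℓp (fun n => (((n + n₀ : ℕ) : ℂ))⁻¹ • (ρ : ℂ) ^ n • γ n) 1 := by
    rw [hmem]
    rw [mem_weighted hρ] at hγ
    refine Summable.of_nonneg_of_le (fun n => norm_nonneg _) (fun n => ?_)
      (hγ.mul_left (n₀ : ℝ)⁻¹)
    simp only [norm_smul, norm_inv, Complex.norm_natCast, hnρ]
    rw [mul_comm (ρ ^ n)]
    gcongr
    omega
  let w : lp (fun _ : ℕ => E) 1 := ⟨_, hw⟩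
  let v : lp (fun _ : ℕ => E) 1 := (↑u⁻¹ : _ →L[ℂ] _) w
  have hv : v - K v = w := by
    have : (↑u * ↑u⁻¹ : lp (fun _ : ℕ => E) 1 →L[ℂ] lp (fun _ : ℕ => E) 1) w = w := by simp
    rw [hu] at this
    exact this
  refine ⟨un v, hunw v, funext fun n => ?_⟩
  have hvn : v n - k₀ v n = (((n + n₀ : ℕ) : ℂ))⁻¹ • (ρ : ℂ) ^ n • γ n :=
    congrFun (congrArg Subtype.val hv) n
  have hnn : ((n + n₀ : ℕ) : ℂ) ≠ 0 := by
    have : 0 < n₀ := by exact_mod_cast hn₀pos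
    exact_mod_cast (by omega : n + n₀ ≠ 0)
  have h2 := congrArg (fun x => ((ρ : ℂ) ^ n)⁻¹ • ((n + n₀ : ℕ) : ℂ) • x) hvn
  simp only [k₀, smul_sub, smul_inv_smul₀ hnn, inv_smul_smul₀ (hρn n)] at h2
  rw [← h2, smul_comm _ (_ : ℂ)]
  rfl

/-- Shrinking the radius pays for a derivative, because `n (σ/ρ)^n` is bounded. -/
theorem summable_nat_mul_of_lt {f : ℕ → E} {σ ρ : ℝ} (hσ : 0 < σ) (h : σ < ρ)
    (hf : f ∈ weighted E ρ) : (fun n : ℕ => (n : ℂ) • f n) ∈ weighted E σ := by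
  have hρ := hσ.trans h
  rw [mem_weighted hρ] at hf
  rw [mem_weighted hσ]
  have h1 : Summable fun n : ℕ => ‖((n : ℝ) ^ 1 * (σ / ρ) ^ n : ℝ)‖ :=
    summable_norm_pow_mul_geometric_of_norm_lt_one 1 (by
      rw [Real.norm_of_nonneg (by positivity)]; exact (div_lt_one hρ).2 h)
  obtain ⟨C, hC⟩ := h1.tendsto_atTop_zero.bddAbove_range
  refine Summable.of_nonneg_of_le (fun n => by positivity) (fun n => ?_) (hf.mul_left C)
  have h2 : ‖((n : ℝ) ^ 1 * (σ / ρ) ^ n : ℝ)‖ ≤ C := hC ⟨n, rfl⟩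
  rw [Real.norm_of_nonneg (by positivity), pow_one] at h2
  rw [norm_smul, Complex.norm_natCast]
  calc (n : ℝ) * ‖f n‖ * σ ^ n = ((n : ℝ) * (σ / ρ) ^ n) * (‖f n‖ * ρ ^ n) := by
        rw [div_pow]; field_simp
    _ ≤ C * (‖f n‖ * ρ ^ n) := by gcongr

/-- The domain of `z d/dz` in the space `weighted E ρ`. -/
def weightedDom (E : Type*) [NormedAddCommGroup E] [NormedSpace ℂ E] (ρ : ℝ) :
    Submodule ℂ (ℕ → E) where
  carrier := {f | f ∈ weighted E ρ ∧ (fun n : ℕ => (n : ℂ) • f n) ∈ weighted E ρ}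
  zero_mem' := ⟨zero_mem _, by
    convert zero_mem (weighted E ρ) using 1
    funext n
    exact smul_zero _⟩
  add_mem' := fun {f g} hf hg => ⟨add_mem hf.1 hg.1, by
    convert add_mem hf.2 hg.2 using 1
    funext n
    exact smul_add _ _ _⟩
  smul_mem' := fun c f hf => ⟨Submodule.smul_mem _ c hf.1, by
    convert Submodule.smul_mem _ c hf.2 using 1
    funext n
    exact smul_comm _ _ _⟩

theorem weightedDom_mono {σ ρ : ℝ} (hσ : 0 < σ) (h : σ ≤ ρ) :
    weightedDom E ρ ≤ weightedDom E σ :=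
  fun _ hf => ⟨weighted_mono hσ h hf.1, weighted_mono hσ h hf.2⟩

theorem shift_mem_weighted {ρ : ℝ} (hρ : 0 < ρ) {f : ℕ → E} (k : ℕ) :
    (fun n => f (n + k)) ∈ weighted E ρ ↔ f ∈ weighted E ρ := by
  rw [mem_weighted hρ, mem_weighted hρ, ← summable_nat_add_iff k (f := fun n => ‖f n‖ * ρ ^ n)]
  simp only [pow_add, ← mul_assoc]
  rw [summable_mul_right_iff (pow_ne_zero _ hρ.ne')]

theorem singularOp_mem {ρ : ℝ} (hρ : 0 < ρ) (hA : Summable fun k => ‖A k‖ * ρ ^ k) {f : ℕ → E}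
    (hf : f ∈ weightedDom E ρ) : singularOp A m f ∈ weighted E ρ := by
  have h1 : (fun n => ∑ l ∈ Finset.range (n + 1), A (n - l) (f l)) ∈ weighted E ρ := by
    rw [mem_weighted hρ]
    exact (summable_norm_conv hρ hA hf.1 0).1
  have h2 : (fun n => if m ≤ n then ((n - m : ℕ) : ℂ) • f (n - m) else 0) ∈ weighted E ρ := by
    rw [← shift_mem_weighted hρ m]
    simpa using hf.2
  exact sub_mem h2 h1

/-- The space of sequences vanishing below `k`. -/
def vanishBelow (E : Type*) [NormedAddCommGroup E] [NormedSpace ℂ E] (k : ℕ) :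
    Submodule ℂ (ℕ → E) where
  carrier := {f | ∀ n < k, f n = 0}
  zero_mem' := fun _ _ => rfl
  add_mem' := fun hf hg n hn => by simp [hf n hn, hg n hn]
  smul_mem' := fun c f hf n hn => by simp [hf n hn]

/-- Sequences shifted up by `k`. -/
def shiftUp (k : ℕ) (φ : ℕ → E) (n : ℕ) : E := if k ≤ n then φ (n - k) else 0

theorem shiftUp_add (k : ℕ) (φ : ℕ → E) (n : ℕ) : shiftUp k φ (n + k) = φ n := by
  simp [shiftUp]

theorem eq_shiftUp {k : ℕ} {f : ℕ → E} (hf : f ∈ vanishBelow E k) :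
    f = shiftUp k fun n => f (n + k) := by
  funext n
  unfold shiftUp
  split_ifs with h
  · exact congrArg f (Nat.sub_add_cancel h).symm
  · exact hf n (not_le.1 h)

/-- `highOp` is the corner of `singularOp` obtained by starting the source at exponent `n₀` and
reading the target from `n₀ + m`. The excess `m` of discarded target coefficients is the origin of
the index `-m dim E`. -/
theorem singularOp_shiftUp (n₀ : ℕ) (φ : ℕ → E) (n : ℕ) :
    singularOp A m (shiftUp n₀ φ) (n + (n₀ + m)) = highOp A m n₀ φ n := by
  have h1 : n + (n₀ + m) - m = n + n₀ := by omega
  simp only [singularOp, highOp, LinearMap.coe_mk, AddHom.coe_mk]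
  rw [if_pos (by omega), h1, shiftUp_add]
  congr 1
  rw [show n + (n₀ + m) + 1 = n₀ + (n + m + 1) by omega, Finset.sum_range_add]
  rw [Finset.sum_eq_zero, zero_add]
  · refine Finset.sum_congr rfl fun l _ => ?_
    rw [add_comm n₀ l, shiftUp_add]
    congr 2
    omega
  · intro l hl
    rw [shiftUp, if_neg (by simpa using hl), map_zero]

/-- The equation itself controls the derivative: `z d/dz` of the series is the right-hand side plus
a convolution, both in the weighted space. -/
theorem shiftUp_mem_weightedDom {ρ : ℝ} (hρ : 0 < ρ) (hA : Summable fun k => ‖A k‖ * ρ ^ k)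
    {n₀ : ℕ} {φ : ℕ → E} (hφ : φ ∈ weighted E ρ) (h : highOp A m n₀ φ ∈ weighted E ρ) :
    shiftUp n₀ φ ∈ weightedDom E ρ := by
  have h1 : (fun n => ∑ l ∈ Finset.range (n + m + 1), A (n + m - l) (φ l)) ∈ weighted E ρ := by
    rw [mem_weighted hρ]
    exact (summable_norm_conv hρ hA hφ m).1
  constructor
  · rw [← shift_mem_weighted hρ n₀]
    simpa only [shiftUp_add] using hφ
  · rw [← shift_mem_weighted hρ n₀]
    simp only [shiftUp_add]
    convert add_mem h h1 using 1
    funext n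
    simp [highOp]

/-- Solutions of `singularOp A m f = g` converge where `A` and `g` do. -/
theorem singularOp_regular [CompleteSpace E] {σ ρ : ℝ} (hσ : 0 < σ) (h : σ ≤ ρ)
    (hA : Summable fun k => ‖A k‖ * ρ ^ k) {f : ℕ → E} (hf : f ∈ weighted E σ)
    (hg : singularOp A m f ∈ weighted E ρ) : f ∈ weightedDom E ρ := by
  have hρ := hσ.trans_le h
  have hAσ : Summable fun k => ‖A k‖ * σ ^ k :=
    Summable.of_nonneg_of_le (fun n => by positivity) (fun n => by gcongr) hA
  -- The threshold must serve both radii: existence of a solution is used at `ρ`, uniqueness at the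
  -- smaller `σ`.
  obtain ⟨n₁, hn₁⟩ := exists_nat_gt ((ρ ^ m)⁻¹ * (∑' k, ‖A k‖ * ρ ^ k))
  obtain ⟨n₂, hn₂⟩ := exists_nat_gt ((σ ^ m)⁻¹ * (∑' k, ‖A k‖ * σ ^ k))
  set n₀ := max n₁ n₂
  have hn₁ := hn₁.trans_le (Nat.cast_le.2 (le_max_left n₁ n₂))
  have hn₂ := hn₂.trans_le (Nat.cast_le.2 (le_max_right n₁ n₂))
  set lo : ℕ → E := fun n => if n < n₀ then f n else 0
  set φ : ℕ → E := fun n => f (n + n₀)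
  have hlo : lo ∈ weightedDom E ρ := by
    constructor <;> rw [mem_weighted hρ] <;>
    refine summable_of_ne_finset_zero (s := Finset.range n₀) fun n hn => ?_ <;>
    simp [lo, show ¬ n < n₀ by simpa using hn]
  have hsplit : f = lo + shiftUp n₀ φ := by
    funext n
    by_cases hn : n < n₀
    · simp [lo, shiftUp, hn, not_le.2 hn]
    · simp [lo, shiftUp, φ, hn, not_lt.1 hn]
  have hφ : φ ∈ weighted E σ := (shift_mem_weighted hσ n₀).2 hf
  have hS : singularOp A m (shiftUp n₀ φ) ∈ weighted E ρ := by
    have : singularOp A m (shiftUp n₀ φ) = singularOp A m f - singularOp A m lo := by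
      rw [← map_sub]
      congr 1
      rw [hsplit]
      abel
    rw [this]
    exact sub_mem hg (singularOp_mem hρ hA hlo)
  have hγ : highOp A m n₀ φ ∈ weighted E ρ := by
    have := (shift_mem_weighted hρ (n₀ + m)).2 hS
    simpa only [singularOp_shiftUp] using this
  -- A solution `φ'` at the large radius is also one at the small radius, where it must coincide
  -- with `φ`.
  obtain ⟨φ', hφ', he⟩ := highOp_surjective hρ hA hn₁ hγ
  have hz := highOp_injective hσ hAσ hn₂ (sub_mem hφ (weighted_mono hσ h hφ')) (by
    rw [map_sub, he, sub_self])
  obtain rfl := sub_eq_zero.1 hz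
  rw [hsplit]
  exact add_mem hlo (shiftUp_mem_weightedDom hρ hA hφ' hγ)

theorem finrank_quotient_vanishBelow [FiniteDimensional ℂ E] (V : Submodule ℂ (ℕ → E)) (k : ℕ)
    (hV : ∀ f : ℕ → E, (∀ n, k ≤ n → f n = 0) → f ∈ V) :
    Module.Finite ℂ (V ⧸ (vanishBelow E k).comap V.subtype) ∧
    Module.finrank ℂ (V ⧸ (vanishBelow E k).comap V.subtype) = k * Module.finrank ℂ E := by
  let R : V →ₗ[ℂ] (Fin k → E) := LinearMap.pi fun i => LinearMap.proj (i : ℕ) ∘ₗ V.subtype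
  have hR : Function.Surjective R := by
    intro y
    refine ⟨⟨fun n => if h : n < k then y ⟨n, h⟩ else 0, hV _ fun n hn => ?_⟩, ?_⟩
    · simp [not_lt.2 hn]
    · funext i
      simp [R]
  have hk : LinearMap.ker R = (vanishBelow E k).comap V.subtype := by
    ext f
    constructor
    · intro h n hn
      exact congrFun h ⟨n, hn⟩
    · intro h
      funext i
      exact h i i.2
  rw [← hk]
  let e := R.quotKerEquivOfSurjective hR
  exact ⟨Module.Finite.equiv e.symm, by rw [e.finrank_eq, Module.finrank_pi_fintype]; simp⟩

theorem finrank_ker_shift [FiniteDimensional ℂ E] (V : Submodule ℂ (ℕ → E)) (k : ℕ)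
    (hV : ∀ f : ℕ → E, (∀ n, k ≤ n → f n = 0) → f ∈ V) (Q : V →ₗ[ℂ] V)
    (hQ : ∀ f n, (Q f : ℕ → E) n = (f : ℕ → E) (n + k)) :
    Module.Finite ℂ (LinearMap.ker Q) ∧
    Module.finrank ℂ (LinearMap.ker Q) = k * Module.finrank ℂ E := by
  have hker (f : V) : f ∈ LinearMap.ker Q ↔ ∀ n, k ≤ n → (f : ℕ → E) n = 0 := by
    rw [LinearMap.mem_ker]
    constructor
    · intro h n hn
      have := hQ f (n - k)
      rw [h, Nat.sub_add_cancel hn] at this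
      exact this.symm
    · intro h
      exact Subtype.ext (funext fun n => by rw [hQ, h _ (by omega)]; rfl)
  let e : LinearMap.ker Q ≃ₗ[ℂ] (Fin k → E) :=
    { toFun := fun f i => (f : V).1 i
      map_add' := fun _ _ => rfl
      map_smul' := fun _ _ => rfl
      invFun := fun y => ⟨⟨fun n => if h : n < k then y ⟨n, h⟩ else 0, hV _ fun n hn => by
        simp [not_lt.2 hn]⟩, (hker _).2 fun n hn => by simp [not_lt.2 hn]⟩
      left_inv := fun f => by
        refine Subtype.ext (Subtype.ext (funext fun n => ?_))
        by_cases hn : n < k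
        · simp [hn]
        · simp [hn, (hker f).1 f.2 n (not_lt.1 hn)]
      right_inv := fun y => by
        funext i
        simp }
  exact ⟨Module.Finite.equiv e.symm, by rw [e.finrank_eq, Module.finrank_pi_fintype]; simp⟩

/-- The index at a fixed radius. -/
theorem hasIdx_singularOp_weighted [FiniteDimensional ℂ E] {ρ : ℝ} (hρ : 0 < ρ)
    (hA : Summable fun k => ‖A k‖ * ρ ^ k) :
    HasIdx ((singularOp A m).restrict (p := weightedDom E ρ) (q := weighted E ρ)
      fun _ hf => singularOp_mem hρ hA hf) (-(m * Module.finrank ℂ E : ℤ)) := by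
  have : CompleteSpace E := FiniteDimensional.complete ℂ E
  obtain ⟨n₀, hn₀⟩ := exists_nat_gt ((ρ ^ m)⁻¹ * (∑' k, ‖A k‖ * ρ ^ k))
  have hfs (k : ℕ) (f : ℕ → E) (hf : ∀ n, k ≤ n → f n = 0) : f ∈ weightedDom E ρ := by
    constructor <;> rw [mem_weighted hρ] <;>
    refine summable_of_ne_finset_zero (s := Finset.range k) fun n hn => ?_ <;>
    simp [hf n (by simpa using hn)]
  let Q : weighted E ρ →ₗ[ℂ] weighted E ρ :=
    { toFun := fun f => ⟨fun n => f.1 (n + (n₀ + m)), (shift_mem_weighted hρ _).2 f.2⟩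
      map_add' := fun _ _ => rfl
      map_smul' := fun _ _ => rfl }
  obtain ⟨_, h1⟩ := finrank_quotient_vanishBelow (weightedDom E ρ) n₀ (hfs n₀)
  obtain ⟨_, h2⟩ := finrank_ker_shift (weighted E ρ) (n₀ + m) (fun f hf => (hfs _ f hf).1) Q
    fun _ _ => rfl
  -- The corner has codimension `n₀ dim E` in the source and omits `(n₀ + m) dim E` dimensions of
  -- the target.
  refine (HasIdx.of_corner (U := (vanishBelow E n₀).comap (weightedDom E ρ).subtype) (Q := Q)
    ⟨?_, ?_⟩).congr ?_
  · refine (injective_iff_map_eq_zero _).2 ?_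
    rintro ⟨⟨f, hf⟩, hfv⟩ h
    have hf' := eq_shiftUp (show f ∈ vanishBelow E n₀ from hfv)
    have h3 : highOp A m n₀ (fun n => f (n + n₀)) = 0 := by
      funext n
      rw [← singularOp_shiftUp, ← hf']
      exact congrFun (congrArg Subtype.val h) n
    have h4 := highOp_injective hρ hA hn₀ ((shift_mem_weighted hρ n₀).2 hf.1) h3
    refine Subtype.ext (Subtype.ext ?_)
    change f = 0
    rw [hf', h4]
    funext n
    simp [shiftUp]
  · rintro ⟨γ, hγ⟩
    obtain ⟨φ, hφ, h⟩ := highOp_surjective hρ hA hn₀ hγ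
    subst h
    refine ⟨⟨⟨shiftUp n₀ φ, shiftUp_mem_weightedDom hρ hA hφ hγ⟩, fun n hn => ?_⟩, ?_⟩
    · exact if_neg (not_le.2 hn)
    · exact Subtype.ext (funext fun n => singularOp_shiftUp n₀ φ n)
  · rw [h1, h2]
    push_cast
    ring

/-- The convergent power series with coefficients in `E`. -/
def convSeq (E : Type*) [NormedAddCommGroup E] [NormedSpace ℂ E] : Submodule ℂ (ℕ → E) where
  carrier := {f | ∃ ρ, 0 < ρ ∧ f ∈ weighted E ρ}
  zero_mem' := ⟨1, one_pos, zero_mem _⟩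
  add_mem' := by
    rintro f g ⟨ρ, hρ, hf⟩ ⟨σ, hσ, hg⟩
    have h : 0 < min ρ σ := lt_min hρ hσ
    exact ⟨min ρ σ, h, add_mem (weighted_mono h (min_le_left _ _) hf)
      (weighted_mono h (min_le_right _ _) hg)⟩
  smul_mem' := by
    rintro c f ⟨ρ, hρ, hf⟩
    exact ⟨ρ, hρ, Submodule.smul_mem _ c hf⟩

theorem exists_weightedDom {f : ℕ → E} (hf : f ∈ convSeq E) {ρ : ℝ} (hρ : 0 < ρ) :
    ∃ σ, 0 < σ ∧ σ ≤ ρ ∧ f ∈ weightedDom E σ := by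
  obtain ⟨τ, hτ, hf⟩ := hf
  have h : 0 < min τ ρ := lt_min hτ hρ
  refine ⟨min τ ρ / 2, by positivity, (half_le_self h.le).trans (min_le_right _ _), ?_, ?_⟩
  · exact weighted_mono (by positivity) ((half_le_self h.le).trans (min_le_left _ _)) hf
  · exact summable_nat_mul_of_lt (by positivity)
      ((half_lt_self h).trans_le (min_le_left _ _)) hf

theorem singularOp_mem_convSeq {ρ : ℝ} (hρ : 0 < ρ) (hA : Summable fun k => ‖A k‖ * ρ ^ k)
    {f : ℕ → E} (hf : f ∈ convSeq E) : singularOp A m f ∈ convSeq E := by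
  obtain ⟨σ, hσ, h, hf⟩ := exists_weightedDom hf hρ
  exact ⟨σ, hσ, singularOp_mem hσ
    (Summable.of_nonneg_of_le (fun n => by positivity) (fun n => by gcongr) hA) hf⟩

/-- The index on convergent power series. -/
theorem hasIdx_singularOp [FiniteDimensional ℂ E] {ρ : ℝ} (hρ : 0 < ρ)
    (hA : Summable fun k => ‖A k‖ * ρ ^ k) :
    HasIdx ((singularOp A m).restrict (p := convSeq E) (q := convSeq E)
      fun _ hf => singularOp_mem_convSeq hρ hA hf) (-(m * Module.finrank ℂ E : ℤ)) := by
  have : CompleteSpace E := FiniteDimensional.complete ℂ E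
  have hAσ {σ : ℝ} (hσ : 0 < σ) (h : σ ≤ ρ) : Summable fun k => ‖A k‖ * σ ^ k :=
    Summable.of_nonneg_of_le (fun n => by positivity) (fun n => by gcongr) hA
  let T {σ : ℝ} (hσ : 0 < σ) (h : σ ≤ ρ) : weightedDom E σ →ₗ[ℂ] weighted E σ :=
    (singularOp A m).restrict fun _ hf => singularOp_mem hσ (hAσ hσ h) hf
  have hT {σ : ℝ} (hσ : 0 < σ) (h : σ ≤ ρ) : HasIdx (T hσ h) (-(m * Module.finrank ℂ E : ℤ)) :=
    hasIdx_singularOp_weighted hσ (hAσ hσ h)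
  have hreg {f : ℕ → E} (hf : f ∈ convSeq E) (hg : singularOp A m f ∈ weighted E ρ) :
      f ∈ weightedDom E ρ := by
    obtain ⟨σ, hσ, h, hf⟩ := exists_weightedDom hf hρ
    exact singularOp_regular hσ h hA hf.1 hg
  have hT₀ := hT hρ le_rfl
  refine hT₀.of_regular (fun f hf => ⟨ρ, hρ, hf.1⟩) (fun f hf => ⟨ρ, hρ, hf⟩)
    (fun f hf => hreg hf) ?_
  rintro g ⟨τ, hτ, hg⟩
  -- Below both `ρ` and the radius of `g` the index is the same as at `ρ`; so `g` is, modulo the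
  -- image, a series converging at `ρ`.
  have hσ := lt_min hτ hρ
  have h := min_le_right τ ρ
  obtain ⟨g₀, hg₀, f, hf, h⟩ := hT₀.exists_add_of_regular (weightedDom_mono hσ h)
    (weighted_mono hσ h) (fun f hf => hreg ⟨_, hσ, hf.1⟩) (hT hσ h) g
    (weighted_mono hσ (min_le_left τ ρ) hg)
  exact ⟨g₀, hg₀, f, ⟨_, hσ, hf.1⟩, h⟩

end ConvergentIndex

end IrregularSpectral

end

noncomputable section

namespace IrregularSpectral

/-! ### The ambient field and its subfields -/

section Ambient

theorem le_orderTop_mul {f g : H} {a b : ℚ} (hf : (a : WithTop ℚ) ≤ f.orderTop)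
    (hg : (b : WithTop ℚ) ≤ g.orderTop) : ((a + b : ℚ) : WithTop ℚ) ≤ (f * g).orderTop := by
  rw [HahnSeries.orderTop_mul, WithTop.coe_add]
  exact add_le_add hf hg

/-- The series with exponents `≥ a`. -/
def fil (a : ℚ) : Submodule ℂ H where
  carrier := {f | (a : WithTop ℚ) ≤ f.orderTop}
  zero_mem' := by simp
  add_mem' := fun {f g} hf hg => by
    rw [Set.mem_ofPred_eq] at *
    exact (le_min hf hg).trans HahnSeries.min_orderTop_le_orderTop_add
  smul_mem' := fun c f hf => by
    rw [Set.mem_ofPred_eq] at *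
    exact hf.trans (HahnSeries.orderTop_le_orderTop_smul c f)

theorem mem_fil {a : ℚ} {f : H} : f ∈ fil a ↔ (a : WithTop ℚ) ≤ f.orderTop := Iff.rfl

theorem mem_fil_iff {a : ℚ} {f : H} : f ∈ fil a ↔ ∀ x < a, f.coeff x = 0 := by
  rw [mem_fil, HahnSeries.le_orderTop_iff_forall]
  simp

theorem fil_anti {a b : ℚ} (h : a ≤ b) : fil b ≤ fil a :=
  fun _ hf => le_trans (WithTop.coe_le_coe.2 h) hf

theorem mul_mem_fil {f g : H} {a b : ℚ} (hf : f ∈ fil a) (hg : g ∈ fil b) : f * g ∈ fil (a + b) :=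
  le_orderTop_mul hf hg

theorem mem_fil_order (f : H) : f ∈ fil f.order := by
  rw [mem_fil_iff]
  exact fun x hx => HahnSeries.coeff_eq_zero_of_lt_order hx

theorem mem_fil_iff_order {f : H} (hf : f ≠ 0) {a : ℚ} : f ∈ fil a ↔ a ≤ f.order := by
  rw [mem_fil, ← HahnSeries.order_eq_orderTop_of_ne_zero hf, WithTop.coe_le_coe]

/-- A common bound for the pole orders, needed to place finite families and matrices in lattices. -/
theorem exists_nat_mem_fil {ι : Type*} [Finite ι] (f : ι → H) :
    ∃ m : ℕ, ∀ i, f i ∈ fil (-m) := by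
  cases nonempty_fintype ι
  choose m hm using fun i => exists_nat_ge (-(f i).order)
  refine ⟨Finset.univ.sup m, fun i => fil_anti ?_ (mem_fil_order (f i))⟩
  have h1 : (m i : ℚ) ≤ (Finset.univ.sup m : ℕ) := by
    exact_mod_cast Finset.le_sup (f := m) (Finset.mem_univ i)
  linarith [hm i]

theorem zpow_mul (a b : ℚ) : zpow a * zpow b = zpow (a + b) := by
  simp [zpow, HahnSeries.single_mul_single]

theorem zpow_zero : zpow 0 = 1 := rfl

theorem zpow_ne_zero (a : ℚ) : zpow a ≠ 0 := by simp [zpow]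

theorem zpow_natCast_mul (n : ℕ) (a : ℚ) : zpow a ^ n = zpow (n * a) := by
  simp [zpow, HahnSeries.single_pow]

theorem order_zpow (a : ℚ) : (zpow a).order = a := HahnSeries.order_single one_ne_zero

theorem orderTop_zpow (a : ℚ) : (zpow a).orderTop = a := HahnSeries.orderTop_single one_ne_zero

theorem zpow_mem_fil (a : ℚ) : zpow a ∈ fil a := (orderTop_zpow a).ge

theorem coeff_zpow_mul (a : ℚ) (f : H) (x : ℚ) : (zpow a * f).coeff x = f.coeff (x - a) := by
  simp [zpow, HahnSeries.coeff_single_mul]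

theorem zpow_mem_laurent (s : ℕ) (k : ℤ) : zpow ((k : ℚ) / s) ∈ laurent s := by
  intro a ha
  refine ⟨k, ?_⟩
  by_contra hne
  exact ha (HahnSeries.coeff_single_of_ne hne)

theorem single_mem_convergent (a : ℚ) (c : ℂ) : (HahnSeries.single a c : H) ∈ convergent := by
  refine ⟨1, one_pos, summable_of_ne_finset_zero (s := {a}) fun b hb => ?_⟩
  rw [HahnSeries.coeff_single_of_ne (by simpa using hb)]
  simp

theorem order_inv (f : H) : f⁻¹.order = -f.order := by
  by_cases hf : f = 0
  · simp [hf]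
  have := HahnSeries.order_mul hf (inv_ne_zero hf)
  rw [mul_inv_cancel₀ hf, HahnSeries.order_one] at this
  linarith

theorem order_div {f g : H} (hf : f ≠ 0) (hg : g ≠ 0) : (f / g).order = f.order - g.order := by
  rw [div_eq_mul_inv, HahnSeries.order_mul hf (inv_ne_zero hg), order_inv, sub_eq_add_neg]

theorem order_prod {ι : Type*} (s : Finset ι) {f : ι → H} (h : ∀ i ∈ s, f i ≠ 0) :
    (∏ i ∈ s, f i).order = ∑ i ∈ s, (f i).order := by
  classical
  induction s using Finset.induction_on with
  | empty => simp
  | insert i s hi ih =>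
    rw [Finset.prod_insert hi, Finset.sum_insert hi, HahnSeries.order_mul (h i (by simp))
      (Finset.prod_ne_zero_iff.2 fun j hj => h j (by simp [hj])),
      ih fun j hj => h j (by simp [hj])]

/-! ### Formal Laurent series in `z ^ (1/s)` -/

theorem div_le_div_iff_int {s : ℕ} (hs : 0 < s) (k l : ℤ) :
    (k : ℚ) * (s : ℚ)⁻¹ ≤ (l : ℚ) * (s : ℚ)⁻¹ ↔ k ≤ l := by
  have : (0 : ℚ) < (s : ℚ)⁻¹ := by positivity
  rw [mul_le_mul_iff_left₀ this, Int.cast_le]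

/-- The isomorphism `t ↦ z ^ (1/s)` of the field of formal Laurent series in `t` onto
`laurent s`, as a map to the ambient field. -/
def ofLaurent {s : ℕ} (hs : 0 < s) : HahnSeries ℤ ℂ →+* H :=
  HahnSeries.embDomainRingHom ((AddMonoidHom.mulRight ((s : ℚ)⁻¹)).comp (Int.castAddHom ℚ))
    (fun k l h => by
      have h : (k : ℚ) * (s : ℚ)⁻¹ = (l : ℚ) * (s : ℚ)⁻¹ := h
      exact le_antisymm ((div_le_div_iff_int hs k l).1 h.le) ((div_le_div_iff_int hs l k).1 h.ge))
    (div_le_div_iff_int hs)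

theorem coeff_ofLaurent {s : ℕ} (hs : 0 < s) (f : HahnSeries ℤ ℂ) (k : ℤ) :
    (ofLaurent hs f).coeff ((k : ℚ) / s) = f.coeff k := by
  rw [div_eq_mul_inv]
  exact HahnSeries.embDomain_coeff (a := k)

theorem ofLaurent_mem {s : ℕ} (hs : 0 < s) (f : HahnSeries ℤ ℂ) : ofLaurent hs f ∈ laurent s := by
  intro a ha
  obtain ⟨k, -, rfl⟩ := HahnSeries.support_embDomain_subset ha
  exact ⟨k, (div_eq_mul_inv _ _).symm⟩

theorem exists_ofLaurent {s : ℕ} (hs : 0 < s) {f : H} (hf : f ∈ laurent s) :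
    ∃ g, ofLaurent hs g = f := by
  have hs' : (0 : ℚ) < s := by exact_mod_cast hs
  have hb : BddBelow (Function.support fun k : ℤ => f.coeff ((k : ℚ) / s)) := by
    refine ⟨⌊f.order * s⌋, fun k hk => ?_⟩
    have h1 : f.order ≤ (k : ℚ) / s := HahnSeries.order_le_of_coeff_ne_zero hk
    rw [le_div_iff₀ hs'] at h1
    exact Int.cast_le.1 ((Int.floor_le _).trans h1)
  refine ⟨HahnSeries.ofSuppBddBelow _ hb, ?_⟩
  ext a
  by_cases ha : ∃ k : ℤ, a = (k : ℚ) / s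
  · obtain ⟨k, rfl⟩ := ha
    rw [coeff_ofLaurent]
    rfl
  · have h1 : a ∉ (ofLaurent hs (HahnSeries.ofSuppBddBelow _ hb)).support :=
      fun h => ha (ofLaurent_mem hs _ a h)
    have h2 : a ∉ f.support := fun h => ha (hf a h)
    rw [HahnSeries.mem_support, not_not] at h1 h2
    rw [h1, h2]

/-- `laurent s` is the image of the field of Laurent series in one variable under a ring
homomorphism of fields. -/
theorem inv_mem_laurent {s : ℕ} (hs : 0 < s) {f : H} (hf : f ∈ laurent s) : f⁻¹ ∈ laurent s := by
  obtain ⟨g, rfl⟩ := exists_ofLaurent hs hf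
  rw [← map_inv₀]
  exact ofLaurent_mem hs _

theorem laurent_le_mul {s : ℕ} (t : ℕ) (ht : 0 < t) : laurent s ≤ laurent (s * t) := by
  intro f hf a ha
  obtain ⟨k, rfl⟩ := hf a ha
  refine ⟨k * t, ?_⟩
  push_cast
  rw [mul_div_mul_right]
  positivity

theorem laurent_one_le (s : ℕ) (hs : 0 < s) : laurent 1 ≤ laurent s := by
  simpa using laurent_le_mul (s := 1) s hs

/-! ### Inverses of convergent series -/

/-- The weighted norm `∑ |f_a| ρ ^ a`. -/
def wnorm (f : H) (ρ : ℝ) : ℝ := ∑' a : ℚ, ‖f.coeff a‖ * ρ ^ (a : ℝ)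

theorem wnorm_nonneg (f : H) {ρ : ℝ} (hρ : 0 < ρ) : 0 ≤ wnorm f ρ :=
  tsum_nonneg fun a => by positivity

theorem wnorm_mul_le {f g : H} {ρ : ℝ} (hρ : 0 < ρ) (hf : SummableAt f ρ) (hg : SummableAt g ρ) :
    wnorm (f * g) ρ ≤ wnorm f ρ * wnorm g ρ := by
  have hs := hf.mul hρ hg
  set u : ℚ × ℚ → ℝ :=
    fun p => (‖f.coeff p.1‖ * ρ ^ (p.1 : ℝ)) * (‖g.coeff p.2‖ * ρ ^ (p.2 : ℝ)) with hu
  have hun : ∀ p, 0 ≤ u p := fun p => by positivity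
  have hsum : Summable u :=
    Summable.mul_of_nonneg hf hg (fun a => by positivity) (fun a => by positivity)
  have hs2 : Summable (fun x : Σ a : ℚ, {p : ℚ × ℚ // p.1 + p.2 = a} => u x.2) :=
    ((Equiv.sigmaFiberEquiv fun p : ℚ × ℚ => p.1 + p.2).summable_iff (f := u)).2 hsum
  have h1 : wnorm f ρ * wnorm g ρ = ∑' a : ℚ, ∑' p : {p : ℚ × ℚ // p.1 + p.2 = a}, u p := by
    rw [wnorm, wnorm, hf.tsum_mul_tsum hg hsum, ← hs2.tsum_sigma,
      ← (Equiv.sigmaFiberEquiv fun p : ℚ × ℚ => p.1 + p.2).tsum_eq u]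
    rfl
  rw [h1]
  refine hs.tsum_le_tsum (fun a => ?_) hs2.sigma
  have hfib : Summable (fun p : {p : ℚ × ℚ // p.1 + p.2 = a} => u p) := hs2.sigma_factor a
  set A := Finset.antidiagonal f.isPWO_support g.isPWO_support a with hA
  have hmem : ∀ p ∈ A, p.1 + p.2 = a := fun p hp => (Finset.mem_antidiagonal.1 hp).2.2
  have h1 : ‖(f * g).coeff a‖ * ρ ^ (a : ℝ) ≤ ∑ p ∈ A, u p := by
    have : ‖(f * g).coeff a‖ ≤ ∑ p ∈ A, ‖f.coeff p.1‖ * ‖g.coeff p.2‖ := by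
      rw [HahnSeries.coeff_mul]
      refine (norm_sum_le _ _).trans (le_of_eq ?_)
      exact Finset.sum_congr rfl fun p _ => norm_mul _ _
    calc ‖(f * g).coeff a‖ * ρ ^ (a : ℝ)
        ≤ (∑ p ∈ A, ‖f.coeff p.1‖ * ‖g.coeff p.2‖) * ρ ^ (a : ℝ) := by gcongr
      _ = ∑ p ∈ A, u p := by
          rw [Finset.sum_mul]
          refine Finset.sum_congr rfl fun p hp => ?_
          have := hmem p hp
          rw [hu, ← this]
          push_cast
          rw [Real.rpow_add hρ]
          ring
  refine h1.trans ?_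
  have h2 : ∑ p ∈ A, u p = ∑ p ∈ A.subtype (fun p => p.1 + p.2 = a), u p :=
    (Finset.sum_subtype_of_mem u hmem).symm
  rw [h2]
  exact hfib.sum_le_tsum _ (fun p _ => hun p)

theorem summableAt_one (ρ : ℝ) : SummableAt 1 ρ := by
  refine summable_of_ne_finset_zero (s := {0}) fun a ha => ?_
  rw [HahnSeries.coeff_one, if_neg (by simpa using ha)]
  simp

theorem wnorm_one (ρ : ℝ) : wnorm 1 ρ = 1 := by
  rw [wnorm, tsum_eq_single 0]
  · simp
  · intro a ha
    rw [HahnSeries.coeff_one, if_neg ha]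
    simp

theorem summableAt_pow {f : H} {ρ : ℝ} (hρ : 0 < ρ) (hf : SummableAt f ρ) (n : ℕ) :
    SummableAt (f ^ n) ρ ∧ wnorm (f ^ n) ρ ≤ wnorm f ρ ^ n := by
  induction n with
  | zero => simpa using ⟨summableAt_one ρ, (wnorm_one ρ).le⟩
  | succ n ih =>
    rw [pow_succ, pow_succ]
    exact ⟨ih.1.mul hρ hf, (wnorm_mul_le hρ ih.1 hf).trans
      (mul_le_mul_of_nonneg_right ih.2 (wnorm_nonneg f hρ))⟩

/-- All exponents of `f` are at least `δ = ord f > 0`, so shrinking the radius by `τ ≤ 1` multiplies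
every term, hence the norm `B`, by at most `τ^δ`. -/
theorem exists_wnorm_lt_one {f : H} (hf : f ∈ convergent) (h0 : 0 < f.orderTop) :
    ∃ σ : ℝ, 0 < σ ∧ SummableAt f σ ∧ wnorm f σ < 1 := by
  obtain ⟨ρ, hρ, hf⟩ := hf
  by_cases hz : f = 0
  · exact ⟨ρ, hρ, hf, by simp [hz, wnorm]⟩
  set δ : ℝ := ((f.order : ℚ) : ℝ)
  have hδ : 0 < δ := by
    rw [← HahnSeries.order_eq_orderTop_of_ne_zero hz] at h0
    exact Rat.cast_pos.2 (WithTop.coe_lt_coe.1 h0)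
  set B := wnorm f ρ
  have hB : 0 ≤ B := wnorm_nonneg f hρ
  -- Chosen so that `τ^δ = 1/(B + 1)`, which brings the norm below `B/(B + 1) < 1`.
  set τ : ℝ := (B + 1)⁻¹ ^ δ⁻¹
  have hτ : 0 < τ := by positivity
  have hτ1 : τ ≤ 1 := Real.rpow_le_one (by positivity) (inv_le_one_of_one_le₀ (by linarith))
    (by positivity)
  have hτδ : τ ^ δ = (B + 1)⁻¹ := by
    rw [← Real.rpow_mul (by positivity), inv_mul_cancel₀ hδ.ne', Real.rpow_one]
  have hσ : 0 < τ * ρ := by positivity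
  have hs : SummableAt f (τ * ρ) := summableAt_of_le hσ (mul_le_of_le_one_left hρ.le hτ1) hf
  refine ⟨τ * ρ, hσ, hs, ?_⟩
  have key (a : ℚ) : ‖f.coeff a‖ * (τ * ρ) ^ (a : ℝ)
      ≤ (B + 1)⁻¹ * (‖f.coeff a‖ * ρ ^ (a : ℝ)) := by
    by_cases ha : f.coeff a = 0
    · simp [ha]
    have hle : δ ≤ (a : ℝ) := Rat.cast_le.2 (HahnSeries.order_le_of_coeff_ne_zero ha)
    have h1 : τ ^ (a : ℝ) ≤ (B + 1)⁻¹ := hτδ ▸ Real.rpow_le_rpow_of_exponent_ge hτ hτ1 hle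
    rw [Real.mul_rpow hτ.le hρ.le]
    calc ‖f.coeff a‖ * (τ ^ (a : ℝ) * ρ ^ (a : ℝ))
        = τ ^ (a : ℝ) * (‖f.coeff a‖ * ρ ^ (a : ℝ)) := by ring
      _ ≤ _ := by gcongr
  have h2 := hs.tsum_le_tsum key (hf.mul_left _)
  rw [tsum_mul_left] at h2
  refine h2.trans_lt ?_
  change (B + 1)⁻¹ * B < 1
  rw [inv_mul_lt_iff₀ (by linarith)]
  linarith

/-- The formal inverse is the geometric series in `g`. At a radius where `g` has norm less than `1`
the double series over powers and exponents converges absolutely and may be regrouped by exponents.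
-/
theorem inv_one_sub_mem_convergent {g : H} (hg : g ∈ convergent) (h0 : 0 < g.orderTop) :
    (1 - g)⁻¹ ∈ convergent := by
  have h1 : (1 - g)⁻¹ = (HahnSeries.SummableFamily.powers g).hsum :=
    inv_eq_of_mul_eq_one_right (HahnSeries.SummableFamily.one_sub_self_mul_hsum_powers h0)
  rw [h1]
  obtain ⟨σ, hσ, hs, hlt⟩ := exists_wnorm_lt_one hg h0
  refine ⟨σ, hσ, ?_⟩
  have hp (n : ℕ) : HahnSeries.SummableFamily.powers g n = g ^ n :=
    HahnSeries.SummableFamily.powers_of_orderTop_pos h0 n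
  have hsum : Summable fun x : (_ : ℕ) × ℚ => ‖(g ^ x.1).coeff x.2‖ * σ ^ (x.2 : ℝ) := by
    rw [summable_sigma_of_nonneg (fun x => by positivity)]
    refine ⟨fun n => (summableAt_pow hσ hs n).1, ?_⟩
    exact Summable.of_nonneg_of_le (fun n => wnorm_nonneg (g ^ n) hσ)
      (fun n => (summableAt_pow hσ hs n).2)
      (summable_geometric_of_lt_one (wnorm_nonneg g hσ) hlt)
  have hsum' : Summable fun x : (_ : ℚ) × ℕ => ‖(g ^ x.2).coeff x.1‖ * σ ^ (x.1 : ℝ) := by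
    let e : (_ : ℚ) × ℕ ≃ (_ : ℕ) × ℚ := ((Equiv.sigmaEquivProd ℚ ℕ).trans (Equiv.prodComm ℚ ℕ)).trans
      (Equiv.sigmaEquivProd ℕ ℚ).symm
    exact (e.summable_iff (f := fun x : (_ : ℕ) × ℚ => ‖(g ^ x.1).coeff x.2‖ * σ ^ (x.2 : ℝ))).2 hsum
  refine Summable.of_nonneg_of_le (fun a => by positivity) (fun a => ?_) hsum'.sigma
  have hfa := hsum'.sigma_factor a
  simp only at hfa ⊢
  rw [HahnSeries.SummableFamily.coeff_hsum_eq_sum, tsum_mul_right]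
  refine mul_le_mul_of_nonneg_right ?_ (by positivity)
  rw [summable_mul_right_iff (by positivity)] at hfa
  refine (norm_sum_le _ _).trans ?_
  simp only [hp]
  exact hfa.sum_le_tsum _ fun n _ => norm_nonneg _

/-- Splitting off the leading monomial reduces inversion to the geometric series. -/
theorem exists_eq_single_mul_one_sub {f : H} (hf : f ≠ 0) :
    ∃ g : H, 0 < g.orderTop ∧ g = 1 - HahnSeries.single (-f.order) f.leadingCoeff⁻¹ * f ∧
      f⁻¹ = HahnSeries.single (-f.order) f.leadingCoeff⁻¹ * (1 - g)⁻¹ := by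
  have hc : f.leadingCoeff ≠ 0 := HahnSeries.leadingCoeff_ne_zero.2 hf
  set u : H := HahnSeries.single (-f.order) f.leadingCoeff⁻¹ with hu
  have hu0 : u ≠ 0 := by rw [hu]; simpa using hf
  refine ⟨1 - u * f, ?_, rfl, ?_⟩
  · refine lt_of_lt_of_le ?_ (le_refl _)
    rw [← not_le]
    intro hle
    obtain ⟨x, hx, hne⟩ : ∃ x : ℚ, x ≤ 0 ∧ (1 - u * f).coeff x ≠ 0 := by
      have hz : 1 - u * f ≠ 0 := by
        intro h
        simp [h] at hle
      refine ⟨(1 - u * f).order, ?_, fun h => hz (HahnSeries.coeff_order_eq_zero.1 h)⟩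
      rw [← HahnSeries.order_eq_orderTop_of_ne_zero hz] at hle
      exact_mod_cast hle
    refine hne ?_
    rw [HahnSeries.coeff_sub, hu, HahnSeries.coeff_single_mul, sub_neg_eq_add]
    rcases hx.lt_or_eq with h | rfl
    · rw [HahnSeries.coeff_one, if_neg h.ne, HahnSeries.coeff_eq_zero_of_lt_order (by linarith)]
      simp
    · rw [zero_add, ← HahnSeries.leadingCoeff_eq, inv_mul_cancel₀ hc]
      simp
  · rw [sub_sub_cancel, mul_inv, mul_inv_cancel_left₀ hu0]

theorem inv_mem_convergent {f : H} (hf : f ∈ convergent) : f⁻¹ ∈ convergent := by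
  by_cases h0 : f = 0
  · simp [h0, zero_mem]
  obtain ⟨g, hg, hgd, h⟩ := exists_eq_single_mul_one_sub h0
  rw [h]
  refine mul_mem (single_mem_convergent _ _) (inv_one_sub_mem_convergent ?_ hg)
  rw [hgd]
  exact sub_mem (one_mem _) (mul_mem (single_mem_convergent _ _) hf)

theorem inv_mem_convLaurent {s : ℕ} (hs : 0 < s) {f : H} (hf : f ∈ convLaurent s) :
    f⁻¹ ∈ convLaurent s :=
  ⟨inv_mem_laurent hs hf.1, inv_mem_convergent hf.2⟩

theorem zpow_mem_convLaurent (s : ℕ) (k : ℤ) : zpow ((k : ℚ) / s) ∈ convLaurent s :=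
  ⟨zpow_mem_laurent s k, single_mem_convergent _ _⟩

theorem zpow_int_mem_convLaurent (k : ℤ) : zpow k ∈ convLaurent 1 := by
  simpa using zpow_mem_convLaurent 1 k

theorem isField_convL : IsField ConvL where
  exists_pair_ne := ⟨0, 1, fun h => zero_ne_one (congrArg ConvL.val h)⟩
  mul_comm := mul_comm
  mul_inv_cancel := fun {f} hf => ⟨(⟨f.1⁻¹, inv_mem_convLaurent one_pos f.2⟩ : convLaurent 1),
    Subtype.ext (mul_inv_cancel₀ fun h => hf (Subtype.ext h))⟩

theorem isField_formalL : IsField FormalL where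
  exists_pair_ne := ⟨0, 1, fun h => zero_ne_one (congrArg FormalL.val h)⟩
  mul_comm := mul_comm
  mul_inv_cancel := fun {f} hf => ⟨(⟨f.1⁻¹, inv_mem_laurent one_pos f.2⟩ : laurent 1),
    Subtype.ext (mul_inv_cancel₀ fun h => hf (Subtype.ext h))⟩

end Ambient

/-! ### The Galois generator -/

section Galois

theorem coeff_xi (f : H) (a : ℚ) :
    (xi f).coeff a = Complex.exp (2 * Real.pi * Complex.I * (a : ℂ)) * f.coeff a := rfl

theorem coeff_xi_iterate (l : ℕ) (f : H) (a : ℚ) :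
    (xi^[l] f).coeff a = Complex.exp (2 * Real.pi * Complex.I * (l * a : ℂ)) * f.coeff a := by
  induction l with
  | zero => simp
  | succ l ih =>
    rw [Function.iterate_succ_apply', coeff_xi, ih, ← mul_assoc, ← Complex.exp_add]
    push_cast
    ring_nf

theorem support_xi (f : H) : (xi f).support = f.support := by
  ext a
  simp [HahnSeries.mem_support, coeff_xi]

/-- `ξ` as an automorphism of the ambient field. -/
def xiHom : H →ₐ[ℂ] H where
  toFun := xi
  map_one' := by
    ext a
    rw [coeff_xi, HahnSeries.coeff_one]
    split_ifs with h <;> simp [h]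
  map_mul' f g := by
    ext a
    rw [coeff_xi, HahnSeries.coeff_mul, HahnSeries.coeff_mul]
    have h1 : Finset.antidiagonal (xi f).isPWO_support (xi g).isPWO_support a =
        Finset.antidiagonal f.isPWO_support g.isPWO_support a := by
      ext p
      simp [Finset.mem_antidiagonal, support_xi]
    rw [h1, Finset.mul_sum]
    refine Finset.sum_congr rfl fun p hp => ?_
    rw [← (Finset.mem_antidiagonal.1 hp).2.2, coeff_xi, coeff_xi]
    push_cast
    rw [mul_add, Complex.exp_add]
    ring
  map_zero' := by
    ext a
    simp [coeff_xi]
  map_add' f g := by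
    ext a
    simp [coeff_xi, mul_add]
  commutes' c := by
    ext a
    rw [HahnSeries.algebraMap_apply, HahnSeries.C_apply, coeff_xi, HahnSeries.coeff_single]
    split_ifs with h <;> simp [h]

@[simp] theorem xiHom_apply (f : H) : xiHom f = xi f := rfl

theorem xi_iterate_eq (l : ℕ) (f : H) : xi^[l] f = (xiHom ^ l) f := by
  rw [AlgHom.coe_pow]
  rfl

theorem xi_injective : Function.Injective xi := xiHom.toRingHom.injective

theorem orderTop_xi (f : H) : (xi f).orderTop = f.orderTop := by
  by_cases hf : f = 0
  · subst hf
    rw [← xiHom_apply, map_zero]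
  refine HahnSeries.orderTop_eq_of_le (g := f.order) ?_ ?_ |>.trans
    (HahnSeries.order_eq_orderTop_of_ne_zero hf)
  · rw [support_xi, HahnSeries.mem_support]
    exact fun h => hf (HahnSeries.coeff_order_eq_zero.1 h)
  · intro a ha
    rw [support_xi] at ha
    exact HahnSeries.order_le_of_coeff_ne_zero ha

theorem orderTop_xi_iterate (l : ℕ) (f : H) : (xi^[l] f).orderTop = f.orderTop := by
  induction l with
  | zero => rfl
  | succ l ih => rw [Function.iterate_succ_apply', orderTop_xi, ih]

theorem order_eq_of_orderTop_eq {f g : H} (h : f.orderTop = g.orderTop) : f.order = g.order := by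
  by_cases hf : f = 0
  · subst hf
    rw [HahnSeries.orderTop_zero, eq_comm, HahnSeries.orderTop_eq_top] at h
    rw [h]
  have hg : g ≠ 0 := by
    rintro rfl
    rw [HahnSeries.orderTop_zero, HahnSeries.orderTop_eq_top] at h
    exact hf h
  rw [← HahnSeries.order_eq_orderTop_of_ne_zero hf,
    ← HahnSeries.order_eq_orderTop_of_ne_zero hg] at h
  exact_mod_cast h

theorem order_xi_iterate (l : ℕ) (f : H) : (xi^[l] f).order = f.order :=
  order_eq_of_orderTop_eq (orderTop_xi_iterate l f)

/-- `f` is fixed by `ξ ^ s` exactly if it is a series in `z ^ (1/s)`. -/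
theorem xi_iterate_eq_self_iff {s : ℕ} (hs : 0 < s) {f : H} : xi^[s] f = f ↔ f ∈ laurent s := by
  have hs' : (s : ℚ) ≠ 0 := by exact_mod_cast hs.ne'
  have key (a : ℚ) : Complex.exp (2 * Real.pi * Complex.I * (s * a : ℂ)) = 1 ↔
      ∃ k : ℤ, a = (k : ℚ) / s := by
    rw [Complex.exp_eq_one_iff]
    refine exists_congr fun k => ?_
    rw [mul_comm (k : ℂ), mul_right_inj' Complex.two_pi_I_ne_zero, eq_div_iff hs', mul_comm a]
    exact_mod_cast Iff.rfl
  constructor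
  · intro h a ha
    have h1 := congrArg (fun g => HahnSeries.coeff g a) h
    simp only [coeff_xi_iterate] at h1
    exact (key a).1 (mul_right_cancel₀ ha (by rw [h1, one_mul]))
  · intro h
    ext a
    rw [coeff_xi_iterate]
    by_cases ha : f.coeff a = 0
    · rw [ha, mul_zero]
    · rw [(key a).2 (h a ha), one_mul]

theorem xi_eq_self_of_laurent_one {f : H} (hf : f ∈ laurent 1) : xi f = f :=
  (xi_iterate_eq_self_iff one_pos).2 hf

theorem xi_iterate_mem_laurent {s : ℕ} {f : H} (hf : f ∈ laurent s) (l : ℕ) :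
    xi^[l] f ∈ laurent s := fun a ha => hf a fun h => ha (by rw [coeff_xi_iterate, h, mul_zero])

theorem xi_iterate_mem_convergent {f : H} (hf : f ∈ convergent) (l : ℕ) :
    xi^[l] f ∈ convergent := by
  obtain ⟨ρ, hρ, hf⟩ := hf
  refine ⟨ρ, hρ, hf.congr fun a => ?_⟩
  rw [coeff_xi_iterate, norm_mul]
  have : ‖Complex.exp (2 * Real.pi * Complex.I * (l * a : ℂ))‖ = 1 := by
    have : (2 * Real.pi * Complex.I * (l * a : ℂ)) = ((2 * Real.pi * (l * a) : ℝ) : ℂ) * Complex.I := by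
      push_cast; ring
    rw [this, Complex.norm_exp_ofReal_mul_I]
  rw [this, one_mul]

/-! ### Ramification -/

variable {q : H}

theorem ramificationIndex_spec (hq : q ∈ polarAll) :
    0 < ramificationIndex q ∧ q ∈ polar (ramificationIndex q) := by
  obtain ⟨s, hs⟩ := hq
  exact Nat.sInf_mem (s := {s : ℕ | 0 < s ∧ q ∈ polar s}) ⟨s, hs⟩

theorem ramificationIndex_le {s : ℕ} (hs : 0 < s) (h : q ∈ polar s) : ramificationIndex q ≤ s :=
  Nat.sInf_le ⟨hs, h⟩

/-- Being fixed by `ξ^l` means being a series in `z^{1/l}`, which minimality of the ramification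
index excludes. Thus the `r` conjugates of `q` are distinct. -/
theorem xi_iterate_ne (hq : q ∈ polarAll) {l : ℕ} (hl : 0 < l) (h : l < ramificationIndex q) :
    xi^[l] q ≠ q := by
  intro he
  have h1 := (xi_iterate_eq_self_iff hl).1 he
  exact absurd (ramificationIndex_le hl ⟨h1, (ramificationIndex_spec hq).2.2⟩) (not_le.2 h)

theorem xi_iterate_ramificationIndex (hq : q ∈ polarAll) : xi^[ramificationIndex q] q = q :=
  (xi_iterate_eq_self_iff (ramificationIndex_spec hq).1).2 (ramificationIndex_spec hq).2.1

theorem xi_iterate_mod (hq : q ∈ polarAll) (n : ℕ) :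
    xi^[n % ramificationIndex q] q = xi^[n] q := by
  conv_rhs => rw [← Nat.mod_add_div n (ramificationIndex q), Function.iterate_add_apply,
    Function.iterate_mul]
  congr 1
  exact (Function.iterate_fixed (xi_iterate_ramificationIndex hq) _).symm

theorem xi_iterate_ne_of_mod_ne (hq : q ∈ polarAll) {m n : ℕ}
    (h : m % ramificationIndex q ≠ n % ramificationIndex q) : xi^[m] q ≠ xi^[n] q := by
  rw [← xi_iterate_mod hq m, ← xi_iterate_mod hq n]
  have hm := Nat.mod_lt m (ramificationIndex_spec hq).1
  have hn := Nat.mod_lt n (ramificationIndex_spec hq).1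
  generalize m % ramificationIndex q = a at *
  generalize n % ramificationIndex q = b at *
  have key {a b : ℕ} (hab : a < b) (hb : b < ramificationIndex q) : xi^[a] q ≠ xi^[b] q := by
    intro he
    obtain ⟨c, rfl⟩ := Nat.exists_eq_add_of_lt hab
    rw [add_assoc, Function.iterate_add_apply] at he
    exact xi_iterate_ne hq (by omega) (by omega) ((xi_injective.iterate a) he).symm
  rcases lt_or_gt_of_ne h with h | h
  · exact key h hn
  · exact (key h hm).symm

theorem order_lt_zero_of_polar {f : H} (hf : ∀ a ∈ f.support, a < 0) (h0 : f ≠ 0) :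
    f.order < 0 :=
  hf _ fun h => h0 (HahnSeries.coeff_order_eq_zero.1 h)

theorem sub_polar {f g : H} (hf : ∀ a ∈ f.support, a < 0) (hg : ∀ a ∈ g.support, a < 0) :
    ∀ a ∈ (f - g).support, a < 0 := by
  intro a ha
  by_contra h
  have h1 : f.coeff a = 0 := by by_contra hc; exact h (hf a hc)
  have h2 : g.coeff a = 0 := by by_contra hc; exact h (hg a hc)
  exact ha (by simp [h1, h2])

theorem xi_iterate_polar {f : H} (hf : ∀ a ∈ f.support, a < 0) (l : ℕ) :
    ∀ a ∈ (xi^[l] f).support, a < 0 :=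
  fun a ha => hf a fun h => ha (by rw [coeff_xi_iterate, h, mul_zero])

end Galois

/-! ### The Euler operator -/

section Euler

theorem coeff_euler (f : H) (a : ℚ) : (euler f).coeff a = (a : ℂ) * f.coeff a := rfl

theorem ddz_eq (f : H) : ddz f = zpow (-1) * euler f := rfl

theorem euler_eq (f : H) : euler f = zpow 1 * ddz f := by
  rw [ddz_eq, ← mul_assoc, zpow_mul, add_neg_cancel, zpow_zero, one_mul]

theorem euler_mem_fil {f : H} {a : ℚ} (hf : f ∈ fil a) : euler f ∈ fil a := by
  rw [mem_fil_iff] at *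
  intro x hx
  rw [coeff_euler, hf x hx, mul_zero]

theorem euler_mem_laurent {f : H} {s : ℕ} (hf : f ∈ laurent s) : euler f ∈ laurent s :=
  fun a ha => hf a fun h => ha (by rw [coeff_euler, h, mul_zero])

theorem order_ddz {f : H} (hf : f ≠ 0) (h0 : f.order ≠ 0) : ddz f ≠ 0 ∧ (ddz f).order = f.order - 1 := by
  have h1 : (ddz f).coeff (f.order - 1) ≠ 0 := by
    rw [coeff_ddz, sub_add_cancel]
    exact mul_ne_zero (by exact_mod_cast h0) fun h => hf (HahnSeries.coeff_order_eq_zero.1 h)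
  have h2 : ddz f ≠ 0 := fun h => h1 (by rw [h]; rfl)
  refine ⟨h2, le_antisymm (HahnSeries.order_le_of_coeff_ne_zero h1) ?_⟩
  have h3 : (ddz f).coeff (ddz f).order ≠ 0 := fun h => h2 (HahnSeries.coeff_order_eq_zero.1 h)
  rw [coeff_ddz] at h3
  have := HahnSeries.order_le_of_coeff_ne_zero (right_ne_zero_of_mul h3)
  linarith

/-- A solution of `z f' = λ f` with `λ` polar vanishes unless `λ` does. -/
theorem eq_zero_of_euler_eq {f g : H} (hg : ∀ a ∈ g.support, a < 0) (h0 : g ≠ 0)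
    (h : euler f = g * f) : f = 0 := by
  by_contra hf
  -- The Euler operator never lowers the order, while multiplication by `g` lowers it strictly.
  have h1 : euler f ∈ fil f.order := euler_mem_fil (mem_fil_order f)
  rw [h, mem_fil_iff_order (mul_ne_zero h0 hf), HahnSeries.order_mul h0 hf] at h1
  linarith [order_lt_zero_of_polar hg h0]

theorem exists_algebraMap_of_euler_eq_zero {f : H} (h : euler f = 0) : ∃ c : ℂ, f = algebraMap ℂ H c := by
  refine ⟨f.coeff 0, ?_⟩
  ext a
  rw [HahnSeries.algebraMap_apply, HahnSeries.C_apply, HahnSeries.coeff_single]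
  have h1 := congrArg (fun g => HahnSeries.coeff g a) h
  simp only [coeff_euler, HahnSeries.coeff_zero, mul_eq_zero] at h1
  split_ifs with ha
  · rw [ha]; rfl
  · exact h1.resolve_left (by exact_mod_cast ha)

end Euler

end IrregularSpectral

end

noncomputable section

namespace IrregularSpectral

/-! ### Relative dimensions of subspaces -/

section RelDim

variable {X Y : Type*} [AddCommGroup X] [Module ℂ X] [AddCommGroup Y] [Module ℂ Y]

/-- `A ≤ B` and `dim B / A = n` is finite. -/
structure RelDim (A B : Submodule ℂ X) (n : ℕ) : Prop where
  le : A ≤ B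
  finite : Module.Finite ℂ (B ⧸ A.submoduleOf B)
  finrank : Module.finrank ℂ (B ⧸ A.submoduleOf B) = n

theorem RelDim.of_surjective {A B : Submodule ℂ X} (h : A ≤ B) {F : Type*} [AddCommGroup F]
    [Module ℂ F] [Module.Finite ℂ F] {g : B →ₗ[ℂ] F} (hg : Function.Surjective g)
    (hk : ∀ x : B, g x = 0 ↔ (x : X) ∈ A) : RelDim A B (Module.finrank ℂ F) := by
  have : LinearMap.ker g = A.submoduleOf B := by
    ext x
    rw [LinearMap.mem_ker, hk]
    exact Iff.rfl
  have e := (Submodule.quotEquivOfEq _ _ this).symm.trans (g.quotKerEquivOfSurjective hg)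
  exact ⟨h, Module.Finite.equiv e.symm, e.finrank_eq⟩

/-- Composing `Ψ` with the projection to `B / A` gives a surjection from the larger preimage whose
kernel is the smaller one. Lattices in diagonal coordinates are compared with the original ones in
this way. -/
theorem RelDim.comap {A B : Submodule ℂ Y} {n : ℕ} (h : RelDim A B n) {Ψ : X →ₗ[ℂ] Y}
    {S : Submodule ℂ X} (hS : ∀ y ∈ B, ∃ x ∈ S, Ψ x = y) :
    RelDim (S ⊓ A.comap Ψ) (S ⊓ B.comap Ψ) n := by
  have := h.finite
  let g : ↥(S ⊓ B.comap Ψ) →ₗ[ℂ] (B ⧸ A.submoduleOf B) :=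
    (A.submoduleOf B).mkQ ∘ₗ Ψ.restrict fun x hx => hx.2
  rw [← h.finrank]
  refine RelDim.of_surjective (g := g) (inf_le_inf_left _ (Submodule.comap_mono h.le)) ?_ ?_
  · intro y
    obtain ⟨⟨y, hy⟩, rfl⟩ := Submodule.mkQ_surjective _ y
    obtain ⟨x, hx, rfl⟩ := hS y hy
    exact ⟨⟨x, hx, hy⟩, rfl⟩
  · intro x
    refine (Submodule.Quotient.mk_eq_zero _).trans ?_
    exact ⟨fun hx => ⟨x.2.1, hx⟩, fun hx => hx.2⟩

theorem RelDim.trans {A B C : Submodule ℂ X} (hAB : A ≤ B) (hBC : B ≤ C) {n : ℕ}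
    (h : RelDim A C n) : ∃ k l, RelDim A B k ∧ RelDim B C l ∧ k + l = n := by
  have := h.finite
  let f : (B ⧸ A.submoduleOf B) →ₗ[ℂ] (C ⧸ A.submoduleOf C) :=
    Submodule.mapQ _ _ (Submodule.inclusion hBC) fun x hx => hx
  let g : (C ⧸ A.submoduleOf C) →ₗ[ℂ] (C ⧸ B.submoduleOf C) :=
    Submodule.mapQ _ _ LinearMap.id fun x hx => hAB hx
  have hf : Function.Injective f := by
    refine (injective_iff_map_eq_zero _).2 fun y hy => ?_
    obtain ⟨y, rfl⟩ := Submodule.mkQ_surjective _ y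
    exact (Submodule.Quotient.mk_eq_zero _).2 ((Submodule.Quotient.mk_eq_zero _).1 hy :)
  have hg : Function.Surjective g := by
    intro y
    obtain ⟨y, rfl⟩ := Submodule.mkQ_surjective _ y
    exact ⟨Submodule.mkQ _ y, rfl⟩
  have hfg : Function.Exact f g := by
    intro y
    obtain ⟨y, rfl⟩ := Submodule.mkQ_surjective _ y
    constructor
    · intro hy
      exact ⟨Submodule.mkQ _ ⟨y.1, (Submodule.Quotient.mk_eq_zero (B.submoduleOf C)).1 hy⟩, rfl⟩
    · rintro ⟨x, hx⟩
      obtain ⟨x, rfl⟩ := Submodule.mkQ_surjective _ x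
      rw [← hx]
      exact (Submodule.Quotient.mk_eq_zero _).2 x.2
  have h1 : Module.Finite ℂ (B ⧸ A.submoduleOf B) := Module.Finite.of_injective f hf
  have h2 : Module.Finite ℂ (C ⧸ B.submoduleOf C) := Module.Finite.of_surjective g hg
  refine ⟨_, _, ⟨hAB, h1, rfl⟩, ⟨hBC, h2, rfl⟩, ?_⟩
  have h3 := finrank_of_exact hfg
  rw [LinearMap.finrank_range_of_inj hf, LinearMap.range_eq_top.2 hg, finrank_top] at h3
  rw [← h3, h.finrank]

theorem RelDim.unique {A B : Submodule ℂ X} {n k : ℕ} (h : RelDim A B n) (h' : RelDim A B k) :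
    n = k := h.finrank.symm.trans h'.finrank

theorem RelDim.pi {ι : Type*} [Fintype ι] {A B : ι → Submodule ℂ X} {n : ι → ℕ}
    (h : ∀ l, RelDim (A l) (B l) (n l)) :
    RelDim (Submodule.pi Set.univ A) (Submodule.pi Set.univ B) (∑ l, n l) := by
  have hfin (l) := (h l).finite
  have hsum : ∑ l, n l = Module.finrank ℂ (∀ l, B l ⧸ (A l).submoduleOf (B l)) := by
    rw [Module.finrank_pi_fintype]
    exact Finset.sum_congr rfl fun l _ => (h l).finrank.symm
  rw [hsum]
  let g : Submodule.pi Set.univ B →ₗ[ℂ] ∀ l, B l ⧸ (A l).submoduleOf (B l) :=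
    LinearMap.pi fun l => ((A l).submoduleOf (B l)).mkQ ∘ₗ
      (LinearMap.proj l).restrict fun x hx => hx l (Set.mem_univ l)
  refine RelDim.of_surjective (g := g) (Submodule.pi_mono fun l _ => (h l).le) ?_ ?_
  · intro y
    choose x hx using fun l => Submodule.mkQ_surjective _ (y l)
    exact ⟨⟨fun l => (x l).1, fun l _ => (x l).2⟩, funext hx⟩
  · intro x
    simp only [funext_iff, Submodule.mem_pi, Set.mem_univ, true_imp_iff]
    refine forall_congr' fun l => ?_
    exact Submodule.Quotient.mk_eq_zero _

/-- Comparison of indices for two pairs of commensurable subspaces. -/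
theorem HasIdx.of_relDim {T : X →ₗ[ℂ] Y} {S V : Submodule ℂ X} {S' V' : Submodule ℂ Y}
    (hS : ∀ x ∈ S, T x ∈ S') (hV : ∀ x ∈ V, T x ∈ V') {n n' : ℕ} (h : RelDim S V n)
    (h' : RelDim S' V' n') {i : ℤ} (hi : HasIdx (T.restrict hS) i) :
    HasIdx (T.restrict hV) (i + (n - n')) := by
  have := h.finite
  have := h'.finite
  have hS₁ : ∀ x ∈ S.submoduleOf V, T.restrict hV x ∈ S'.submoduleOf V' := fun x hx => hS _ hx
  have := HasIdx.of_finite_quotient (T := T.restrict hV) (i := i) hS₁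
    (hi.of_equiv (Submodule.submoduleOfEquivOfLe h.le).symm
      (Submodule.submoduleOfEquivOfLe h'.le).symm fun x => rfl)
  rwa [h.finrank, h'.finrank] at this

end RelDim

/-! ### Formal solutions -/

section Formal

/-- `ℂ((z^{1/s}))` as a complex vector space. -/
def lau (s : ℕ) : Submodule ℂ H := Subalgebra.toSubmodule (laurent s)

theorem mem_lau {s : ℕ} {f : H} : f ∈ lau s ↔ f ∈ laurent s := Iff.rfl

/-- The series in `z^{1/s}` with exponents `≥ a`. -/
def lauFil (s : ℕ) (a : ℚ) : Submodule ℂ H := lau s ⊓ fil a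

theorem isPWO_of_int_div {s : ℕ} (hs : 0 < s) (a : ℚ) (S : Set ℚ)
    (hS : ∀ x ∈ S, a ≤ x ∧ ∃ k : ℤ, x = (k : ℚ) / s) : S.IsPWO := by
  have hs' : (0 : ℚ) < s := by exact_mod_cast hs
  have h1 : (Set.Ici ⌊a * s⌋ : Set ℤ).IsPWO := bddBelow_Ici.isWF.isPWO
  refine (h1.image_of_monotone (f := fun k : ℤ => (k : ℚ) / s) fun k l h => ?_).mono ?_
  · have : (k : ℚ) ≤ l := by exact_mod_cast h
    change (k : ℚ) / s ≤ (l : ℚ) / s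
    gcongr
  · intro x hx
    obtain ⟨h, k, rfl⟩ := hS x hx
    rw [le_div_iff₀ hs'] at h
    exact ⟨k, Int.cast_le.1 ((Int.floor_le _).trans h), rfl⟩

theorem eq_zero_of_forall_mem_fil {f : H} {a δ : ℚ} (hδ : 0 < δ)
    (h : ∀ n : ℕ, f ∈ fil (a + n * δ)) : f = 0 := by
  ext x
  obtain ⟨n, hn⟩ := exists_nat_gt ((x - a) / δ)
  rw [div_lt_iff₀ hδ] at hn
  exact mem_fil_iff.1 (h n) x (by linarith)

variable {s : ℕ}

/-- If `N` raises orders, then `1 - N` is invertible. -/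
theorem exists_sub_eq (hs : 0 < s) {N : H →ₗ[ℂ] H} {δ : ℚ} (hδ : 0 < δ)
    (hN : ∀ a, ∀ f ∈ lauFil s a, N f ∈ lauFil s (a + δ)) {a : ℚ} {h : H} (hh : h ∈ lauFil s a) :
    ∃ f ∈ lauFil s a, f - N f = h := by
  have hpow (n : ℕ) : (N ^ n) h ∈ lauFil s (a + n * δ) := by
    induction n with
    | zero => simpa using hh
    | succ n ih =>
      rw [pow_succ', Module.End.mul_apply]
      convert hN _ _ ih using 2
      push_cast
      ring
  -- Partial sums of the Neumann series `∑ N^i h`. Each coefficient is eventually constant, because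
  -- the orders of the terms tend to infinity.
  let F (n : ℕ) : H := ∑ i ∈ Finset.range n, (N ^ i) h
  have hF (n : ℕ) : F n ∈ lauFil s a := sum_mem fun i _ =>
    ⟨(hpow i).1, fil_anti (le_add_of_nonneg_right (by positivity)) (hpow i).2⟩
  have hFs (n k : ℕ) : F (n + k) - F n ∈ fil (a + n * δ) := by
    induction k with
    | zero => simp [zero_mem]
    | succ k ih =>
      have : F (n + (k + 1)) - F n = (F (n + k) - F n) + (N ^ (n + k)) h := by
        simp only [F, ← add_assoc, Finset.sum_range_succ]
        abel
      rw [this]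
      refine add_mem ih (fil_anti ?_ (hpow (n + k)).2)
      push_cast
      have : 0 ≤ (k : ℚ) * δ := by positivity
      linarith
  -- From the stage `ν x` on, the coefficient at the exponent `x` no longer changes.
  let ν (x : ℚ) : ℕ := ⌊(x - a) / δ⌋₊ + 1
  have hν (x : ℚ) : x < a + ν x * δ := by
    have h1 : (x - a) / δ < ν x := by
      have := Nat.lt_floor_add_one ((x - a) / δ)
      push_cast [ν]
      exact this
    rw [div_lt_iff₀ hδ] at h1
    linarith
  have hstab {x : ℚ} {n : ℕ} (hx : x < a + n * δ) : (F (ν x)).coeff x = (F n).coeff x := by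
    rcases le_total (ν x) n with hle | hle
    · obtain ⟨k, rfl⟩ := Nat.exists_eq_add_of_le hle
      have h1 := mem_fil_iff.1 (hFs (ν x) k) x (hν x)
      rw [HahnSeries.coeff_sub, sub_eq_zero] at h1
      exact h1.symm
    · obtain ⟨k, hk⟩ := Nat.exists_eq_add_of_le hle
      have h1 := mem_fil_iff.1 (hFs n k) x hx
      rw [← hk, HahnSeries.coeff_sub, sub_eq_zero] at h1
      exact h1
  have hsupp : ∀ x ∈ Function.support fun x => (F (ν x)).coeff x,
      a ≤ x ∧ ∃ k : ℤ, x = (k : ℚ) / s := by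
    intro x hx
    refine ⟨?_, (hF (ν x)).1 x hx⟩
    by_contra hlt
    exact hx (mem_fil_iff.1 (hF (ν x)).2 x (not_le.1 hlt))
  let f : H := ⟨fun x => (F (ν x)).coeff x, isPWO_of_int_div hs a _ hsupp⟩
  have hf : f ∈ lauFil s a := by
    refine ⟨fun x hx => (hsupp x hx).2, mem_fil_iff.2 fun x hx => ?_⟩
    by_contra hne
    exact absurd (hsupp x hne).1 (not_le.2 hx)
  have hfF (n : ℕ) : f - F n ∈ lauFil s (a + n * δ) := by
    refine ⟨sub_mem hf.1 (hF n).1, mem_fil_iff.2 fun x hx => ?_⟩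
    rw [HahnSeries.coeff_sub, sub_eq_zero]
    exact hstab hx
  refine ⟨f, hf, sub_eq_zero.1 (eq_zero_of_forall_mem_fil hδ (a := a) fun n => ?_)⟩
  -- The sum telescopes, and `f - N f - h` has order at least `a + n δ` for every `n`.
  have htel : F n - N (F n) = h - (N ^ n) h := by
    induction n with
    | zero => simp [F]
    | succ n ih =>
      have : F (n + 1) = F n + (N ^ n) h := Finset.sum_range_succ _ _
      rw [this, map_add, pow_succ', Module.End.mul_apply]
      linear_combination ih
  have : f - N f - h = (f - F n) - N (f - F n) - (N ^ n) h := by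
    rw [map_sub]
    linear_combination htel
  rw [this]
  refine sub_mem (sub_mem (hfF n).2 (fil_anti ?_ (hN _ _ (hfF n)).2)) (hpow n).2
  linarith

theorem eq_zero_of_sub_eq_zero {N : H →ₗ[ℂ] H} {δ : ℚ} (hδ : 0 < δ)
    (hN : ∀ a, ∀ f ∈ lauFil s a, N f ∈ lauFil s (a + δ)) {f : H} (hf : f ∈ lau s)
    (h : f - N f = 0) : f = 0 := by
  have key (n : ℕ) : f ∈ lauFil s (f.order + n * δ) := by
    induction n with
    | zero => simpa using ⟨hf, mem_fil_order f⟩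
    | succ n ih =>
      have := hN _ _ ih
      rw [← sub_eq_zero.1 h] at this
      convert this using 2
      push_cast
      ring
  exact eq_zero_of_forall_mem_fil hδ fun n => (key n).2

/-- Multiplication by `g`. -/
def mulH (g : H) : H →ₗ[ℂ] H where
  toFun f := g * f
  map_add' f₁ f₂ := mul_add _ _ _
  map_smul' c f := by
    rw [RingHom.id_apply, ← HahnSeries.C_mul_eq_smul, ← HahnSeries.C_mul_eq_smul]
    ring

theorem mulH_apply (g f : H) : mulH g f = g * f := rfl

/-- The operator `z d/dz - g`. -/
def eulerSub (g : H) : H →ₗ[ℂ] H where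
  toFun f := euler f - g * f
  map_add' f₁ f₂ := by
    ext a
    simp only [coeff_euler, HahnSeries.coeff_add, HahnSeries.coeff_sub, mul_add]
    ring
  map_smul' c f := by
    rw [← mulH_apply, map_smul, mulH_apply]
    ext a
    simp only [coeff_euler, HahnSeries.coeff_smul, HahnSeries.coeff_sub, smul_eq_mul,
      RingHom.id_apply]
    ring

theorem eulerSub_apply (g f : H) : eulerSub g f = euler f - g * f := rfl

theorem eulerSub_mem_lau {g : H} (hg : g ∈ laurent s) : ∀ f ∈ lau s, eulerSub g f ∈ lau s :=
  fun _ hf => sub_mem (euler_mem_laurent hf) ((laurent s).mul_mem hg hf)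

theorem mul_mem_lauFil {g f : H} (hg : g ∈ laurent s) {a : ℚ} (hf : f ∈ lauFil s a) :
    g * f ∈ lauFil s (a + g.order) :=
  ⟨(laurent s).mul_mem hg hf.1, add_comm a g.order ▸ mul_mem_fil (mem_fil_order g) hf.2⟩

theorem eulerSub_mem_lauFil {g : H} (hg : g ∈ laurent s) (hg' : g.order ≤ 0) {a : ℚ} :
    ∀ f ∈ lauFil s a, eulerSub g f ∈ lauFil s (a + g.order) :=
  fun f hf => sub_mem ⟨euler_mem_laurent hf.1, fil_anti (by linarith) (euler_mem_fil hf.2)⟩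
    (mul_mem_lauFil hg hf)

/-- Factor `z d/dz - g = -g (1 - N)` with `N = g⁻¹ z d/dz`. As `g` has a pole, `N` raises orders by
`-ord g > 0`, so `1 - N` is invertible. -/
theorem eulerSub_bijective_aux (hs : 0 < s) {g : H} (hg : g ∈ laurent s)
    (hpol : ∀ a ∈ g.support, a < 0) (h0 : g ≠ 0) :
    (∀ f ∈ lau s, eulerSub g f = 0 → f = 0) ∧
      ∀ a, ∀ h ∈ lauFil s (a + g.order), ∃ f ∈ lauFil s a, eulerSub g f = h := by
  let N : H →ₗ[ℂ] H := mulH g⁻¹ ∘ₗ eulerSub 0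
  have hN (f : H) : N f = g⁻¹ * euler f := by
    change g⁻¹ * (euler f - 0 * f) = _
    ring
  have hNr : ∀ a, ∀ f ∈ lauFil s a, N f ∈ lauFil s (a + -g.order) := by
    intro a f hf
    rw [hN, ← order_inv]
    exact mul_mem_lauFil (inv_mem_laurent hs hg) ⟨euler_mem_laurent hf.1, euler_mem_fil hf.2⟩
  have hδ : 0 < -g.order := neg_pos.2 (order_lt_zero_of_polar hpol h0)
  have hrel (f : H) : eulerSub g f = -g * (f - N f) := by
    rw [hN, eulerSub_apply]
    linear_combination (-euler f) * mul_inv_cancel₀ h0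
  constructor
  · intro f hf h
    rw [hrel] at h
    exact eq_zero_of_sub_eq_zero hδ hNr hf
      ((mul_eq_zero.1 h).resolve_left (neg_ne_zero.2 h0))
  · intro a h hh
    have h1 : -g⁻¹ * h ∈ lauFil s a := by
      have := mul_mem_lauFil (inv_mem_laurent hs hg) hh
      rw [order_inv, add_neg_cancel_right] at this
      rw [show -g⁻¹ * h = -(g⁻¹ * h) by ring]
      exact neg_mem this
    obtain ⟨f, hf, h2⟩ := exists_sub_eq hs hδ hNr h1
    refine ⟨f, hf, ?_⟩
    rw [hrel, h2]
    linear_combination h * mul_inv_cancel₀ h0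

theorem exists_euler_eq {a : ℚ} {h : H} (hh : h ∈ lauFil s a) (h0 : h.coeff 0 = 0) :
    ∃ f ∈ lauFil s a, euler f = h := by
  -- At the exponent `0` the inverse is `0` by convention, which is harmless since `h` has no
  -- constant term.
  let f : H := ⟨fun x => (x : ℂ)⁻¹ * h.coeff x,
    h.isPWO_support.mono fun x hx h' => hx (by simp [h'])⟩
  refine ⟨f, ⟨fun x hx => hh.1 x fun h' => hx ?_, mem_fil_iff.2 fun x hx => ?_⟩, ?_⟩
  · change (x : ℂ)⁻¹ * h.coeff x = 0
    rw [h', mul_zero]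
  · change (x : ℂ)⁻¹ * h.coeff x = 0
    rw [mem_fil_iff.1 hh.2 x hx, mul_zero]
  · ext x
    change (x : ℂ) * ((x : ℂ)⁻¹ * h.coeff x) = _
    by_cases hx : x = 0
    · simp [hx, h0]
    · rw [mul_inv_cancel_left₀ (by exact_mod_cast hx)]

/-- The operator `z d/dz - g` with `g` polar is invertible on positive exponents. -/
theorem eulerSub_bijective (hs : 0 < s) {g : H} (hg : g ∈ laurent s)
    (hpol : ∀ a ∈ g.support, a < 0) {a : ℚ} (ha : 0 < a) :
    (∀ f ∈ lauFil s a, eulerSub g f = 0 → f = 0) ∧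
      ∀ h ∈ lauFil s (a + g.order), ∃ f ∈ lauFil s a, eulerSub g f = h := by
  by_cases h0 : g = 0
  · subst h0
    constructor
    · intro f hf h
      rw [eulerSub_apply, zero_mul, sub_zero] at h
      ext x
      have h1 := congrArg (fun u => HahnSeries.coeff u x) h
      simp only [coeff_euler, HahnSeries.coeff_zero, mul_eq_zero] at h1
      rcases h1 with h1 | h1
      · have : x = 0 := by exact_mod_cast h1
        exact mem_fil_iff.1 hf.2 x (this ▸ ha)
      · exact h1
    · intro h hh
      -- The convention that the zero series has order `0` is the right one here: for `g = 0` the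
      -- operator `z d/dz` preserves orders. The hypothesis `0 < a` excludes constants.
      rw [HahnSeries.order_zero, add_zero] at hh
      obtain ⟨f, hf, h1⟩ := exists_euler_eq hh (mem_fil_iff.1 hh.2 0 ha)
      exact ⟨f, hf, by rw [eulerSub_apply, zero_mul, sub_zero, h1]⟩
  · obtain ⟨h1, h2⟩ := eulerSub_bijective_aux hs hg hpol h0
    exact ⟨fun f hf => h1 f hf.1, h2 a⟩

/-- The operator `z d/dz - g` with `g` polar has index zero on formal Laurent series. -/
theorem hasIdx_eulerSub (hs : 0 < s) {g : H} (hg : g ∈ laurent s)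
    (hpol : ∀ a ∈ g.support, a < 0) :
    HasIdx (V := lau s) (W := lau s) ((eulerSub g).restrict (p := lau s) (q := lau s) (eulerSub_mem_lau hg)) 0 := by
  by_cases h0 : g = 0
  · subst h0
    have ha (f : H) : eulerSub 0 f = euler f := by rw [eulerSub_apply, zero_mul, sub_zero]
    set T := (eulerSub 0).restrict (eulerSub_mem_lau hg)
    have hT (f : lau s) : (T f : H) = euler f := ha f
    have h1m : (1 : H) ∈ lau s := one_mem (laurent s)
    let c₀ : lau s →ₗ[ℂ] ℂ :=
      { toFun := fun f => (f : H).coeff 0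
        map_add' := fun _ _ => rfl
        map_smul' := fun _ _ => rfl }
    have hc₀ : Function.Surjective c₀ := by
      intro c
      refine ⟨c • ⟨1, h1m⟩, ?_⟩
      simp [c₀]
    -- For `g = 0` the only obstruction to solving is the constant term, and the only solutions of
    -- the homogeneous equation are the constants; the two dimensions cancel.
    have hr : LinearMap.range T = LinearMap.ker c₀ := by
      ext h
      constructor
      · rintro ⟨f, rfl⟩
        change (T f : H).coeff 0 = 0
        rw [hT, coeff_euler]
        simp
      · intro hh
        obtain ⟨f, hf, he⟩ := exists_euler_eq (a := (h : H).order) (h := h)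
          ⟨h.2, mem_fil_order _⟩ hh
        exact ⟨⟨f, hf.1⟩, Subtype.ext ((hT _).trans he)⟩
    let eC := (Submodule.quotEquivOfEq _ _ hr).trans (LinearMap.quotKerEquivOfSurjective (M := lau s) c₀ hc₀)
    let eK : LinearMap.ker T ≃ₗ[ℂ] ℂ := LinearEquiv.ofBijective (c₀ ∘ₗ (LinearMap.ker T).subtype) (by
      have hk (f : LinearMap.ker T) : ∃ c : ℂ, (f : H) = algebraMap ℂ H c :=
        exists_algebraMap_of_euler_eq_zero
          (by rw [← hT]; exact congrArg Subtype.val (LinearMap.mem_ker.1 f.2))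
      have h1k : (⟨1, h1m⟩ : lau s) ∈ LinearMap.ker T := by
        rw [LinearMap.mem_ker]
        refine Subtype.ext ((hT _).trans ?_)
        ext x
        change (x : ℂ) * (1 : H).coeff x = 0
        rw [HahnSeries.coeff_one]
        split_ifs with h <;> simp [h]
      constructor
      · intro f g hfg
        obtain ⟨c, hc⟩ := hk f
        obtain ⟨d, hd⟩ := hk g
        refine Subtype.ext (Subtype.ext ?_)
        have hfg : ((f : lau s) : H).coeff 0 = ((g : lau s) : H).coeff 0 := hfg
        rw [hc, hd, HahnSeries.algebraMap_apply, HahnSeries.algebraMap_apply] at hfg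
        rw [hc, hd]
        congr 1
        simpa using hfg
      · intro c
        refine ⟨c • ⟨⟨1, h1m⟩, h1k⟩, ?_⟩
        simp [c₀])
    refine ⟨Module.Finite.equiv eK.symm, Module.Finite.equiv eC.symm, ?_⟩
    rw [eK.finrank_eq, eC.finrank_eq, sub_self]
  · obtain ⟨h1, h2⟩ := eulerSub_bijective_aux hs hg hpol h0
    refine HasIdx.of_bijective ⟨(injective_iff_map_eq_zero _).2 fun f hf =>
      Subtype.ext (h1 f f.2 (congrArg Subtype.val hf)), fun h => ?_⟩
    obtain ⟨f, hf, he⟩ := h2 ((h : H).order - g.order) h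
      ⟨h.2, by rw [sub_add_cancel]; exact mem_fil_order _⟩
    exact ⟨⟨f, hf.1⟩, Subtype.ext he⟩

/-- A half-open interval of length `n/s` contains exactly `n` multiples of `1/s`, wherever it
starts; the first one here is `k₀/s`. -/
theorem relDim_lauFil (hs : 0 < s) (b : ℚ) (n : ℕ) :
    RelDim (lauFil s (b + (n : ℚ) / s)) (lauFil s b) n := by
  have hs' : (0 : ℚ) < s := by exact_mod_cast hs
  set k₀ : ℤ := ⌈b * s⌉
  have hn : n = Module.finrank ℂ (Fin n → ℂ) := by simp
  conv_rhs => rw [hn]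
  let g : lauFil s b →ₗ[ℂ] (Fin n → ℂ) :=
    { toFun := fun f i => (f : H).coeff (((k₀ + i : ℤ) : ℚ) / s)
      map_add' := fun _ _ => rfl
      map_smul' := fun _ _ => rfl }
  have hle : b ≤ b + (n : ℚ) / s := le_add_of_nonneg_right (by positivity)
  refine RelDim.of_surjective (g := g) (inf_le_inf_left _ (fil_anti hle)) ?_ ?_
  · intro y
    let e (i : Fin n) : lauFil s b := ⟨zpow (((k₀ + i : ℤ) : ℚ) / s), zpow_mem_laurent s _,
      fil_anti (by
        rw [le_div_iff₀ hs']
        refine (Int.le_ceil _).trans ?_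
        push_cast
        exact le_add_of_nonneg_right (by positivity)) (zpow_mem_fil _)⟩
    have hge (i : Fin n) : g (e i) = Pi.single i 1 := by
      funext j
      change (zpow _).coeff _ = _
      rcases eq_or_ne j i with rfl | hji
      · rw [Pi.single_eq_same]
        exact HahnSeries.coeff_single_same _ _
      · rw [Pi.single_eq_of_ne hji]
        refine HahnSeries.coeff_single_of_ne fun h => hji ?_
        rwa [div_left_inj' hs'.ne', Int.cast_inj, add_right_inj, Nat.cast_inj, ← Fin.ext_iff] at h
    refine ⟨∑ i, y i • e i, ?_⟩
    refine (map_sum g _ _).trans ?_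
    simp only [map_smul, hge]
    funext j
    simp [Finset.sum_apply, Pi.single_apply]
  · intro f
    constructor
    · intro h
      refine ⟨f.2.1, mem_fil_iff.2 fun x hx => ?_⟩
      by_contra hne
      obtain ⟨k, rfl⟩ := f.2.1 x hne
      have h1 : b ≤ (k : ℚ) / s := by
        by_contra hlt
        exact hne (mem_fil_iff.1 f.2.2 _ (not_le.1 hlt))
      rw [le_div_iff₀ hs'] at h1
      have h2 : k₀ ≤ k := Int.ceil_le.2 h1
      have h3 : k < k₀ + n := by
        rw [div_lt_iff₀ hs', add_mul, div_mul_cancel₀ _ hs'.ne'] at hx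
        have := Int.le_ceil (b * s)
        have h4 : (k : ℚ) < ((k₀ + n : ℤ) : ℚ) := by
          push_cast
          linarith
        exact_mod_cast h4
      refine hne ?_
      have := congrFun h ⟨(k - k₀).toNat, by omega⟩
      change (f : H).coeff _ = 0 at this
      convert this using 3
      push_cast
      rw [← Int.cast_natCast, Int.toNat_of_nonneg (by omega)]
      push_cast
      ring
    · intro h
      funext i
      refine mem_fil_iff.1 h.2 _ ?_
      rw [div_lt_iff₀ hs', add_mul, div_mul_cancel₀ _ hs'.ne']
      have h1 := Int.ceil_lt_add_one (b * s)
      have h2 : ((i : ℕ) : ℚ) + 1 ≤ n := by exact_mod_cast i.2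
      push_cast
      linarith

end Formal

end IrregularSpectral

end

noncomputable section

namespace IrregularSpectral

/-! ### Decomposition of ramified series -/

section Parts

/-- The part of a series with integral exponents. -/
def intPart (f : H) : H :=
  ⟨fun a => open Classical in if ∃ k : ℤ, a = k then f.coeff a else 0,
    f.isPWO_support.mono fun a ha h => ha (by simp [h])⟩

theorem coeff_intPart_int (f : H) (k : ℤ) : (intPart f).coeff k = f.coeff k :=
  if_pos ⟨k, rfl⟩

theorem coeff_intPart_of_not {f : H} {a : ℚ} (h : ¬∃ k : ℤ, a = k) : (intPart f).coeff a = 0 :=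
  if_neg h

theorem mem_laurent_one {f : H} : f ∈ laurent 1 ↔ ∀ a, f.coeff a ≠ 0 → ∃ k : ℤ, a = k := by
  change (∀ a ∈ f.support, ∃ k : ℤ, a = (k : ℚ) / (1 : ℕ)) ↔ _
  simp [HahnSeries.mem_support]

theorem intPart_mem (f : H) : intPart f ∈ laurent 1 :=
  mem_laurent_one.2 fun _ h => by_contra fun h' => h (coeff_intPart_of_not h')

theorem intPart_mem_fil {f : H} {b : ℚ} (h : f ∈ fil b) : intPart f ∈ fil b := by
  refine mem_fil_iff.2 fun x hx => ?_
  by_cases h' : ∃ k : ℤ, x = k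
  · obtain ⟨k, rfl⟩ := h'
    rw [coeff_intPart_int]
    exact mem_fil_iff.1 h _ hx
  · exact coeff_intPart_of_not h'

theorem intPart_eq_of {f g : H} (hg : g ∈ laurent 1) (h : ∀ k : ℤ, f.coeff k = g.coeff k) :
    intPart f = g := by
  ext a
  by_cases h' : ∃ k : ℤ, a = k
  · obtain ⟨k, rfl⟩ := h'
    rw [coeff_intPart_int, h]
  · rw [coeff_intPart_of_not h']
    exact (not_not.1 fun hne => h' (mem_laurent_one.1 hg a hne)).symm

theorem intPart_add (f g : H) : intPart (f + g) = intPart f + intPart g :=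
  intPart_eq_of (add_mem (intPart_mem f) (intPart_mem g)) fun k => by
    rw [HahnSeries.coeff_add, HahnSeries.coeff_add, coeff_intPart_int, coeff_intPart_int]

/-- Multiplication by a series with integral exponents preserves classes of exponents modulo `ℤ`.
Hence the coordinates `part r i` are linear over `ℂ((z))`. -/
theorem intPart_mul {g : H} (hg : g ∈ laurent 1) (f : H) : intPart (g * f) = g * intPart f := by
  refine intPart_eq_of (mul_mem hg (intPart_mem f)) fun k => ?_
  rw [← sub_eq_zero, ← HahnSeries.coeff_sub, ← mul_sub]
  by_contra hne
  obtain ⟨x, hx, y, hy, hxy⟩ := HahnSeries.support_mul_subset hne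
  obtain ⟨n, rfl⟩ := mem_laurent_one.1 hg x hx
  have hyk : y = ((k - n : ℤ) : ℚ) := by
    push_cast
    rw [← hxy]
    ring
  refine hy ?_
  rw [hyk, HahnSeries.coeff_sub, coeff_intPart_int, sub_self]

theorem intPart_sum {ι : Type*} (S : Finset ι) (f : ι → H) :
    intPart (∑ i ∈ S, f i) = ∑ i ∈ S, intPart (f i) := by
  let L : H →+ H := AddMonoidHom.mk' intPart intPart_add
  exact map_sum L f S

variable {r : ℕ}

/-- The coefficients of a series in `z^{1/r}` with respect to `1, z^{1/r}, …, z^{(r-1)/r}`. -/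
def part (r : ℕ) (i : Fin r) (f : H) : H := intPart (zpow (-((i : ℕ) : ℚ) / r) * f)

theorem part_mem (i : Fin r) (f : H) : part r i f ∈ laurent 1 := intPart_mem _

theorem part_mul {g : H} (hg : g ∈ laurent 1) (i : Fin r) (f : H) :
    part r i (g * f) = g * part r i f := by
  rw [part, mul_left_comm, intPart_mul hg, part]

theorem part_sum {ι : Type*} (S : Finset ι) (f : ι → H) (i : Fin r) :
    part r i (∑ j ∈ S, f j) = ∑ j ∈ S, part r i (f j) := by
  rw [part, Finset.mul_sum, intPart_sum]
  rfl

/-- Dividing by `z^{i/r}` with `i < r` lowers the order by less than one. -/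
theorem part_mem_fil {f : H} {b : ℚ} (h : f ∈ fil b) (i : Fin r) : part r i f ∈ fil (b - 1) := by
  refine intPart_mem_fil (fil_anti ?_ (mul_mem_fil (zpow_mem_fil _) h))
  have hr : (0 : ℚ) < r := by exact_mod_cast i.pos
  have : ((i : ℕ) : ℚ) / r ≤ 1 := by
    rw [div_le_one hr]
    exact_mod_cast i.2.le
  rw [neg_div]
  linarith

theorem sum_part (hr : 0 < r) {f : H} (hf : f ∈ laurent r) :
    ∑ i : Fin r, zpow (((i : ℕ) : ℚ) / r) * part r i f = f := by
  have hr' : (r : ℚ) ≠ 0 := by exact_mod_cast hr.ne'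
  have hc (i : Fin r) (a : ℚ) : (zpow (((i : ℕ) : ℚ) / r) * part r i f).coeff a =
      open Classical in if ∃ k : ℤ, a - ((i : ℕ) : ℚ) / r = k then f.coeff a else 0 := by
    classical
    rw [coeff_zpow_mul]
    by_cases h : ∃ k : ℤ, a - ((i : ℕ) : ℚ) / r = k
    · rw [if_pos h]
      obtain ⟨k, hk⟩ := h
      rw [hk, part, coeff_intPart_int, ← hk, coeff_zpow_mul]
      congr 1
      ring
    · rw [if_neg h]
      exact coeff_intPart_of_not h
  ext a
  rw [HahnSeries.coeff_sum]
  simp only [hc]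
  by_cases h0 : f.coeff a = 0
  · simp [h0]
  obtain ⟨k, rfl⟩ := hf a h0
  have hpos : 0 ≤ k % r := Int.emod_nonneg _ (by exact_mod_cast hr.ne')
  have hlt : k % r < r := Int.emod_lt_of_pos _ (by exact_mod_cast hr)
  -- Only the summand with `i` congruent to `k` modulo `r` contains the exponent `k/r`.
  rw [Finset.sum_eq_single ⟨(k % r).toNat, by omega⟩]
  · refine if_pos ⟨k / r, ?_⟩
    have h1 := Int.emod_add_mul_ediv k r
    have h2 : (((k % r).toNat : ℕ) : ℚ) = (k % r : ℤ) := by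
      rw [← Int.cast_natCast, Int.toNat_of_nonneg hpos]
    have h3 : (k : ℚ) = (k % r : ℤ) + r * (k / r : ℤ) := by
      exact_mod_cast h1.symm
    rw [h2, h3]
    field_simp
    ring
  · intro i _ hi
    refine if_neg ?_
    rintro ⟨n, hn⟩
    refine hi (Fin.ext ?_)
    have h1 : (k : ℚ) = ((n * r + i : ℤ) : ℚ) := by
      field_simp at hn
      push_cast
      linarith
    have h2 : k = n * r + i := by exact_mod_cast h1
    have h3 : k % r = i := by
      rw [h2, Int.add_comm, Int.add_mul_emod_self_right]
      exact Int.emod_eq_of_lt (by positivity) (by exact_mod_cast i.2)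
    change (i : ℕ) = (k % r).toNat
    omega
  · intro h
    exact absurd (Finset.mem_univ _) h

end Parts

/-! ### Comparison of formal and convergent solutions -/

/-- Identifying the two index types makes the matrix square; over a field injectivity means a
nonzero determinant. -/
theorem exists_inverse_matrix {K : Type*} [CommRing K] (hK : IsField K) {I J : Type*} [Fintype I]
    [Fintype J] [DecidableEq I] [DecidableEq J] (hc : Fintype.card I = Fintype.card J)
    (N : Matrix I J K) (hN : ∀ x, N.mulVec x = 0 → x = 0) :
    ∃ N' : Matrix J I K, N * N' = 1 ∧ N' * N = 1 := by
  have := hK.isDomain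
  let e : I ≃ J := Fintype.equivOfCardEq hc
  let S : Matrix I I K := N.submatrix id e
  have hdet : S.det ≠ 0 := by
    intro h0
    obtain ⟨v, hv, h1⟩ := Matrix.exists_mulVec_eq_zero_iff.2 h0
    rw [Matrix.submatrix_mulVec_equiv] at h1
    have h2 := hN _ h1
    refine hv (funext fun i => ?_)
    have := congrFun h2 (e i)
    simpa using this
  obtain ⟨d, hd⟩ := hK.mul_inv_cancel hdet
  have hu : IsUnit S.det := IsUnit.of_mul_eq_one d hd
  refine ⟨(S⁻¹).submatrix e.symm id, ?_, ?_⟩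
  · have h1 := Matrix.mul_nonsing_inv S hu
    rw [← h1]
    ext i j
    simp only [Matrix.mul_apply, S, Matrix.submatrix_apply, id]
    exact (Fintype.sum_equiv e _ _ fun x => by simp).symm
  · have h1 := Matrix.nonsing_inv_mul S hu
    ext i j
    have h2 := congrFun (congrFun h1 (e.symm i)) (e.symm j)
    simp only [Matrix.mul_apply, S, Matrix.submatrix_apply, id, Equiv.apply_symm_apply,
      Matrix.one_apply, EmbeddingLike.apply_eq_iff_eq] at h2 ⊢
    exact h2

section Comparison

variable {I J : Type*}

/-- The diagonal operator `z d/dz - g`. -/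
def diagOp (g : I → H) : (I → H) →ₗ[ℂ] (I → H) :=
  LinearMap.pi fun l => eulerSub (g l) ∘ₗ LinearMap.proj l

theorem diagOp_apply (g : I → H) (x : I → H) (l : I) : diagOp g x l = eulerSub (g l) (x l) := rfl

/-- Vectors of series in `z^{1/s}`. -/
def piLau (J : Type*) (s : ℕ) : Submodule ℂ (J → H) := Submodule.pi Set.univ fun _ => lau s

/-- Vectors of series in `z^{1/s}` with prescribed lower bounds for the exponents. -/
def piFil (s : ℕ) (a : J → ℚ) : Submodule ℂ (J → H) :=
  Submodule.pi Set.univ fun j => lauFil s (a j)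

theorem mem_piLau {s : ℕ} {x : J → H} : x ∈ piLau J s ↔ ∀ j, x j ∈ laurent s := by
  simp [piLau, Submodule.mem_pi, mem_lau]

theorem mem_piFil {s : ℕ} {a : J → ℚ} {x : J → H} :
    x ∈ piFil s a ↔ ∀ j, x j ∈ lauFil s (a j) := by
  simp [piFil, Submodule.mem_pi]

theorem piFil_le {s : ℕ} (a : J → ℚ) : piFil s a ≤ piLau J s :=
  fun _ hx => mem_piLau.2 fun j => (mem_piFil.1 hx j).1

theorem piFil_anti {s : ℕ} {a b : J → ℚ} (h : ∀ j, a j ≤ b j) : piFil s b ≤ piFil s a :=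
  fun _ hx => mem_piFil.2 fun j => ⟨(mem_piFil.1 hx j).1, fil_anti (h j) (mem_piFil.1 hx j).2⟩

variable [Fintype J]

/-- The linear map given by a matrix of Hahn series. -/
def matOp (w : I → J → H) : (J → H) →ₗ[ℂ] (I → H) :=
  LinearMap.pi fun l => ∑ j, mulH (w l j) ∘ₗ LinearMap.proj j

theorem matOp_apply (w : I → J → H) (x : J → H) (l : I) : matOp w x l = ∑ j, w l j * x j := by
  simp only [matOp, LinearMap.pi_apply, LinearMap.sum_apply]
  rfl

/-- The operator `z d/dz - A`. -/
def connOp (A : J → J → H) : (J → H) →ₗ[ℂ] (J → H) :=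
  (LinearMap.pi fun j => eulerSub 0 ∘ₗ LinearMap.proj j) - matOp A

theorem connOp_apply (A : J → J → H) (x : J → H) (j : J) :
    connOp A x j = euler (x j) - ∑ j', A j j' * x j' := by
  change (euler (x j) - 0 * x j) - matOp A x j = _
  rw [matOp_apply]
  ring

theorem relDim_piFil {s : ℕ} (hs : 0 < s) (b : J → ℚ) (n : J → ℕ) :
    RelDim (piFil s fun j => b j + (n j : ℚ) / s) (piFil s b) (∑ j, n j) :=
  RelDim.pi fun j => relDim_lauFil hs (b j) (n j)

theorem sum_mem_lauFil {ι : Type*} {S : Finset ι} {s : ℕ} {b : ℚ} {f : ι → H}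
    (h : ∀ i ∈ S, f i ∈ lauFil s b) : ∑ i ∈ S, f i ∈ lauFil s b := sum_mem h

theorem mul_mem_lauFil' {s : ℕ} {g f : H} {a b : ℚ} (hg : g ∈ laurent s) (hg' : g ∈ fil a)
    (hf : f ∈ lauFil s b) : g * f ∈ lauFil s (b + a) :=
  ⟨(laurent s).mul_mem hg hf.1, add_comm a b ▸ mul_mem_fil hg' hf.2⟩

theorem matOp_mem_piFil {s m : ℕ} {w : I → J → H} (hw : ∀ l j, w l j ∈ laurent s)
    (hw' : ∀ l j, w l j ∈ fil (-m)) {b : ℚ} {x : J → H} (hx : x ∈ piFil s fun _ => b) :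
    matOp w x ∈ piFil s fun _ => b - m := by
  refine mem_piFil.2 fun l => ?_
  rw [matOp_apply, sub_eq_add_neg]
  exact sum_mem_lauFil fun j _ => mul_mem_lauFil' (hw l j) (hw' l j) (mem_piFil.1 hx j)

theorem matOp_mem_piLau {s : ℕ} {w : I → J → H} (hw : ∀ l j, w l j ∈ laurent s) {x : J → H}
    (hx : x ∈ piLau J s) : matOp w x ∈ piLau I s := by
  refine mem_piLau.2 fun l => ?_
  rw [matOp_apply]
  exact sum_mem fun j _ => (laurent s).mul_mem (hw l j) (mem_piLau.1 hx j)

theorem FormalL.val_mulVec (N : Matrix I J FormalL) (x : J → FormalL) (k : I) :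
    FormalL.val (N.mulVec x k) =
      matOp (fun k j => FormalL.val (N k j)) (fun j => FormalL.val (x j)) k := by
  rw [matOp_apply]
  simp only [Matrix.mulVec, dotProduct, map_sum, map_mul]

/-- Expanding ramified series along `1, z^{1/r}, …, z^{(r-1)/r}` turns `w` into a matrix over
`ℂ((z))`, square by the cardinality hypothesis and hence invertible. The inverse is produced as a
matrix so that its pole orders can be bounded. -/
theorem exists_inverse_matOp [Fintype I] {r : ℕ} (hr : 0 < r) {w : I → J → H} (hw : ∀ l j, w l j ∈ laurent r)
    (hc : Fintype.card J = Fintype.card I * r)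
    (hinj : ∀ x ∈ piLau J 1, matOp w x = 0 → x = 0) :
    ∃ u : J → I × Fin r → H, (∀ j k, u j k ∈ laurent 1) ∧
      (∀ y ∈ piLau I r, matOp w (matOp u fun k => part r k.2 (y k.1)) = y) ∧
      ∀ x ∈ piLau J 1, matOp u (fun k => part r k.2 (matOp w x k.1)) = x := by
  classical
  let N : Matrix (I × Fin r) J FormalL := fun k j => (⟨part r k.2 (w k.1 j), part_mem _ _⟩ : laurent 1)
  have hvi : Function.Injective FormalL.val := Subtype.val_injective
  have hN (x : J → FormalL) (k) : FormalL.val (N.mulVec x k) =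
      part r k.2 (matOp w (fun j => FormalL.val (x j)) k.1) := by
    rw [FormalL.val_mulVec, matOp_apply, matOp_apply, part_sum]
    refine Finset.sum_congr rfl fun j _ => ?_
    have hx : FormalL.val (x j) ∈ laurent 1 := (x j).2
    rw [mul_comm (w k.1 j), part_mul hx, mul_comm (FormalL.val (x j))]
    rfl
  have hparts {y y' : I → H} (hy : y ∈ piLau I r) (hy' : y' ∈ piLau I r)
      (h : ∀ k : I × Fin r, part r k.2 (y k.1) = part r k.2 (y' k.1)) : y = y' := by
    funext l
    rw [← sum_part hr (mem_piLau.1 hy l), ← sum_part hr (mem_piLau.1 hy' l)]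
    exact Finset.sum_congr rfl fun i _ => by rw [h (l, i)]
  have hle : laurent 1 ≤ laurent r := laurent_one_le r hr
  have hwx {x : J → H} (hx : x ∈ piLau J 1) : matOp w x ∈ piLau I r :=
    matOp_mem_piLau hw (mem_piLau.2 fun j => hle (mem_piLau.1 hx j))
  have hp0 (i : Fin r) : part r i 0 = 0 := by
    have := part_mul (zero_mem (laurent 1)) i (0 : H)
    rwa [zero_mul, zero_mul] at this
  obtain ⟨N', h1, h2⟩ := exists_inverse_matrix isField_formalL
    (by rw [Fintype.card_prod, Fintype.card_fin, hc]) N (fun x hx => by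
      have h3 : (fun j => FormalL.val (x j)) = 0 := by
        refine hinj _ (mem_piLau.2 fun j => (x j).2) ?_
        refine hparts (hwx (mem_piLau.2 fun j => (x j).2)) (zero_mem _) fun k => ?_
        rw [← hN, hx, Pi.zero_apply, map_zero, Pi.zero_apply, hp0]
      exact funext fun j => hvi ((congrFun h3 j).trans (map_zero _).symm))
  have h3 (y) : N.mulVec (N'.mulVec y) = y := by rw [Matrix.mulVec_mulVec, h1, Matrix.one_mulVec]
  have h4 (x) : N'.mulVec (N.mulVec x) = x := by rw [Matrix.mulVec_mulVec, h2, Matrix.one_mulVec]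
  clear_value N
  refine ⟨fun j k => FormalL.val (N' j k), fun j k => (N' j k).2, fun y hy => ?_, fun x hx => ?_⟩
  · let Y : I × Fin r → FormalL := fun k => (⟨part r k.2 (y k.1), part_mem _ _⟩ : laurent 1)
    have h5 : (matOp (fun j k => FormalL.val (N' j k)) fun k => part r k.2 (y k.1)) =
        fun j => FormalL.val (N'.mulVec Y j) := funext fun j => (FormalL.val_mulVec N' Y j).symm
    rw [h5]
    refine hparts (hwx (mem_piLau.2 fun j => (N'.mulVec Y j).2)) hy fun k => ?_
    rw [← hN, h3]
    rfl
  · let X : J → FormalL := fun j => (⟨x j, mem_piLau.1 hx j⟩ : laurent 1)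
    have h5 : (fun k : I × Fin r => part r k.2 (matOp w x k.1)) =
        fun k => FormalL.val (N.mulVec X k) := funext fun k => (hN X k).symm
    rw [h5]
    funext j
    rw [← FormalL.val_mulVec, h4]
    rfl

end Comparison

end IrregularSpectral

end

noncomputable section

namespace IrregularSpectral

/-! ### Index on formal lattices -/

section HasIdxOn

variable {X Y X' Y' : Type*} [AddCommGroup X] [Module ℂ X] [AddCommGroup Y] [Module ℂ Y]
  [AddCommGroup X'] [Module ℂ X'] [AddCommGroup Y'] [Module ℂ Y']

/-- `T` maps `S` to `S'`, and has index `i` as a map `S → S'`. -/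
def HasIdxOn (T : X →ₗ[ℂ] Y) (S : Submodule ℂ X) (S' : Submodule ℂ Y) (i : ℤ) : Prop :=
  ∃ h : ∀ x ∈ S, T x ∈ S', HasIdx (T.restrict h) i

theorem HasIdxOn.congr {T : X →ₗ[ℂ] Y} {S : Submodule ℂ X} {S' : Submodule ℂ Y} {i j : ℤ}
    (h : HasIdxOn T S S' i) (hij : i = j) : HasIdxOn T S S' j := hij ▸ h

theorem HasIdxOn.of_relDim {T : X →ₗ[ℂ] Y} {S V : Submodule ℂ X} {S' V' : Submodule ℂ Y}
    (hV : ∀ x ∈ V, T x ∈ V') {n n' : ℕ} (h : RelDim S V n)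
    (h' : RelDim S' V' n') {i : ℤ} (hi : HasIdxOn T S S' i) : HasIdxOn T V V' (i + (n - n')) := by
  obtain ⟨hS, hi⟩ := hi
  exact ⟨hV, hi.of_relDim hS hV h h'⟩

theorem HasIdxOn.of_bijOn {T : X →ₗ[ℂ] Y} {S : Submodule ℂ X} {S' : Submodule ℂ Y}
    (h : ∀ x ∈ S, T x ∈ S') (hi : ∀ x ∈ S, T x = 0 → x = 0) (hs : ∀ y ∈ S', ∃ x ∈ S, T x = y) :
    HasIdxOn T S S' 0 := by
  refine ⟨h, HasIdx.of_bijective ⟨(injective_iff_map_eq_zero _).2 fun x hx =>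
    Subtype.ext (hi x x.2 (congrArg Subtype.val hx)), fun y => ?_⟩⟩
  obtain ⟨x, hx, hxy⟩ := hs y y.2
  exact ⟨⟨x, hx⟩, Subtype.ext hxy⟩

/-- `Ψ` restricts to a bijection `S → U`. -/
structure MapsBij (Ψ : X →ₗ[ℂ] Y) (S : Submodule ℂ X) (U : Submodule ℂ Y) : Prop where
  maps : ∀ x ∈ S, Ψ x ∈ U
  inj : ∀ x ∈ S, Ψ x = 0 → x = 0
  surj : ∀ y ∈ U, ∃ x ∈ S, Ψ x = y

/-- The isomorphism given by a bijective restriction. -/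
def MapsBij.equiv {Ψ : X →ₗ[ℂ] Y} {S : Submodule ℂ X} {U : Submodule ℂ Y} (h : MapsBij Ψ S U) :
    S ≃ₗ[ℂ] U :=
  LinearEquiv.ofBijective (Ψ.restrict h.maps)
    ⟨(injective_iff_map_eq_zero _).2 fun x hx =>
      Subtype.ext (h.inj x x.2 (congrArg Subtype.val hx)), fun y => by
        obtain ⟨x, hx, hxy⟩ := h.surj y y.2
        exact ⟨⟨x, hx⟩, Subtype.ext hxy⟩⟩

/-- Source and target may be identified by different maps; this freedom absorbs the factor `z`
between `d/dz` and `z d/dz`, and the shift between lattices with different pole orders. -/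
theorem HasIdxOn.of_mapsBij {T : X →ₗ[ℂ] X'} {D : Y →ₗ[ℂ] Y'} {Ψ : X →ₗ[ℂ] Y} {Ψ' : X' →ₗ[ℂ] Y'}
    {S : Submodule ℂ X} {U : Submodule ℂ Y} {S' : Submodule ℂ X'} {U' : Submodule ℂ Y'}
    (h : MapsBij Ψ S U) (h' : MapsBij Ψ' S' U') (hT : ∀ x ∈ S, T x ∈ S')
    (hc : ∀ x ∈ S, Ψ' (T x) = D (Ψ x)) {i : ℤ} (hD : HasIdxOn D U U' i) : HasIdxOn T S S' i := by
  obtain ⟨_, hD⟩ := hD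
  refine ⟨hT, hD.of_equiv h.equiv.symm h'.equiv.symm fun y => ?_⟩
  rw [LinearEquiv.symm_apply_eq]
  obtain ⟨x, rfl⟩ := h.equiv.surjective y
  rw [h.equiv.symm_apply_apply]
  exact Subtype.ext (hc x x.2).symm

theorem HasIdxOn.pi {ι : Type*} [Fintype ι] {T : ι → X →ₗ[ℂ] Y} {S : ι → Submodule ℂ X}
    {S' : ι → Submodule ℂ Y} {i : ι → ℤ} (h : ∀ l, HasIdxOn (T l) (S l) (S' l) (i l)) :
    HasIdxOn (LinearMap.pi fun l => T l ∘ₗ LinearMap.proj l) (Submodule.pi Set.univ S)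
      (Submodule.pi Set.univ S') (∑ l, i l) := by
  choose h₁ h₂ using h
  let e (S : ι → Submodule ℂ X) : (∀ l, S l) ≃ₗ[ℂ] Submodule.pi Set.univ S :=
    { toFun := fun x => ⟨fun l => x l, fun l _ => (x l).2⟩
      map_add' := fun _ _ => rfl
      map_smul' := fun _ _ => rfl
      invFun := fun x l => ⟨x.1 l, x.2 l (Set.mem_univ l)⟩ }
  let e' (S : ι → Submodule ℂ Y) : (∀ l, S l) ≃ₗ[ℂ] Submodule.pi Set.univ S :=
    { toFun := fun x => ⟨fun l => x l, fun l _ => (x l).2⟩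
      map_add' := fun _ _ => rfl
      map_smul' := fun _ _ => rfl
      invFun := fun x l => ⟨x.1 l, x.2 l (Set.mem_univ l)⟩ }
  exact ⟨fun x hx l _ => h₁ l _ (hx l (Set.mem_univ l)),
    (HasIdx.pi h₂).of_equiv (e S) (e' S') fun x => rfl⟩

/-- Excision. -/
theorem HasIdxOn.inf_sup {T : X →ₗ[ℂ] Y} {S₁ S₂ : Submodule ℂ X} {S₁' S₂' : Submodule ℂ Y}
    (h₁ : ∀ x ∈ S₁, T x ∈ S₁') (h₂ : ∀ x ∈ S₂, T x ∈ S₂') {i j k : ℤ}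
    (hI : HasIdxOn T (S₁ ⊓ S₂) (S₁' ⊓ S₂') i) (hS : HasIdxOn T (S₁ ⊔ S₂) (S₁' ⊔ S₂') j)
    (hk : HasIdxOn T S₂ S₂' k) : HasIdxOn T S₁ S₁' (i + j - k) := by
  obtain ⟨hi, hI⟩ := hI
  obtain ⟨hs, hS⟩ := hS
  obtain ⟨_, hk⟩ := hk
  -- The indices on `S₁` and `S₂` add up to `i + j`; uniqueness of the index identifies the second
  -- one with `k`.
  obtain ⟨a, b, ha, hb, hab⟩ := (hI.inf_sup h₁ h₂ hi hs hS).of_prodMap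
  have := hb.unique hk
  exact ⟨h₁, ha.congr (by omega)⟩

end HasIdxOn

/-! ### Diagonalized formal systems and their index on lattices -/

section FormalIndex

variable {I J : Type*} [Fintype I] [Fintype J]

/-- The matrix `w` of series in `z^{1/r}` diagonalizes `z d/dz - A`, with exponents `g`. -/
structure Diagonalizes (r : ℕ) (w : I → J → H) (A : J → J → H) (g : I → H) : Prop where
  pos : 0 < r
  mem : ∀ l j, w l j ∈ laurent r
  -- Equality of dimensions over `ℂ((z))`; with `inj` it makes `matOp w` a bijection from vectors
  -- over `ℂ((z))` to vectors over `ℂ((z^{1/r}))`.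
  card : Fintype.card J = Fintype.card I * r
  inj : ∀ x ∈ piLau J 1, matOp w x = 0 → x = 0
  mem_g : ∀ l, g l ∈ laurent r
  polar : ∀ l, ∀ a ∈ (g l).support, a < 0
  comm : ∀ x ∈ piLau J 1, matOp w (connOp A x) = diagOp g (matOp w x)

variable {r : ℕ} {w : I → J → H} {A : J → J → H} {g : I → H}

theorem connOp_mem_piLau (hA : ∀ j k, A j k ∈ laurent 1) :
    ∀ x ∈ piLau J 1, connOp A x ∈ piLau J 1 := by
  refine fun x hx => mem_piLau.2 fun j => ?_
  rw [connOp_apply]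
  exact sub_mem (euler_mem_laurent (mem_piLau.1 hx j))
    (sum_mem fun k _ => mul_mem (hA j k) (mem_piLau.1 hx k))

theorem connOp_mem_piFil (hA : ∀ j k, A j k ∈ laurent 1) {m : ℕ} (hAm : ∀ j k, A j k ∈ fil (-m)) :
    ∀ x ∈ piFil 1 fun _ : J => 0, connOp A x ∈ piFil 1 fun _ : J => -(m : ℚ) := by
  refine fun x hx => mem_piFil.2 fun j => ?_
  rw [connOp_apply]
  have hxj := mem_piFil.1 hx j
  refine sub_mem ⟨euler_mem_laurent hxj.1, fil_anti (by simp) (euler_mem_fil hxj.2)⟩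
    (sum_mem_lauFil fun k _ => ?_)
  have := mul_mem_lauFil' (hA j k) (hAm j k) (mem_piFil.1 hx k)
  rwa [zero_add] at this

theorem Diagonalizes.matOp_mem (h : Diagonalizes r w A g) {x : J → H} (hx : x ∈ piLau J 1) :
    matOp w x ∈ piLau I r :=
  matOp_mem_piLau h.mem (mem_piLau.2 fun j => laurent_one_le r h.pos (mem_piLau.1 hx j))

theorem Diagonalizes.surj (h : Diagonalizes r w A g) :
    ∀ y ∈ piLau I r, ∃ x ∈ piLau J 1, matOp w x = y := by
  obtain ⟨u, hu, h1, -⟩ := exists_inverse_matOp h.pos h.mem h.card h.inj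
  exact fun y hy => ⟨_, matOp_mem_piLau hu (mem_piLau.2 fun k => part_mem _ _), h1 y hy⟩

theorem Diagonalizes.mapsBij (h : Diagonalizes r w A g) :
    MapsBij (X := J → H) (Y := I → H) (matOp w) (piLau J 1) (piLau I r) :=
  ⟨fun _ => h.matOp_mem, h.inj, h.surj⟩

theorem hasIdxOn_diagOp (hr : 0 < r) (hg : ∀ l, g l ∈ laurent r)
    (hp : ∀ l, ∀ a ∈ (g l).support, a < 0) :
    HasIdxOn (X := I → H) (Y := I → H) (diagOp g) (piLau I r) (piLau I r) 0 :=
  (HasIdxOn.pi (X := H) (Y := H) (i := fun _ : I => 0) fun l =>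
    ⟨eulerSub_mem_lau (hg l), hasIdx_eulerSub hr (hg l) (hp l)⟩).congr (by simp)

theorem Diagonalizes.hasIdxOn_formal (h : Diagonalizes r w A g) (hA : ∀ j k, A j k ∈ laurent 1) :
    HasIdxOn (X := J → H) (Y := J → H) (connOp A) (piLau J 1) (piLau J 1) 0 :=
  HasIdxOn.of_mapsBij (Y := I → H) (Y' := I → H) h.mapsBij h.mapsBij (connOp_mem_piLau hA) h.comm
    (hasIdxOn_diagOp h.pos h.mem_g h.polar)

/-- The subspace of formal vectors corresponding to `piFil r a`. -/
def pullFil (r : ℕ) (w : I → J → H) (a : I → ℚ) : Submodule ℂ (J → H) :=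
  piLau J 1 ⊓ (piFil r a).comap (matOp w)

theorem Diagonalizes.relDim_pullFil (h : Diagonalizes r w A g) (b : I → ℚ) (n : I → ℕ) :
    RelDim (X := J → H) (pullFil r w fun j => b j + (n j : ℚ) / r) (pullFil r w b) (∑ j, n j) :=
  RelDim.comap (X := J → H) (Y := I → H) (relDim_piFil h.pos b n)
    fun y hy => h.surj y (piFil_le _ hy)

/-- In diagonal coordinates each `z d/dz - g_l` is bijective from order at least `a` to order at
least `a + ord g_l`; taking `a > 0` avoids the constants when `g_l = 0`. -/
theorem Diagonalizes.hasIdxOn_pullFil (h : Diagonalizes r w A g) (hA : ∀ j k, A j k ∈ laurent 1)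
    {a : ℚ} (ha : 0 < a) : HasIdxOn (X := J → H) (Y := J → H) (connOp A) (pullFil r w fun _ => a)
      (pullFil r w fun l => a + (g l).order) 0 := by
  have hg (l) : (g l).order ≤ 0 := by
    by_cases h0 : g l = 0
    · rw [h0, HahnSeries.order_zero]
    · exact (order_lt_zero_of_polar (h.polar l) h0).le
  refine HasIdxOn.of_bijOn (X := J → H) (Y := J → H) ?_ ?_ ?_
  · rintro x ⟨hx, hx'⟩
    refine ⟨connOp_mem_piLau hA x hx, ?_⟩
    change matOp w (connOp A x) ∈ piFil r _
    rw [h.comm x hx]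
    exact mem_piFil.2 fun l => eulerSub_mem_lauFil (h.mem_g l) (hg l) _ (mem_piFil.1 hx' l)
  · rintro x ⟨hx, hx'⟩ h0
    refine h.inj x hx (funext fun l => ?_)
    refine (eulerSub_bijective h.pos (h.mem_g l) (h.polar l) ha).1 _ (mem_piFil.1 hx' l) ?_
    rw [← diagOp_apply, ← h.comm x hx, h0, map_zero, Pi.zero_apply]
  · rintro y ⟨hy, hy'⟩
    choose f hf hfy using fun l => (eulerSub_bijective h.pos (h.mem_g l) (h.polar l) ha).2 _
      (mem_piFil.1 hy' l)
    obtain ⟨x, hx, hxf⟩ := h.surj f (mem_piLau.2 fun l => (hf l).1)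
    have hx' : matOp w x ∈ piFil r fun _ => a := by
      rw [hxf]
      exact mem_piFil.2 hf
    refine ⟨x, ⟨hx, hx'⟩, ?_⟩
    rw [← sub_eq_zero]
    refine h.inj _ (sub_mem (connOp_mem_piLau hA x hx) hy) ?_
    rw [map_sub, h.comm x hx, hxf, sub_eq_zero]
    exact funext hfy

/-- The pole orders of `w` and of its inverse `u` bound how far the standard lattices are from those
defined in diagonal coordinates. -/
theorem Diagonalizes.exists_bound (h : Diagonalizes r w A g) : ∃ c : ℕ,
    (∀ b : ℚ, (piFil 1 fun _ : J => b) ≤ pullFil r w fun _ => b - c) ∧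
      ∀ b : ℚ, (pullFil r w fun _ => b) ≤ piFil 1 fun _ => b - c := by
  obtain ⟨u, hu, -, h2⟩ := exists_inverse_matOp h.pos h.mem h.card h.inj
  obtain ⟨c, hc⟩ := exists_nat_mem_fil fun k : I × J => w k.1 k.2
  obtain ⟨d, hd⟩ := exists_nat_mem_fil fun k : J × (I × Fin r) => u k.1 k.2
  -- The extra `1` is the loss of order in passing to the components `part r i`.
  refine ⟨max c (d + 1), fun b x hx => ⟨piFil_le _ hx, ?_⟩, fun b x hx => ?_⟩
  · refine piFil_anti ?_ (matOp_mem_piFil h.mem (fun l j => hc (l, j))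
      (mem_piFil.2 fun j => ⟨laurent_one_le r h.pos (mem_piFil.1 hx j).1, (mem_piFil.1 hx j).2⟩))
    intro l
    have : (c : ℚ) ≤ (max c (d + 1) : ℕ) := by exact_mod_cast le_max_left _ _
    linarith
  · rw [← h2 x hx.1]
    refine piFil_anti ?_ (matOp_mem_piFil hu (fun l j => hd (l, j)) (mem_piFil.2 fun k =>
      ⟨part_mem _ _, part_mem_fil (mem_piFil.1 hx.2 k.1).2 k.2⟩))
    intro l
    have : ((d + 1 : ℕ) : ℚ) ≤ (max c (d + 1) : ℕ) := by exact_mod_cast le_max_right _ _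
    push_cast at this ⊢
    linarith

/-- The index of a formal connection on lattices. -/
theorem Diagonalizes.hasIdxOn_lattice (h : Diagonalizes r w A g) (hA : ∀ j k, A j k ∈ laurent 1)
    {m : ℕ} (hAm : ∀ j k, A j k ∈ fil (-m)) {p : I → ℕ} (hp : ∀ l, (g l).order = -(p l : ℚ) / r) :
    HasIdxOn (X := J → H) (Y := J → H) (connOp A) (piFil 1 fun _ => 0) (piFil 1 fun _ => -m)
      (∑ l, p l - m * Fintype.card J : ℤ) := by
  have hr : (0 : ℚ) < r := by exact_mod_cast h.pos
  obtain ⟨c, hc1, hc2⟩ := h.exists_bound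
  set P := ∑ l, p l
  have hpP (l) : (p l : ℚ) / r ≤ P := by
    have h1 : (p l : ℚ) ≤ P := by
      exact_mod_cast Finset.single_le_sum (f := p) (fun _ _ => Nat.zero_le _) (Finset.mem_univ l)
    refine le_trans (div_le_self (by positivity) ?_) h1
    exact_mod_cast h.pos
  -- With this `a` the lattice of order `a` and its image, whose orders drop by at most `P`, both
  -- lie in the standard lattices; `b` gives a lattice containing everything, which makes all
  -- relative dimensions finite.
  let a : ℕ := c + P + 1
  let b : ℕ := m + c
  have hT : ∀ x ∈ piFil 1 fun _ : J => 0, connOp A x ∈ piFil 1 fun _ : J => -(m : ℚ) := by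
    exact connOp_mem_piFil hA hAm
  have h1 : (pullFil r w fun _ => (a : ℚ)) ≤ piFil 1 fun _ => 0 :=
    (hc2 a).trans (piFil_anti fun _ => by push_cast [a]; linarith [show (0 : ℚ) ≤ P by positivity])
  have h2 : (piFil 1 fun _ : J => (0 : ℚ)) ≤ piFil 1 fun _ => -(m : ℚ) :=
    piFil_anti fun _ => by simp
  have h3 : (piFil 1 fun _ : J => -(m : ℚ)) ≤ pullFil r w fun _ => -(b : ℚ) := by
    refine (hc1 _).trans (le_of_eq ?_)
    congr 1
    funext _
    push_cast [b]
    ring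
  have h4 : (pullFil r w fun l => (a : ℚ) + (g l).order) ≤ piFil 1 fun _ => -(m : ℚ) := by
    have h5 : (pullFil r w fun l => (a : ℚ) + (g l).order) ≤ pullFil r w fun _ => (c : ℚ) := by
      refine inf_le_inf_left _ (Submodule.comap_mono (piFil_anti fun l => ?_))
      rw [hp, neg_div]
      push_cast [a]
      linarith [hpP l]
    exact h5.trans ((hc2 _).trans (piFil_anti fun _ => by simp))
  have hab := h.relDim_pullFil (fun _ => -(b : ℚ)) fun _ => (a + b) * r
  have hab' : (fun _ : I => -(b : ℚ) + (((a + b) * r : ℕ) : ℚ) / r) = fun _ => (a : ℚ) := by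
    funext _
    push_cast
    field_simp
    ring
  rw [hab'] at hab
  obtain ⟨N, -, hN, -, -⟩ := RelDim.trans (X := J → H) (h1.trans h2) h3 hab
  obtain ⟨n, n₁, hn, hn₁, hnN⟩ := RelDim.trans (X := J → H) h1 h2 hN
  have hP := h.relDim_pullFil (fun l => (a : ℚ) + (g l).order) p
  have hP' : (fun l : I => (a : ℚ) + (g l).order + (p l : ℚ) / r) = fun _ => (a : ℚ) := by
    funext l
    rw [hp]
    ring
  rw [hP'] at hP
  -- Two chains with the same ends give `n + m |J| = N = P + n'`, hence the correction `n - n' = P -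
  -- m |J|` to the index `0`.
  obtain ⟨n₂, n', hn₂, hn', hnN'⟩ := RelDim.trans (X := J → H) hP.le h4 hN
  have e₂ : n₂ = P := hn₂.unique hP
  have hm := relDim_piFil (J := J) (s := 1) one_pos (fun _ => -(m : ℚ)) fun _ => m
  have hm' : (fun _ : J => -(m : ℚ) + (m : ℚ) / (1 : ℕ)) = fun _ => 0 := by
    funext _
    simp
  rw [hm'] at hm
  have e₁ : n₁ = m * Fintype.card J := by
    rw [hn₁.unique hm, Finset.sum_const, Finset.card_univ, smul_eq_mul, mul_comm]
  refine ((h.hasIdxOn_pullFil hA (a := a) (by positivity)).of_relDim (X := J → H) (Y := J → H) hT hn hn').congr ?_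
  have : (n₁ : ℤ) = m * Fintype.card J := by exact_mod_cast e₁
  omega

end FormalIndex

end IrregularSpectral

end

noncomputable section

namespace IrregularSpectral

/-! ### Convergent lattices as spaces of sequences -/

section Sequences

/-- The series `∑ c_n z^(n - m)`. -/
def ofSeq (m : ℕ) (c : ℕ → ℂ) : H :=
  ⟨fun a => open Classical in if ∃ n : ℕ, a = n - m then c ⌊a + m⌋₊ else 0, by
    refine isPWO_of_int_div one_pos (-m) _ fun a ha => ?_
    obtain ⟨n, rfl⟩ : ∃ n : ℕ, a = n - m := by_contra fun h => ha (if_neg h)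
    exact ⟨by linarith [n.cast_nonneg (α := ℚ)], n - m, by push_cast; simp⟩⟩

theorem coeff_ofSeq (m : ℕ) (c : ℕ → ℂ) (n : ℕ) : (ofSeq m c).coeff (n - m) = c n := by
  refine (if_pos ⟨n, rfl⟩).trans ?_
  rw [sub_add_cancel, Nat.floor_natCast]

theorem coeff_ofSeq_of_not {m : ℕ} {c : ℕ → ℂ} {a : ℚ} (h : ¬∃ n : ℕ, a = n - m) :
    (ofSeq m c).coeff a = 0 := if_neg h

theorem exists_nat_of_mem {m : ℕ} {f : H} (hf : f ∈ lauFil 1 (-m)) {a : ℚ} (ha : f.coeff a ≠ 0) :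
    ∃ n : ℕ, a = n - m := by
  obtain ⟨k, rfl⟩ := mem_laurent_one.1 hf.1 a ha
  have h1 : (-m : ℚ) ≤ k := not_lt.1 fun h => ha (mem_fil_iff.1 hf.2 _ h)
  have h2 : -(m : ℤ) ≤ k := by exact_mod_cast h1
  refine ⟨(k + m).toNat, ?_⟩
  have h3 : (((k + m).toNat : ℤ) : ℚ) = ((k + m : ℤ) : ℚ) := by
    rw [Int.toNat_of_nonneg (by omega)]
  push_cast at h3
  rw [h3]
  ring

theorem ofSeq_mem (m : ℕ) (c : ℕ → ℂ) : ofSeq m c ∈ lauFil 1 (-m) := by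
  refine ⟨mem_laurent_one.2 fun a ha => ?_, mem_fil_iff.2 fun a ha => ?_⟩
  · obtain ⟨n, rfl⟩ := by_contra fun h => ha (coeff_ofSeq_of_not h)
    exact ⟨n - m, by push_cast; ring⟩
  · refine coeff_ofSeq_of_not ?_
    rintro ⟨n, rfl⟩
    linarith [n.cast_nonneg (α := ℚ)]

theorem ext_of_mem {m : ℕ} {f g : H} (hf : f ∈ lauFil 1 (-m)) (hg : g ∈ lauFil 1 (-m))
    (h : ∀ n : ℕ, f.coeff (n - m) = g.coeff (n - m)) : f = g := by
  ext a
  by_cases ha : ∃ n : ℕ, a = n - m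
  · obtain ⟨n, rfl⟩ := ha
    exact h n
  · rw [not_not.1 fun h => ha (exists_nat_of_mem hf h), not_not.1 fun h => ha (exists_nat_of_mem hg h)]

theorem summableAt_iff {m : ℕ} {f : H} (hf : f ∈ lauFil 1 (-m)) {ρ : ℝ} (hρ : 0 < ρ) :
    SummableAt f ρ ↔ Summable fun n : ℕ => ‖f.coeff (n - m)‖ * ρ ^ n := by
  have hi : Function.Injective fun n : ℕ => (n : ℚ) - m := fun a b h => by
    simpa using h
  rw [SummableAt, ← hi.summable_iff (fun a ha => ?_)]
  · have h1 (n : ℕ) : ρ ^ n = ρ ^ (((n : ℚ) - m : ℚ) : ℝ) * ρ ^ m := by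
      rw [← Real.rpow_natCast, ← Real.rpow_natCast, ← Real.rpow_add hρ]
      push_cast
      simp
    have h2 (n : ℕ) : ‖f.coeff (n - m)‖ * ρ ^ n =
        ‖f.coeff (n - m)‖ * ρ ^ (((n : ℚ) - m : ℚ) : ℝ) * ρ ^ m := by
      rw [h1, mul_assoc]
    rw [summable_congr h2, summable_mul_right_iff (by positivity)]
    rfl
  · by_cases h0 : f.coeff a = 0
    · simp [h0]
    · obtain ⟨n, rfl⟩ := exists_nat_of_mem hf h0
      exact absurd ⟨n, rfl⟩ ha

theorem exists_common_radius {ι : Type*} [Finite ι] {f : ι → H} (hf : ∀ i, f i ∈ convergent) :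
    ∃ ρ : ℝ, 0 < ρ ∧ ∀ i, SummableAt (f i) ρ := by
  cases nonempty_fintype ι
  choose ρ hρ hs using hf
  -- In the order dual an upper bound of a finite set is a positive lower bound for the radii, also
  -- when the family is empty.
  obtain ⟨σ, hσ⟩ := Finset.exists_le (Finset.univ.image fun i => (OrderDual.toDual ⟨ρ i, hρ i⟩ : (Set.Ioi (0 : ℝ))ᵒᵈ))
  refine ⟨(OrderDual.ofDual σ).1, (OrderDual.ofDual σ).2, fun i => ?_⟩
  have := hσ _ (Finset.mem_image_of_mem _ (Finset.mem_univ i))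
  exact summableAt_of_le (OrderDual.ofDual σ).2 this (hs i)

theorem coeff_mul_of_mem {m : ℕ} {f g : H} (hf : f ∈ lauFil 1 (-m)) (hg : g ∈ lauFil 1 0) (n : ℕ) :
    (f * g).coeff (n - m) =
      ∑ l ∈ Finset.range (n + 1), f.coeff ((n - l : ℕ) - m) * g.coeff l := by
  have hg' : g ∈ lauFil 1 (-(0 : ℕ)) := by simpa using hg
  rw [HahnSeries.coeff_mul]
  have key : ∀ p ∈ Finset.antidiagonal f.isPWO_support g.isPWO_support ((n : ℚ) - m),
      ∃ l : ℕ, l ≤ n ∧ p.2 = l ∧ p.1 = ((n - l : ℕ) : ℚ) - m := by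
    intro p hp
    obtain ⟨h1, h2, h3⟩ := Finset.mem_antidiagonal.1 hp
    obtain ⟨l, hl⟩ := exists_nat_of_mem hg' h2
    obtain ⟨k, hk⟩ := exists_nat_of_mem hf h1
    have h4 : ((k + l : ℕ) : ℚ) = n := by
      push_cast at hl ⊢
      linarith
    have h5 : k + l = n := by exact_mod_cast h4
    refine ⟨l, by omega, by simpa using hl, ?_⟩
    rw [hk, ← h5, Nat.add_sub_cancel]
  refine Finset.sum_of_injOn (fun p => ⌊p.2⌋₊) ?_ ?_ ?_ ?_
  · intro p hp p' hp' h
    obtain ⟨l, -, h1, h2⟩ := key p hp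
    obtain ⟨l', -, h1', h2'⟩ := key p' hp'
    simp only [h1, h1', Nat.floor_natCast] at h
    subst h
    exact Prod.ext (h2.trans h2'.symm) (h1.trans h1'.symm)
  · intro p hp
    obtain ⟨l, hl, h1, -⟩ := key p hp
    simp only [h1, Nat.floor_natCast, Finset.coe_range, Set.mem_Iio]
    omega
  · intro l hl hl'
    by_contra hne
    refine hl' ⟨(((n - l : ℕ) : ℚ) - m, l), Finset.mem_coe.2 (Finset.mem_antidiagonal.2
      ⟨left_ne_zero_of_mul hne, right_ne_zero_of_mul hne, ?_⟩), by simp⟩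
    have : l ≤ n := by simpa [Nat.lt_succ_iff] using hl
    push_cast [this]
    ring
  · intro p hp
    obtain ⟨l, -, h1, h2⟩ := key p hp
    simp only [h1, h2, Nat.floor_natCast]

end Sequences

/-! ### Excision between convergent and formal vectors -/

section ConvergentIndex

variable {J : Type*}

/-- Vectors of convergent Laurent series. -/
def piConv (J : Type*) : Submodule ℂ (J → H) :=
  Submodule.pi Set.univ fun _ => Subalgebra.toSubmodule (convLaurent 1)

theorem mem_piConv {x : J → H} : x ∈ piConv J ↔ ∀ j, x j ∈ convLaurent 1 := by
  simp [piConv, Submodule.mem_pi]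

/-- The coefficients of a vector of Laurent series with a pole of order at most `m`. -/
def toSeq (m : ℕ) : (J → H) →ₗ[ℂ] (ℕ → J → ℂ) where
  toFun x n j := (x j).coeff (n - m)
  map_add' _ _ := rfl
  map_smul' _ _ := rfl

/-- The polar part of a formal Laurent series is a finite sum, hence convergent, and the rest is a
formal power series. -/
theorem sup_piFil (m : ℕ) : (piConv J ⊔ piFil 1 fun _ => -(m : ℚ)) = piLau J 1 := by
  refine le_antisymm (sup_le (fun x hx => mem_piLau.2 fun j => (mem_piConv.1 hx j).1)
    (piFil_le _)) fun x hx => ?_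
  let t (j : J) : H := HahnSeries.truncLT 0 (x j)
  have hc (j : J) (a : ℚ) : (t j).coeff a = if a < 0 then (x j).coeff a else 0 := rfl
  have ht (j : J) : t j ∈ laurent 1 := fun a ha => mem_piLau.1 hx j a fun h0 => ha (by simp [hc, h0])
  have hxt : x = t + (x - t) := by abel
  rw [hxt]
  refine Submodule.add_mem_sup (mem_piConv.2 fun j => ⟨ht j, ?_⟩) (mem_piFil.2 fun j =>
    ⟨sub_mem (mem_piLau.1 hx j) (ht j), mem_fil_iff.2 fun a ha => ?_⟩)
  · obtain ⟨n, hn⟩ := exists_nat_ge (-(t j).order)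
    have hmem : t j ∈ lauFil 1 (-n) := ⟨ht j, fil_anti (by linarith) (mem_fil_order _)⟩
    refine ⟨1, one_pos, (summableAt_iff hmem one_pos).2
      (summable_of_ne_finset_zero (s := Finset.range n) fun k hk => ?_)⟩
    have hk : (n : ℚ) ≤ k := by exact_mod_cast not_lt.1 fun h => hk (Finset.mem_range.2 h)
    rw [hc, if_neg (by linarith), norm_zero, zero_mul]
  · have : a < 0 := ha.trans_le (by simp)
    rw [Pi.sub_apply, HahnSeries.coeff_sub, hc, if_pos this, sub_self]

variable [Fintype J]

theorem mapsBij_toSeq (m : ℕ) : MapsBij (X := J → H) (toSeq m)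
    (piConv J ⊓ piFil 1 fun _ => -(m : ℚ)) (convSeq (J → ℂ)) := by
  refine ⟨fun x hx => ?_, fun x hx h0 => ?_, fun y hy => ?_⟩
  · obtain ⟨ρ, hρ, hs⟩ := exists_common_radius fun j => (mem_piConv.1 hx.1 j).2
    refine ⟨ρ, hρ, (mem_weighted hρ).2 ?_⟩
    refine Summable.of_nonneg_of_le (fun n => by positivity) (fun n => ?_)
      (summable_sum fun j (_ : j ∈ Finset.univ) => (summableAt_iff (mem_piFil.1 hx.2 j) hρ).1 (hs j))
    rw [← Finset.sum_mul]
    gcongr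
    exact (pi_norm_le_iff_of_nonneg (by positivity)).2 fun j =>
      Finset.single_le_sum (f := fun j => ‖(x j).coeff (n - m)‖) (fun _ _ => norm_nonneg _)
        (Finset.mem_univ j)
  · funext j
    refine ext_of_mem (mem_piFil.1 hx.2 j) (zero_mem _) fun n => ?_
    exact congrFun (congrFun h0 n) j
  · obtain ⟨ρ, hρ, hs⟩ := hy
    rw [mem_weighted hρ] at hs
    refine ⟨fun j => ofSeq m fun n => y n j, ⟨mem_piConv.2 fun j => ⟨(ofSeq_mem m _).1, ρ, hρ, ?_⟩,
      mem_piFil.2 fun j => ofSeq_mem m _⟩, ?_⟩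
    · rw [summableAt_iff (ofSeq_mem m _) hρ]
      refine Summable.of_nonneg_of_le (fun n => by positivity) (fun n => ?_) hs
      rw [coeff_ofSeq]
      gcongr
      exact norm_le_pi_norm (y n) j
    · funext n j
      exact coeff_ofSeq m (fun n => y n j) n

theorem euler_mem_convLaurent {f : H} (hf : f ∈ convLaurent 1) : euler f ∈ convLaurent 1 :=
  ⟨euler_mem_laurent hf.1, by
    rw [euler_eq]
    exact mul_mem (single_mem_convergent _ _) (ddz_mem_convergent hf.2)⟩

theorem connOp_mem_piConv {A : J → J → H} (hA : ∀ j k, A j k ∈ convLaurent 1) :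
    ∀ x ∈ piConv J, connOp A x ∈ piConv J := by
  refine fun x hx => mem_piConv.2 fun j => ?_
  rw [connOp_apply]
  exact sub_mem (euler_mem_convLaurent (mem_piConv.1 hx j))
    (sum_mem fun k _ => mul_mem (hA j k) (mem_piConv.1 hx k))

/-- The index of a convergent connection on lattices. -/
theorem hasIdxOn_convergent_lattice {A : J → J → H} (hA : ∀ j k, A j k ∈ convLaurent 1) {m : ℕ}
    (hAm : ∀ j k, A j k ∈ fil (-m)) :
    HasIdxOn (X := J → H) (Y := J → H) (connOp A) (piConv J ⊓ piFil 1 fun _ => 0)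
      (piConv J ⊓ piFil 1 fun _ => -(m : ℚ)) (-(m * Fintype.card J : ℤ)) := by
  classical
  -- The coefficient of `z^k` in `z^m A`, which has no pole.
  let a (k : ℕ) : (J → ℂ) →L[ℂ] (J → ℂ) :=
    LinearMap.toContinuousLinearMap (Matrix.toLin' fun i j => (A i j).coeff (k - m))
  have ha (k : ℕ) (v : J → ℂ) (i : J) : a k v i = ∑ j, (A i j).coeff (k - m) * v j := rfl
  obtain ⟨ρ, hρ, hs⟩ := exists_common_radius fun ij : J × J => (hA ij.1 ij.2).2
  have hAl (i j) : A i j ∈ lauFil 1 (-m) := ⟨(hA i j).1, hAm i j⟩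
  have hsum : Summable fun k => ‖a k‖ * ρ ^ k := by
    refine Summable.of_nonneg_of_le (fun n => by positivity) (fun n => ?_)
      (summable_sum fun ij (_ : ij ∈ Finset.univ) =>
        (summableAt_iff (hAl (Prod.fst ij) (Prod.snd ij)) hρ).1 (hs ij))
    rw [← Finset.sum_mul]
    gcongr
    refine ContinuousLinearMap.opNorm_le_bound _ (by positivity) fun v => ?_
    refine (pi_norm_le_iff_of_nonneg (by positivity)).2 fun i => ?_
    rw [ha, Fintype.sum_prod_type, Finset.sum_mul]
    refine (norm_sum_le _ _).trans ?_
    refine le_trans ?_ (Finset.single_le_sum (f := fun i => (∑ j, ‖(A i j).coeff (n - m)‖) * ‖v‖)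
        (fun _ _ => by positivity) (Finset.mem_univ i))
    rw [Finset.sum_mul]
    refine Finset.sum_le_sum fun j _ => ?_
    rw [norm_mul]
    gcongr
    exact norm_le_pi_norm v j
  have hidx := hasIdx_singularOp (m := m) hρ hsum
  rw [Module.finrank_fintype_fun_eq_card] at hidx
  have h0 : MapsBij (X := J → H) (toSeq 0) (piConv J ⊓ piFil 1 fun _ => 0) (convSeq (J → ℂ)) := by
    simpa using mapsBij_toSeq (J := J) 0
  -- The source is read from exponent `0` and the target from `-m`; this multiplies the equation by
  -- `z^m` and produces `singularOp`.
  refine HasIdxOn.of_mapsBij (X := J → H) (X' := J → H) h0 (mapsBij_toSeq m) ?_ ?_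
    ⟨_, hidx⟩
  · exact fun x hx => ⟨connOp_mem_piConv hA x hx.1,
      connOp_mem_piFil (fun i j => (hA i j).1) hAm x hx.2⟩
  · rintro x ⟨hx, hx'⟩
    funext n i
    change (connOp A x i).coeff _ = (if m ≤ n then (((n - m : ℕ) : ℂ) • toSeq 0 x (n - m)) else 0) i
      - (∑ l ∈ Finset.range (n + 1), a (n - l) (toSeq 0 x l)) i
    rw [connOp_apply, HahnSeries.coeff_sub, coeff_euler]
    congr 1
    · split_ifs with h
      · simp [toSeq, h]
      · rw [mem_fil_iff.1 (mem_piFil.1 hx' i).2, mul_zero, Pi.zero_apply]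
        have : (n : ℚ) < m := by exact_mod_cast not_le.1 h
        linarith
    · rw [HahnSeries.coeff_sum, Finset.sum_apply]
      simp only [ha, coeff_mul_of_mem (hAl _ _) (mem_piFil.1 hx' _)]
      rw [Finset.sum_comm]
      simp [toSeq]

/-- The index of a convergent connection with given formal exponents. -/
theorem Diagonalizes.hasIdxOn_convergent {I : Type*} [Fintype I] {r : ℕ} {w : I → J → H}
    {A : J → J → H} {g : I → H} (h : Diagonalizes r w A g) (hA : ∀ j k, A j k ∈ convLaurent 1)
    {p : I → ℕ} (hp : ∀ l, (g l).order = -(p l : ℚ) / r) :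
    HasIdxOn (X := J → H) (Y := J → H) (connOp A) (piConv J) (piConv J) (-∑ l, p l : ℤ) := by
  obtain ⟨m, hm⟩ := exists_nat_mem_fil fun ij : J × J => A ij.1 ij.2
  have hA' (j k) := (hA j k).1
  have hm' (j k) := hm (j, k)
  have h0 := sup_piFil (J := J) 0
  rw [Nat.cast_zero, neg_zero] at h0
  -- The indices are `-m |J|` on the intersection, `0` on the sum and `∑ p_l - m |J|` on the formal
  -- lattice; the auxiliary `m` cancels.
  refine (HasIdxOn.inf_sup (X := J → H) (Y := J → H) (connOp_mem_piConv hA)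
    (connOp_mem_piFil hA' hm') (hasIdxOn_convergent_lattice hA hm') ?_
    (h.hasIdxOn_lattice hA' hm' hp)).congr (j := -∑ l, p l) (i := _ + 0 - _) (by ring)
  rw [h0, sup_piFil m]
  exact h.hasIdxOn_formal hA'

end ConvergentIndex

end IrregularSpectral

end

noncomputable section

namespace IrregularSpectral

/-! ### Galois action on a frame of eigenvectors -/

section Frame

theorem euler_add (f g : H) : euler (f + g) = euler f + euler g := by
  ext a
  simp only [coeff_euler, HahnSeries.coeff_add, mul_add]

/-- `z d/dz` as an additive map. -/
def eulerAdd : H →+ H := AddMonoidHom.mk' euler euler_add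

theorem euler_sum {ι : Type*} (S : Finset ι) (f : ι → H) :
    euler (∑ i ∈ S, f i) = ∑ i ∈ S, euler (f i) := map_sum eulerAdd f S

theorem euler_one : euler 1 = 0 := by
  have h := euler_mul 1 1
  rw [mul_one, mul_one, one_mul] at h
  simpa using h

theorem euler_zero : euler 0 = 0 := map_zero eulerAdd

theorem euler_xi (f : H) : euler (xi f) = xi (euler f) := by
  ext a
  simp only [coeff_euler, coeff_xi]
  ring

theorem xi_add (f g : H) : xi (f + g) = xi f + xi g := map_add xiHom f g

theorem xi_mul (f g : H) : xi (f * g) = xi f * xi g := map_mul xiHom f g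

theorem xi_sum {ι : Type*} (S : Finset ι) (f : ι → H) : xi (∑ i ∈ S, f i) = ∑ i ∈ S, xi (f i) :=
  map_sum xiHom f S

theorem xi_algebraMap (c : ℂ) : xi (algebraMap ℂ H c) = algebraMap ℂ H c := xiHom.commutes c

theorem xi_iterate_mul (n : ℕ) (f g : H) : xi^[n] (f * g) = xi^[n] f * xi^[n] g := by
  simp only [xi_iterate_eq, map_mul]

theorem map_euler_mul {ι κ μ : Type*} [Fintype κ] (B : Matrix ι κ H) (C : Matrix κ μ H) :
    (B * C).map euler = B.map euler * C + B * C.map euler := by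
  ext1 i j
  simp only [Matrix.map_apply, Matrix.mul_apply, Matrix.add_apply, euler_sum, euler_mul,
    Finset.sum_add_distrib]

theorem map_xi_mul {ι κ μ : Type*} [Fintype κ] (B : Matrix ι κ H) (C : Matrix κ μ H) :
    (B * C).map xi = B.map xi * C.map xi := by
  ext1 i j
  simp only [Matrix.map_apply, Matrix.mul_apply, xi_sum, xi_mul]

/-- The exponents `ξ^k(q) + R`. -/
def expMatrix (q : H) (R : ℂ) (r : ℕ) : Matrix (Fin r) (Fin r) H :=
  Matrix.diagonal fun k => xi^[(k : ℕ)] q + algebraMap ℂ H R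

/-- The columns of `B` are a frame of eigenvectors of `z d/dz - A₀`, for the exponents of an
elementary cell; `B'` is its inverse. -/
structure EigenFrame (q : H) (R : ℂ) (r : ℕ) (A₀ B B' : Matrix (Fin r) (Fin r) H) : Prop where
  hq : q ∈ polarAll
  hr : r = ramificationIndex q
  mem : ∀ i j, A₀ i j ∈ laurent 1
  mul : B * B' = 1
  mul' : B' * B = 1
  eq : B.map euler = A₀ * B - B * expMatrix q R r

variable {q : H} {R : ℂ} {r : ℕ} {A₀ B B' : Matrix (Fin r) (Fin r) H}

theorem EigenFrame.pos (h : EigenFrame q R r A₀ B B') : 0 < r :=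
  h.hr ▸ (ramificationIndex_spec h.hq).1

/-- Differentiating `B' B = 1` gives the dual equation for the inverse frame. -/
theorem EigenFrame.eq' (h : EigenFrame q R r A₀ B B') :
    B'.map euler = expMatrix q R r * B' - B' * A₀ := by
  have h1 : (B' * B).map euler = 0 := by
    rw [h.mul']
    ext1 i j
    rw [Matrix.map_apply, Matrix.one_apply]
    split_ifs
    exacts [euler_one, euler_zero]
  rw [map_euler_mul, h.eq, mul_sub, ← mul_assoc B' B, h.mul', one_mul] at h1
  have h2 := congrArg (fun X => X * B') (eq_neg_of_add_eq_zero_left h1)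
  simp only [mul_assoc, h.mul, mul_one, neg_sub, sub_mul] at h2
  exact h2

theorem conj_aux {S : Type*} [Ring S] (B B' A D X X' : S) :
    B' * (X' - A * X + X * A) * B = ((D * B' - B' * A) * X + B' * X') * B
      + B' * X * (A * B - B * D) - D * (B' * X * B) + (B' * X * B) * D := by
  noncomm_ring

/-- Conjugation with the frame diagonalizes the induced operator on endomorphisms. -/
theorem EigenFrame.conj (h : EigenFrame q R r A₀ B B') (X : Matrix (Fin r) (Fin r) H) :
    B' * (X.map euler - A₀ * X + X * A₀) * B = (B' * X * B).map euler
      - expMatrix q R r * (B' * X * B) + (B' * X * B) * expMatrix q R r := by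
  rw [map_euler_mul, map_euler_mul, h.eq', h.eq]
  exact conj_aux B B' A₀ _ X _

/-- `ξ` fixes `A₀`, so `ξ(B)` is again a frame of eigenvectors, with exponents moved one step along
the Galois orbit. The transition matrix between the two frames satisfies a scalar equation in each
entry, and `R` cancels. -/
theorem EigenFrame.euler_transition (h : EigenFrame q R r A₀ B B') (k l : Fin r) :
    euler ((B' * B.map xi) k l) =
      (xi^[(k : ℕ)] q - xi^[(l : ℕ) + 1] q) * (B' * B.map xi) k l := by
  have hA : A₀.map xi = A₀ := by
    ext1 i j
    exact xi_eq_self_of_laurent_one (h.mem i j)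
  have h1 : (B.map xi).map euler = A₀ * B.map xi - B.map xi * (expMatrix q R r).map xi := by
    have h2 : (B.map xi).map euler = (B.map euler).map xi := by
      ext1 i j
      exact euler_xi _
    rw [h2, h.eq, ← map_xi_mul]
    conv_rhs => rw [← hA, ← map_xi_mul]
    ext1 i j
    exact map_sub xiHom _ _
  have h3 : (B' * B.map xi).map euler =
      expMatrix q R r * (B' * B.map xi) - (B' * B.map xi) * (expMatrix q R r).map xi := by
    rw [map_euler_mul, h.eq', h1, sub_mul, mul_sub, mul_assoc, mul_assoc, mul_assoc]
    abel
  have h4 : (expMatrix q R r).map xi =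
      Matrix.diagonal fun k : Fin r => xi^[(k : ℕ) + 1] q + algebraMap ℂ H R := by
    ext1 i j
    rw [expMatrix, Matrix.map_apply]
    rcases eq_or_ne i j with rfl | hij
    · rw [Matrix.diagonal_apply_eq, Matrix.diagonal_apply_eq, xi_add, xi_algebraMap,
        Function.iterate_succ_apply']
    · rw [Matrix.diagonal_apply_ne _ hij, Matrix.diagonal_apply_ne _ hij]
      exact map_zero xiHom
  have h5 := congrFun (congrFun h3 k) l
  rw [h4, expMatrix, Matrix.sub_apply, Matrix.diagonal_mul, Matrix.mul_diagonal,
    Matrix.map_apply] at h5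
  rw [h5]
  ring

/-- The cyclic shift of indices. -/
def cyc (l : Fin r) : Fin r := ⟨((l : ℕ) + 1) % r, Nat.mod_lt _ l.pos⟩

theorem cyc_iterate (n : ℕ) (l : Fin r) : ((cyc^[n] l : Fin r) : ℕ) = ((l : ℕ) + n) % r := by
  induction n with
  | zero => exact (Nat.mod_eq_of_lt l.2).symm
  | succ n ih =>
    rw [Function.iterate_succ_apply', cyc]
    change (((cyc^[n] l : Fin r) : ℕ) + 1) % r = _
    rw [ih, Nat.mod_add_mod, add_assoc]

theorem cyc_iterate_self (l : Fin r) : cyc^[r] l = l := by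
  refine Fin.ext ?_
  rw [cyc_iterate, Nat.add_mod_right, Nat.mod_eq_of_lt l.2]

theorem cyc_surjective : Function.Surjective (cyc : Fin r → Fin r) := by
  intro l
  refine ⟨cyc^[r - 1] l, ?_⟩
  rw [← Function.iterate_succ_apply' cyc, Nat.succ_eq_add_one, Nat.sub_add_cancel l.pos,
    cyc_iterate_self]

theorem cyc_iterate_zero (hr : 0 < r) (l : Fin r) : cyc^[(l : ℕ)] ⟨0, hr⟩ = l := by
  refine Fin.ext ?_
  rw [cyc_iterate, zero_add, Nat.mod_eq_of_lt l.2]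

/-- In the transition matrix an entry joining different conjugates of `q` solves `z y' = g y` with
`g ≠ 0` polar and vanishes; an entry joining equal ones is constant. So `ξ` permutes the eigenlines
cyclically up to constants. -/
theorem EigenFrame.exists_cyc (h : EigenFrame q R r A₀ B B') :
    ∃ c : Fin r → ℂ, (∀ l, c l ≠ 0) ∧ (∀ i l, xi (B i l) = algebraMap ℂ H (c l) * B i (cyc l)) ∧
      ∀ i l, algebraMap ℂ H (c l) * xi (B' l i) = B' (cyc l) i := by
  have hne (k l : Fin r) (hkl : k ≠ cyc l) : (B' * B.map xi) k l = 0 := by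
    have hmod : (k : ℕ) % ramificationIndex q ≠ ((l : ℕ) + 1) % ramificationIndex q := by
      rw [← h.hr, Nat.mod_eq_of_lt k.2]
      exact fun he => hkl (Fin.ext he)
    refine eq_zero_of_euler_eq (sub_polar ?_ ?_) (sub_ne_zero.2 (xi_iterate_ne_of_mod_ne h.hq hmod))
      (h.euler_transition k l)
    all_goals exact xi_iterate_polar (ramificationIndex_spec h.hq).2.2 _
  have hc (l : Fin r) : ∃ c : ℂ, (B' * B.map xi) (cyc l) l = algebraMap ℂ H c := by
    refine exists_algebraMap_of_euler_eq_zero ?_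
    have h1 : xi^[(l : ℕ) + 1] q = xi^[((cyc l : Fin r) : ℕ)] q := by
      rw [← xi_iterate_mod h.hq, ← h.hr]
      rfl
    rw [h.euler_transition, h1, sub_self, zero_mul]
  choose c hc using hc
  have hB (i l) : xi (B i l) = algebraMap ℂ H (c l) * B i (cyc l) := by
    have h1 : B.map xi = B * (B' * B.map xi) := by rw [← mul_assoc, h.mul, one_mul]
    have h2 := congrFun (congrFun h1 i) l
    rw [Matrix.map_apply, Matrix.mul_apply, Finset.sum_eq_single (cyc l)] at h2
    · rw [h2, hc, mul_comm]
    · intro k _ hk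
      rw [hne k l hk, mul_zero]
    · exact fun hl => absurd (Finset.mem_univ _) hl
  refine ⟨c, fun l h0 => ?_, hB, fun i l => ?_⟩
  -- If `c l` were zero, column `l` of the invertible matrix `B` would vanish.
  · have h1 (i) : B i l = 0 := by
      have h2 := hB i l
      rw [h0, map_zero, zero_mul] at h2
      exact xi_injective (h2.trans (map_zero xiHom).symm)
    have h2 := congrFun (congrFun h.mul' l) l
    rw [Matrix.mul_apply, Matrix.one_apply_eq, Finset.sum_eq_zero fun i _ => by rw [h1, mul_zero]] at h2
    exact zero_ne_one h2
  · have h1 : (B' * B.map xi) * B'.map xi = B' := by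
      rw [mul_assoc, ← map_xi_mul, h.mul]
      have : (1 : Matrix (Fin r) (Fin r) H).map xi = 1 :=
        Matrix.map_one _ (map_zero xiHom) (map_one xiHom)
      rw [this, mul_one]
    have h2 := congrFun (congrFun h1 (cyc l)) i
    rw [Matrix.mul_apply, Finset.sum_eq_single l] at h2
    · rw [← h2, hc]
      rfl
    · intro k _ hk
      rw [hne, zero_mul]
      intro he
      refine hk ?_
      have h3 := congrArg (fun x => cyc^[r - 1] x) he
      simp only [← Function.iterate_succ_apply, Nat.succ_eq_add_one] at h3
      rw [Nat.sub_add_cancel l.pos, cyc_iterate_self, cyc_iterate_self] at h3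
      exact h3.symm
    · exact fun hl => absurd (Finset.mem_univ _) hl

/-- `ξ^r` multiplies every column of `B` by the product of all the `c`, and every row of `B'` by its
inverse. The frame itself need not lie in `ℂ((z^{1/r}))`, but these products are fixed by `ξ^r`. -/
theorem EigenFrame.mul_mem_laurent (h : EigenFrame q R r A₀ B B') (k l i j : Fin r) :
    B' k i * B j l ∈ laurent r := by
  obtain ⟨c, hc0, hB, hB'⟩ := h.exists_cyc
  let P (n : ℕ) (l : Fin r) : ℂ := ∏ t ∈ Finset.range n, c (cyc^[t] l)
  have hP0 (n l) : P n l ≠ 0 := Finset.prod_ne_zero_iff.2 fun _ _ => hc0 _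
  have h1 (n : ℕ) : xi^[n] (B j l) = algebraMap ℂ H (P n l) * B j (cyc^[n] l) := by
    induction n with
    | zero => simp [P]
    | succ n ih =>
      rw [Function.iterate_succ_apply', ih, xi_mul, xi_algebraMap, hB, ← mul_assoc, ← map_mul,
        Function.iterate_succ_apply']
      congr 2
      exact (Finset.prod_range_succ _ _).symm
  have h2 (n : ℕ) : algebraMap ℂ H (P n k) * xi^[n] (B' k i) = B' (cyc^[n] k) i := by
    induction n with
    | zero => simp [P]
    | succ n ih =>
      have h3 : P (n + 1) k = c (cyc^[n] k) * P n k := by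
        rw [mul_comm]
        exact Finset.prod_range_succ _ _
      rw [h3, map_mul, mul_assoc, Function.iterate_succ_apply', ← xi_algebraMap (P n k), ← xi_mul, ih,
        hB', Function.iterate_succ_apply']
  -- The product over a full cycle does not depend on its starting point.
  have h3 (l : Fin r) : P r (cyc l) = P r l := by
    have h4 : P r (cyc l) * c l = P r l * c (cyc^[r] l) := by
      have h5 := Finset.prod_range_succ' (fun t => c (cyc^[t] l)) r
      rw [Finset.prod_range_succ] at h5
      exact h5.symm
    rw [cyc_iterate_self] at h4
    exact mul_right_cancel₀ (hc0 l) h4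
  have h4 (n : ℕ) : P r (cyc^[n] ⟨0, h.pos⟩) = P r ⟨0, h.pos⟩ := by
    induction n with
    | zero => rfl
    | succ n ih => rw [Function.iterate_succ_apply', h3, ih]
  have h5 : P r l = P r k := by
    rw [← cyc_iterate_zero h.pos l, ← cyc_iterate_zero h.pos k, h4, h4]
  rw [← xi_iterate_eq_self_iff h.pos, xi_iterate_mul, h1, cyc_iterate_self]
  have h6 := h2 r
  rw [cyc_iterate_self] at h6
  rw [h5]
  linear_combination B j l * h6

/-- For `X` fixed by `ξ` the matrix `Y = B' X B` is equivariant: up to nonzero constants, `ξ`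
carries the entry `(k, l)` to `(k + 1, l + 1)`. Hence row `0` determines all rows. -/
theorem EigenFrame.xi_conj (h : EigenFrame q R r A₀ B B') {X : Matrix (Fin r) (Fin r) H}
    (hX : ∀ i j, X i j ∈ laurent 1) (h0 : ∀ l, (B' * X * B) ⟨0, h.pos⟩ l = 0) : X = 0 := by
  obtain ⟨c, hc0, hB, hB'⟩ := h.exists_cyc
  have hXx : X.map xi = X := by
    ext1 i j
    exact xi_eq_self_of_laurent_one (hX i j)
  have hY (k l : Fin r) : algebraMap ℂ H (c k) * xi ((B' * X * B) k l) =
      algebraMap ℂ H (c l) * (B' * X * B) (cyc k) (cyc l) := by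
    have h1 : xi ((B' * X * B) k l) = (B'.map xi * X * B.map xi) k l := by
      rw [← hXx, ← map_xi_mul, ← map_xi_mul, hXx]
      rfl
    rw [h1]
    simp only [Matrix.mul_apply, Matrix.map_apply, hB, Finset.mul_sum, Finset.sum_mul, ← hB']
    exact Finset.sum_congr rfl fun _ _ => Finset.sum_congr rfl fun _ _ => by ring
  have h1 (n : ℕ) : ∀ l, (B' * X * B) (cyc^[n] ⟨0, h.pos⟩) l = 0 := by
    induction n with
    | zero => exact h0
    | succ n ih =>
      intro l
      obtain ⟨l, rfl⟩ := cyc_surjective l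
      have h2 := hY (cyc^[n] ⟨0, h.pos⟩) l
      have h3 : xi 0 = 0 := map_zero xiHom
      rw [ih, h3, mul_zero, eq_comm] at h2
      rw [Function.iterate_succ_apply']
      refine (mul_eq_zero.1 h2).resolve_left fun h4 => hc0 l ?_
      exact (algebraMap ℂ H).injective (h4.trans (map_zero _).symm)
  have h2 : B' * X * B = 0 := by
    ext1 k l
    rw [← cyc_iterate_zero h.pos k]
    exact h1 k l
  calc X = B * B' * X * (B * B') := by rw [h.mul, one_mul, mul_one]
    _ = B * (B' * X * B) * B' := by noncomm_ring
    _ = 0 := by rw [h2, mul_zero, zero_mul]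

/-- The matrix of the operator induced on endomorphisms. -/
def endMatrix {n : ℕ} (A₀ : Matrix (Fin n) (Fin n) H) : Fin n × Fin n → Fin n × Fin n → H :=
  fun a b => (if a.2 = b.2 then A₀ a.1 b.1 else 0) - if a.1 = b.1 then A₀ b.2 a.2 else 0

theorem connOp_endMatrix (x : Fin r × Fin r → H) (i j : Fin r) :
    connOp (endMatrix A₀) x (i, j) = ((Matrix.of fun i j => x (i, j)).map euler
      - A₀ * (Matrix.of fun i j => x (i, j)) + (Matrix.of fun i j => x (i, j)) * A₀) i j := by
  rw [connOp_apply, Fintype.sum_prod_type]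
  simp only [endMatrix, sub_mul, Finset.sum_sub_distrib, ite_mul, zero_mul, Finset.sum_ite_eq,
    Finset.mem_univ, if_true, Matrix.sub_apply, Matrix.add_apply, Matrix.map_apply, Matrix.mul_apply,
    Matrix.of_apply]
  rw [Finset.sum_comm (γ := Fin r)]
  simp only [Finset.sum_ite_eq, Finset.mem_univ, if_true]
  rw [Finset.sum_congr rfl fun k _ => mul_comm (x (i, k)) (A₀ k j)]
  ring

/-- The diagonalizing coordinates of `X` are the `r` entries of row `0` of `B' X B`. Each lies in
`ℂ((z^{1/r}))`, so together they have dimension `r²` over `ℂ((z))`, as many as the entries of `X`.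
-/
theorem EigenFrame.diagonalizes (h : EigenFrame q R r A₀ B B') :
    Diagonalizes r (fun (l : Fin r) (a : Fin r × Fin r) => B' ⟨0, h.pos⟩ a.1 * B a.2 l)
      (endMatrix A₀) fun l => q - xi^[(l : ℕ)] q := by
  have hw (x : Fin r × Fin r → H) (l : Fin r) :
      matOp (fun (l : Fin r) (a : Fin r × Fin r) => B' ⟨0, h.pos⟩ a.1 * B a.2 l) x l =
        (B' * (Matrix.of fun i j => x (i, j)) * B) ⟨0, h.pos⟩ l := by
    rw [matOp_apply, Fintype.sum_prod_type, Finset.sum_comm]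
    simp only [Matrix.mul_apply, Matrix.of_apply, Finset.sum_mul]
    exact Finset.sum_congr rfl fun _ _ => Finset.sum_congr rfl fun _ _ => by ring
  have hq := (ramificationIndex_spec h.hq).2
  rw [← h.hr] at hq
  refine ⟨h.pos, fun l a => h.mul_mem_laurent _ _ _ _, by simp, fun x hx h0 => ?_,
    fun l => sub_mem hq.1 (xi_iterate_mem_laurent hq.1 _),
    fun l => sub_polar hq.2 (xi_iterate_polar hq.2 _), fun x hx => ?_⟩
  · have h1 := h.xi_conj (X := Matrix.of fun i j => x (i, j))
      (fun i j => mem_piLau.1 hx (i, j)) fun l => by rw [← hw, h0, Pi.zero_apply]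
    funext a
    exact congrFun (congrFun h1 a.1) a.2
  · funext l
    have h1 : (Matrix.of fun i j => connOp (endMatrix A₀) x (i, j)) =
        (Matrix.of fun i j => x (i, j)).map euler - A₀ * (Matrix.of fun i j => x (i, j))
          + (Matrix.of fun i j => x (i, j)) * A₀ := by
      ext1 i j
      exact connOp_endMatrix x i j
    rw [hw, h1, h.conj, diagOp_apply, eulerSub_apply, hw, Matrix.add_apply, Matrix.sub_apply,
      expMatrix, Matrix.diagonal_mul, Matrix.mul_diagonal, Matrix.map_apply]
    simp only [Function.iterate_zero, id]
    ring

end Frame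

end IrregularSpectral

end

noncomputable section

namespace IrregularSpectral

/-! ### Differential modules in coordinates -/

section Coordinates

variable {R : Type*} [CommRing R] [Algebra ℂ R] {D : Derivation ℂ R R}
  {M : Type*} [AddCommGroup M] [Module R M] [Module ℂ M] [IsScalarTower ℂ R M]
  {ι : Type*} [Fintype ι]

theorem Connection.isMatrix_of_basis {c : Connection D M} {b : Module.Basis ι R M}
    {G : Matrix ι ι R} (h : ∀ j i, b.repr (c.nabla (b j)) i = -G i j) : c.IsMatrix b G := by
  classical
  intro m i
  conv_lhs => rw [← b.sum_repr m]
  simp only [map_sum, c.leibniz, map_add, map_smul, Finsupp.coe_finsetSum, Finset.sum_apply,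
    Finsupp.add_apply, Finsupp.smul_apply, h, Module.Basis.repr_self, smul_eq_mul,
    Finset.sum_add_distrib, Matrix.mulVec, dotProduct]
  rw [Finset.sum_eq_single i]
  · rw [Finsupp.single_eq_same, mul_one, sub_eq_add_neg, ← Finset.sum_neg_distrib]
    congr 1
    exact Finset.sum_congr rfl fun j _ => by ring
  · intro j _ hj
    rw [Finsupp.single_eq_of_ne (Ne.symm hj), mul_zero]
  · exact fun hi => absurd (Finset.mem_univ i) hi

theorem Connection.exists_isMatrix (c : Connection D M) (b : Module.Basis ι R M) :
    ∃ G : Matrix ι ι R, c.IsMatrix b G :=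
  ⟨Matrix.of fun i j => -b.repr (c.nabla (b j)) i,
    Connection.isMatrix_of_basis fun j i => by rw [Matrix.of_apply, neg_neg]⟩

theorem Connection.IsMatrix.apply_basis {c : Connection D M} {b : Module.Basis ι R M}
    {G : Matrix ι ι R} (h : c.IsMatrix b G) (i j : ι) : b.repr (c.nabla (b j)) i = -G i j := by
  classical
  rw [h, Module.Basis.repr_self, Matrix.mulVec, dotProduct, Finset.sum_eq_single j]
  · have h1 : D (Finsupp.single j (1 : R) i) = 0 := by
      rcases eq_or_ne j i with rfl | hij
      · rw [Finsupp.single_eq_same, Derivation.map_one_eq_zero]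
      · rw [Finsupp.single_eq_of_ne (Ne.symm hij), map_zero]
    rw [h1, Finsupp.single_eq_same, mul_one, zero_sub]
  · intro k _ hk
    rw [Finsupp.single_eq_of_ne hk, mul_zero]
  · exact fun hi => absurd (Finset.mem_univ j) hi

theorem Connection.IsMatrix.baseChange {S : Type*} [CommRing S] [Algebra ℂ S] [Algebra R S]
    [IsScalarTower ℂ R S] {DS : Derivation ℂ S S}
    (hD : ∀ f : R, DS (algebraMap R S f) = algebraMap R S (D f))
    {c : Connection D M} {b : Module.Basis ι R M} {G : Matrix ι ι R} (h : c.IsMatrix b G) :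
    (c.baseChange DS hD).IsMatrix (Algebra.TensorProduct.basis S b) (G.map (algebraMap R S)) := by
  refine Connection.isMatrix_of_basis fun j i => ?_
  have h1 : (c.baseChange DS hD).nabla ((1 : S) ⊗ₜ[R] b j) =
      DS 1 ⊗ₜ[R] b j + (1 : S) ⊗ₜ[R] c.nabla (b j) := rfl
  rw [Algebra.TensorProduct.basis_apply, h1, Derivation.map_one_eq_zero, TensorProduct.zero_tmul,
    zero_add, Algebra.TensorProduct.basis_repr_tmul, one_smul, Finsupp.mapRange_apply,
    h.apply_basis, map_neg, Matrix.map_apply]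

theorem Connection.IsMatrix.endConn [DecidableEq ι] {c : Connection D M} {b : Module.Basis ι R M}
    {G : Matrix ι ι R} (h : c.IsMatrix b G) :
    c.endConn.IsMatrix (b.linearMap b) (Matrix.of fun x y =>
      (if x.2 = y.2 then G x.1 y.1 else 0) - if x.1 = y.1 then G y.2 x.2 else 0) := by
  rintro φ ⟨i, j⟩
  have hr (ψ : Module.End R M) (i j) : (b.linearMap b).repr ψ (i, j) = b.repr (ψ (b j)) i := by
    rw [Module.Basis.linearMap_repr_apply]
    exact LinearMap.toMatrix_apply b b ψ i j
  have h1 : c.endConn.nabla φ (b j) = c.nabla (φ (b j)) - φ (c.nabla (b j)) := rfl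
  have h2 : c.nabla (b j) = ∑ k, (-G k j) • b k := by
    conv_lhs => rw [← b.sum_repr (c.nabla (b j))]
    exact Finset.sum_congr rfl fun k _ => by rw [h.apply_basis]
  have h3 : b.repr (φ (c.nabla (b j))) i = -∑ k, G k j * b.repr (φ (b k)) i := by
    rw [h2, map_sum, map_sum, Finsupp.coe_finsetSum, Finset.sum_apply, ← Finset.sum_neg_distrib]
    refine Finset.sum_congr rfl fun k _ => ?_
    rw [map_smul, map_smul, Finsupp.smul_apply, smul_eq_mul, neg_mul]
  rw [hr, h1, map_sub, Finsupp.sub_apply, h3, h, hr, Matrix.mulVec, Matrix.mulVec, dotProduct,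
    dotProduct, Fintype.sum_prod_type]
  simp only [hr, Matrix.of_apply, sub_mul, Finset.sum_sub_distrib, ite_mul, zero_mul,
    Finset.sum_ite_eq, Finset.mem_univ, if_true]
  rw [Finset.sum_comm]
  simp only [Finset.sum_ite_eq, Finset.mem_univ, if_true]
  ring

/-- The index of a differential module, computed in coordinates. -/
theorem HasIdxOn.nabla {c : Connection D M} {b : Module.Basis ι R M} {G : Matrix ι ι R}
    (h : c.IsMatrix b G) (v : R →ₐ[ℂ] H) (hv : Function.Injective v)
    (hD : ∀ f, v (D f) = ddz (v f)) {S : Submodule ℂ (ι → H)}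
    (hS : ∀ x, x ∈ S ↔ ∀ i, ∃ f, v f = x i) {ζ ζ' : R} (hζ : v ζ = zpow 1) (hζ' : v ζ' = zpow (-1))
    {i : ℤ} (hi : HasIdxOn (X := ι → H) (Y := ι → H) (connOp fun i j => zpow 1 * v (G i j)) S S i) :
    HasIdx c.nabla i := by
  have hz : zpow 1 * zpow (-1) = 1 := by rw [zpow_mul, add_neg_cancel, zpow_zero]
  have hsm (a : ℂ) (f : H) : algebraMap ℂ H a * f = a • f := (Algebra.smul_def a f).symm
  let Ψ : M →ₗ[ℂ] (ι → H) :=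
    { toFun := fun m j => v (b.repr m j)
      map_add' := fun m n => by
        funext j
        rw [map_add, Finsupp.add_apply, map_add, Pi.add_apply]
      map_smul' := fun a m => by
        funext j
        rw [← algebraMap_smul R a m, map_smul, Finsupp.smul_apply, smul_eq_mul, map_mul,
          AlgHom.commutes, hsm]
        rfl }
  -- Target coordinates carry an extra factor `z`, so `d/dz - G` becomes `z d/dz - z G`. This
  -- changes no index because `z` is invertible in `R`, with inverse `ζ'`.
  let Ψ' : M →ₗ[ℂ] (ι → H) := (LinearMap.pi fun j => mulH (zpow 1) ∘ₗ LinearMap.proj j) ∘ₗ Ψ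
  have hΨ (m j) : Ψ m j = v (b.repr m j) := rfl
  have hΨ' (m j) : Ψ' m j = zpow 1 * v (b.repr m j) := rfl
  have hinj (m : M) (h0 : ∀ j, v (b.repr m j) = 0) : m = 0 :=
    b.repr.map_eq_zero_iff.1 (Finsupp.ext fun j => hv ((h0 j).trans (map_zero v).symm))
  have hsurj (f : ι → R) : ∃ m, ∀ j, b.repr m j = f j := by
    obtain ⟨m, hm⟩ := b.equivFun.surjective f
    exact ⟨m, fun j => congrFun hm j⟩
  have h1 : MapsBij (Y := ι → H) Ψ ⊤ S := by
    refine ⟨fun m _ => (hS _).2 fun j => ⟨_, rfl⟩, fun m _ h0 => hinj m fun j => congrFun h0 j,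
      fun y hy => ?_⟩
    choose f hf using (hS y).1 hy
    obtain ⟨m, hm⟩ := hsurj f
    exact ⟨m, trivial, funext fun j => by rw [hΨ, hm, hf]⟩
  have h2 : MapsBij (Y := ι → H) Ψ' ⊤ S := by
    refine ⟨fun m _ => (hS _).2 fun j => ⟨ζ * b.repr m j, by rw [map_mul, hζ, hΨ']⟩,
      fun m _ h0 => hinj m fun j => ?_, fun y hy => ?_⟩
    · have h3 : zpow 1 * v (b.repr m j) = 0 := congrFun h0 j
      exact (mul_eq_zero.1 h3).resolve_left (zpow_ne_zero _)
    · choose f hf using (hS y).1 hy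
      obtain ⟨m, hm⟩ := hsurj fun j => ζ' * f j
      refine ⟨m, trivial, funext fun j => ?_⟩
      rw [hΨ', hm, map_mul, hζ', hf, ← mul_assoc, hz, one_mul]
  have h3 : HasIdxOn c.nabla ⊤ ⊤ i :=
    HasIdxOn.of_mapsBij (Y := ι → H) (Y' := ι → H) h1 h2 (fun _ _ => trivial) (fun m _ => by
      funext j
      rw [hΨ', connOp_apply, h, map_sub, hD, mul_sub, ← euler_eq, hΨ]
      congr 1
      rw [Matrix.mulVec, dotProduct, map_sum, Finset.mul_sum]
      exact Finset.sum_congr rfl fun k _ => by rw [map_mul, mul_assoc, hΨ]) hi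
  obtain ⟨h4, h5⟩ := h3
  exact h5.of_equiv Submodule.topEquiv Submodule.topEquiv fun x => rfl

end Coordinates

theorem exists_finBasis {K : Type*} [CommRing K] (hK : IsField K) (M : Type*) [AddCommGroup M]
    [Module K M] [Module.Finite K M] : ∃ n : ℕ, Nonempty (Module.Basis (Fin n) K M) := by
  let := hK.toField
  exact ⟨_, ⟨Module.finBasis K M⟩⟩

/-! ### Eigenframes from the normal form and the irregularity of `End(M)` -/

section Irregularity

variable {M : Type*} [AddCommGroup M] [Module ConvL M] [Module ℂ M] [IsScalarTower ℂ ConvL M]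
  [Module.Finite ConvL M]

/-- A differential module with an elementary cell of multiplicity one as its normal form has a frame
of eigenvectors. -/
theorem exists_eigenFrame {q : Puiseux} (hq : q.val ∈ polarAll) (R : Matrix (Fin 1) (Fin 1) ℂ)
    {c : Connection dConv M} (hM : HasNormalForm c (htlCell q R)) :
    ∃ (b : Module.Basis (Fin (ramificationIndex q.val)) ConvL M)
      (G : Matrix (Fin (ramificationIndex q.val)) (Fin (ramificationIndex q.val)) ConvL)
      (B B' : Matrix (Fin (ramificationIndex q.val)) (Fin (ramificationIndex q.val)) H),
      c.IsMatrix b G ∧ EigenFrame q.val (R 0 0) (ramificationIndex q.val)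
        (Matrix.of fun i j => zpow 1 * ConvL.val (G i j)) B B' := by
  obtain ⟨n, ⟨b⟩⟩ := exists_finBasis isField_convL M
  obtain ⟨f, hf⟩ := hM
  have : Nontrivial Puiseux := ⟨0, 1, fun h => zero_ne_one (congrArg Puiseux.val h)⟩
  let bP := Algebra.TensorProduct.basis Puiseux b
  -- Two bases of the Puiseux extension show that the rank of `M` is the size of the cell.
  have hn : n = ramificationIndex q.val := by
    have h1 := Fintype.card_congr (bP.indexEquiv f)
    rwa [Fintype.card_fin, Fintype.card_prod, Fintype.card_fin, Fintype.card_fin, one_mul] at h1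
  subst hn
  obtain ⟨G, hG⟩ := c.exists_isMatrix b
  have hGP : (puiseuxExtension c).IsMatrix bP (G.map (algebraMap ConvL Puiseux)) := hG.baseChange _
  refine ⟨b, G, Matrix.of fun i k => Puiseux.val (bP.repr (f (0, k)) i),
    Matrix.of fun k i => Puiseux.val (f.repr (bP i) (0, k)), hG, hq, rfl, ?_, ?_, ?_, ?_⟩
  · exact fun i j => mul_mem (zpow_int_mem_convLaurent 1).1 (G i j).2.1
  · ext1 i j
    have h1 := congrFun (congrFun (bP.toMatrix_mul_toMatrix_flip f) i) j
    rw [Matrix.mul_apply, Fintype.sum_prod_type, Fintype.sum_unique] at h1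
    have h2 := congrArg Puiseux.val h1
    rw [map_sum] at h2
    rw [Matrix.mul_apply]
    refine Eq.trans (Finset.sum_congr rfl fun k _ => ?_) (h2.trans ?_)
    · exact (map_mul Puiseux.val _ _).symm
    · rw [Matrix.one_apply, Matrix.one_apply]
      split_ifs
      exacts [map_one _, map_zero _]
  · ext1 i j
    have h1 := congrFun (congrFun (f.toMatrix_mul_toMatrix_flip bP) (0, i)) (0, j)
    rw [Matrix.mul_apply] at h1
    have h2 := congrArg Puiseux.val h1
    rw [map_sum] at h2
    rw [Matrix.mul_apply]
    refine Eq.trans (Finset.sum_congr rfl fun k _ => ?_) (h2.trans ?_)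
    · exact (map_mul Puiseux.val _ _).symm
    · rw [Matrix.one_apply, Matrix.one_apply]
      simp only [Prod.mk.injEq, true_and]
      split_ifs
      exacts [map_one _, map_zero _]
  · have hxi (k : ℕ) : Puiseux.val (xiP^[k] q) = xi^[k] (Puiseux.val q) := by
      induction k with
      | zero => rfl
      | succ k ih =>
        rw [Function.iterate_succ_apply', Function.iterate_succ_apply', ← ih]
        rfl
    ext1 i k
    -- With multiplicity one the cell is diagonal, so its basis vectors are eigenvectors; written in
    -- the original basis they are the columns of `B`.
    have h1 : (puiseuxExtension c).nabla (f (0, k)) = -(htlCell q R (0, k) (0, k)) • f (0, k) := by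
      refine f.repr.injective (Finsupp.ext fun x => ?_)
      rw [hf.apply_basis, map_smul, Finsupp.smul_apply, Module.Basis.repr_self, smul_eq_mul]
      by_cases hx : x = (0, k)
      · rw [hx, Finsupp.single_eq_same, mul_one]
      · have hk : x.2 ≠ k := fun hk => hx (Prod.ext (Subsingleton.elim _ _) hk)
        rw [Finsupp.single_eq_of_ne hx, mul_zero, htlCell, Matrix.blockDiagonal_apply, if_neg hk,
          neg_zero]
    have h2 := hGP (f (0, k)) i
    rw [h1, map_smul, Finsupp.smul_apply, smul_eq_mul] at h2
    have h3 := congrArg Puiseux.val h2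
    have h4 : Puiseux.val (htlCell q R (0, k) (0, k)) =
        zpow (-1) * (xi^[(k : ℕ)] (Puiseux.val q) + algebraMap ℂ H (R 0 0)) := by
      rw [htlCell, Matrix.blockDiagonal_apply, if_pos rfl, Matrix.smul_apply, Matrix.add_apply,
        Matrix.scalar_apply, Matrix.diagonal_apply_eq, Matrix.map_apply, smul_eq_mul, map_mul,
        map_add, hxi, AlgHom.commutes]
      rfl
    have h5 : Puiseux.val (dPuiseux (bP.repr (f (0, k)) i)) =
        ddz (Puiseux.val (bP.repr (f (0, k)) i)) := rfl
    have h6 : Puiseux.val ((G.map (algebraMap ConvL Puiseux)).mulVec (bP.repr (f (0, k))) i) =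
        ∑ j, ConvL.val (G i j) * Puiseux.val (bP.repr (f (0, k)) j) := by
      rw [Matrix.mulVec, dotProduct, map_sum]
      exact Finset.sum_congr rfl fun j _ => map_mul Puiseux.val _ _
    rw [map_mul, map_neg, map_sub, h4, h5, h6] at h3
    rw [Matrix.map_apply, Matrix.sub_apply, expMatrix, Matrix.mul_diagonal, Matrix.mul_apply]
    simp only [Matrix.of_apply, mul_assoc]
    rw [← Finset.mul_sum, euler_eq]
    have h7 : zpow 1 * zpow (-1) = 1 := by rw [zpow_mul, add_neg_cancel, zpow_zero]
    linear_combination (-zpow 1) * h3 - (xi^[(k : ℕ)] (Puiseux.val q) + algebraMap ℂ H (R 0 0)) *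
      Puiseux.val (bP.repr (f (0, k)) i) * h7

/-- The exponents of the module of endomorphisms. -/
theorem exists_order_sub_xi {q : H} (hq : q ∈ polarAll) (l : ℕ) :
    ∃ p : ℕ, (q - xi^[l] q).order = -(p : ℚ) / ramificationIndex q := by
  obtain ⟨hr, hq1, hq2⟩ := ramificationIndex_spec hq
  by_cases h0 : q - xi^[l] q = 0
  -- For `l = 0` the difference is zero, and its default order `0` gives the correct exponent `p =
  -- 0`.
  · exact ⟨0, by simp [h0]⟩
  have h1 : (q - xi^[l] q).coeff (q - xi^[l] q).order ≠ 0 :=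
    fun h => h0 (HahnSeries.coeff_order_eq_zero.1 h)
  obtain ⟨k, hk⟩ := sub_mem hq1 (xi_iterate_mem_laurent hq1 l) _ h1
  have h2 := sub_polar hq2 (xi_iterate_polar hq2 l) _ h1
  have hr' : (0 : ℚ) < ramificationIndex q := by exact_mod_cast hr
  rw [hk, div_lt_iff₀ hr', zero_mul] at h2
  have h3 : k < 0 := by exact_mod_cast h2
  refine ⟨(-k).toNat, ?_⟩
  have h4 : (((-k).toNat : ℤ) : ℚ) = ((-k : ℤ) : ℚ) := by rw [Int.toNat_of_nonneg (by omega)]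
  push_cast at h4
  rw [hk, h4, neg_neg]

/-- The irregularity of the module of endomorphisms. -/
theorem irr_endConn {q : Puiseux} (hq : q.val ∈ polarAll) (R : Matrix (Fin 1) (Fin 1) ℂ)
    {c : Connection dConv M} (hM : HasNormalForm c (htlCell q R))
    {p : Fin (ramificationIndex q.val) → ℕ}
    (hp : ∀ l : Fin (ramificationIndex q.val), (q.val - xi^[(l : ℕ)] q.val).order =
      -(p l : ℚ) / ramificationIndex q.val) :
    HasIrr c.endConn ∧ irr c.endConn = ∑ l, p l := by
  obtain ⟨b, G, B, B', hG, hB⟩ := exists_eigenFrame hq R hM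
  have hD := hB.diagonalizes
  have hE := hG.endConn
  have hEF := hE.baseChange (DS := dFormal) fun _ => rfl
  have hval (x y) : zpow 1 * ConvL.val ((if x.2 = y.2 then G x.1 y.1 else 0) -
      if x.1 = y.1 then G y.2 x.2 else 0) =
      endMatrix (Matrix.of fun i j => zpow 1 * ConvL.val (G i j)) x y := by
    rw [endMatrix, map_sub, mul_sub]
    congr 1 <;> split_ifs <;> simp
  have hA (x y) : endMatrix (Matrix.of fun i j => zpow 1 * ConvL.val (G i j)) x y ∈
      convLaurent 1 := by
    rw [← hval]
    exact mul_mem (zpow_int_mem_convLaurent 1) (Subtype.property _)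
  have h1 := hD.hasIdxOn_convergent hA hp
  have h2 := hD.hasIdxOn_formal fun x y => (hA x y).1
  have h3 : HasIdx c.endConn.nabla (-∑ l, p l : ℤ) := by
    refine HasIdxOn.nabla (S := piConv _) hE ConvL.val Subtype.val_injective (fun _ => rfl) (fun x => ?_)
      (ζ := (⟨_, zpow_int_mem_convLaurent 1⟩ : convLaurent 1))
      (ζ' := (⟨_, zpow_int_mem_convLaurent (-1)⟩ : convLaurent 1)) (by simp; rfl) (by simp; rfl) ?_
    · rw [mem_piConv]
      exact forall_congr' fun j => ⟨fun h => ⟨(⟨_, h⟩ : convLaurent 1), rfl⟩, fun ⟨f, hf⟩ => hf ▸ f.2⟩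
    · convert h1 using 3
      exact funext fun _ => hval _ _
  have h4 : HasIdx (formalization c.endConn).nabla 0 := by
    refine HasIdxOn.nabla (S := piLau _ 1) hEF FormalL.val Subtype.val_injective (fun _ => rfl)
      (fun x => ?_) (ζ := (⟨_, (zpow_int_mem_convLaurent 1).1⟩ : laurent 1))
      (ζ' := (⟨_, (zpow_int_mem_convLaurent (-1)).1⟩ : laurent 1)) (by simp; rfl) (by simp; rfl) ?_
    · rw [mem_piLau]
      exact forall_congr' fun j => ⟨fun h => ⟨(⟨_, h⟩ : laurent 1), rfl⟩, fun ⟨f, hf⟩ => hf ▸ f.2⟩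
    · convert h2 using 3
      exact funext fun _ => hval _ _
  refine ⟨⟨h4.hasIndex, h3.hasIndex⟩, ?_⟩
  rw [irr, h4.index_eq, h3.index_eq]
  ring

end Irregularity

end IrregularSpectral

end

/-! ### Newton–Puiseux theorem -/

noncomputable section

namespace IrregularSpectral

open Polynomial in
/-- A monic polynomial over a complete local ring whose reduction has `0` as a root, but not as its
only root, has a proper monic factor. -/
theorem exists_monic_factor {A : Type*} [CommRing A] [IsLocalRing A]
    [IsAdicComplete (IsLocalRing.maximalIdeal A) A] {Q : A[X]} (hQ : Q.Monic)
    (h0 : Q.coeff 0 ∈ IsLocalRing.maximalIdeal A) {i : ℕ} (hi : i < Q.natDegree)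
    (h1 : Q.coeff i ∉ IsLocalRing.maximalIdeal A) :
    ∃ f : A[X], f.Monic ∧ 0 < f.natDegree ∧ f.natDegree < Q.natDegree ∧ f ∣ Q := by
  have hne : (Q : PowerSeries A).map (IsLocalRing.residue A) ≠ 0 := by
    intro h
    have := congrArg (PowerSeries.coeff i) h
    rw [PowerSeries.coeff_map, Polynomial.coeff_coe, map_zero,
      IsLocalRing.residue_eq_zero_iff] at this
    exact h1 this
  obtain ⟨f, h, W⟩ := PowerSeries.exists_isWeierstrassFactorization hne
  have hf := W.isDistinguishedAt
  have hord : (f.natDegree : ℕ∞) = ((f : PowerSeries A).map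
      (Ideal.Quotient.mk (IsLocalRing.maximalIdeal A))).order :=
    hf.coe_natDegree_eq_order_map (f : PowerSeries A) 1
      (by simp) (by simp)
  -- Weierstrass preparation gives `Q = f h` with a power series `h`. The remainder of `Q` modulo
  -- `f` is then a multiple of `f` of degree less than `deg f`, so uniqueness of Weierstrass
  -- division makes it zero, and `f` divides `Q` as a polynomial.
  have hdvd : f ∣ Q := by
    have hdiv := Polynomial.modByMonic_add_div Q f
    have heq : (f : PowerSeries A) * (h - (Q /ₘ f : A[X])) = (Q %ₘ f : A[X]) := by
      have h2 : (Q : PowerSeries A) = f * h := W.eq_mul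
      rw [← hdiv, Polynomial.coe_add, Polynomial.coe_mul] at h2
      linear_combination -h2
    have hlt : (Q %ₘ f).degree < ((f : PowerSeries A).map
        (Ideal.Quotient.mk (IsLocalRing.maximalIdeal A))).order.toNat := by
      rw [← hord, ENat.toNat_natCast, ← Polynomial.degree_eq_natDegree hf.monic.ne_zero]
      exact Polynomial.degree_modByMonic_lt _ hf.monic
    have := ((hf.isWeierstrassDivisorAt
      (IsLocalRing.maximalIdeal.isMaximal A).ne_top).eq_zero_of_mul_eq hlt heq).2
    exact (Polynomial.modByMonic_eq_zero_iff_dvd hf.monic).1 this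
  have hmap := hf.map_eq_X_pow
  refine ⟨f, hf.monic, ?_, ?_, hdvd⟩
  · rw [Nat.pos_iff_ne_zero]
    intro h00
    have hf1 : f = 1 := hf.monic.natDegree_eq_zero.1 h00
    have h2 : (Q : PowerSeries A) = f * h := W.eq_mul
    have h3 := congrArg (PowerSeries.constantCoeff) h2
    rw [hf1, Polynomial.coe_one, one_mul] at h3
    have h4 : IsUnit (PowerSeries.constantCoeff h) := W.isUnit.map _
    rw [← h3] at h4
    have h5 : PowerSeries.constantCoeff (Q : PowerSeries A) = Q.coeff 0 := by simp
    rw [h5] at h4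
    exact (IsLocalRing.mem_maximalIdeal _).1 h0 h4
  · by_contra hge
    -- A distinguished polynomial reduces to a power of `X`, contrary to the coefficient `i` being a
    -- unit.
    have hfQ : Q = f := Polynomial.eq_of_monic_of_dvd_of_natDegree_le hf.monic hQ hdvd
      (not_lt.1 hge)
    have := congrArg (fun p => p.coeff i) hmap
    simp only [Polynomial.coeff_map, Polynomial.coeff_X_pow] at this
    rw [← hfQ, if_neg hi.ne, Ideal.Quotient.eq_zero_iff_mem] at this
    exact h1 this

open PowerSeries in
instance powerSeries_isAdicComplete :
    IsAdicComplete (IsLocalRing.maximalIdeal (PowerSeries ℂ)) (PowerSeries ℂ) := by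
  rw [PowerSeries.maximalIdeal_eq_span_X]
  infer_instance

theorem mem_maximalIdeal_powerSeries {f : PowerSeries ℂ} :
    f ∈ IsLocalRing.maximalIdeal (PowerSeries ℂ) ↔ PowerSeries.constantCoeff f = 0 := by
  rw [PowerSeries.maximalIdeal_eq_span_X, Ideal.mem_span_singleton, PowerSeries.X_dvd_iff]

open Polynomial in
/-- A monic polynomial over `ℂ⟦t⟧` without term of second highest degree and with nontrivial
reduction has a proper monic factor. -/
theorem exists_monic_factor_powerSeries {Q : (PowerSeries ℂ)[X]} (hQ : Q.Monic)
    (htr : Q.coeff (Q.natDegree - 1) = 0) {i : ℕ} (hi : i < Q.natDegree)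
    (h1 : PowerSeries.constantCoeff (Q.coeff i) ≠ 0) :
    ∃ f : (PowerSeries ℂ)[X], f.Monic ∧ 0 < f.natDegree ∧ f.natDegree < Q.natDegree ∧ f ∣ Q := by
  set n := Q.natDegree with hn
  set Qb : ℂ[X] := Q.map PowerSeries.constantCoeff with hQb
  have hQbm : Qb.Monic := hQ.map _
  have hQbn : Qb.natDegree = n := hQ.natDegree_map _
  obtain ⟨c, hc⟩ := IsAlgClosed.exists_root Qb (by
    rw [Polynomial.degree_eq_natDegree hQbm.ne_zero, hQbn]
    exact_mod_cast (by omega : n ≠ 0))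
  -- A root `c` of the reduction is moved to `0`, to meet the hypotheses of the factorization.
  set T : (PowerSeries ℂ)[X] := X + C (PowerSeries.C c) with hT
  set Q2 := Q.comp T with hQ2
  have hQ2m : Q2.Monic := hQ.comp_X_add_C _
  have hQ2n : Q2.natDegree = n := by
    rw [hQ2, Polynomial.natDegree_comp, hT, Polynomial.natDegree_X_add_C, mul_one]
  have hmapQ2 : Q2.map PowerSeries.constantCoeff = Qb.comp (X + C c) := by
    rw [hQ2, Polynomial.map_comp, hT]
    simp [hQb]
  have hcoef : ∀ j, PowerSeries.constantCoeff (Q2.coeff j) = (Qb.comp (X + C c)).coeff j := by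
    intro j
    rw [← hmapQ2, Polynomial.coeff_map]
  have hz : Q2.coeff 0 ∈ IsLocalRing.maximalIdeal (PowerSeries ℂ) := by
    rw [mem_maximalIdeal_powerSeries, hcoef, Polynomial.coeff_zero_eq_eval_zero,
      Polynomial.eval_comp]
    simpa using hc
  -- Otherwise the reduction is `(X - c)^n`; its coefficient `-n c` in degree `n - 1` vanishes, so
  -- `c = 0` and the reduction is `X^n`, against `h1`.
  have hex : ∃ j < Q2.natDegree, Q2.coeff j ∉ IsLocalRing.maximalIdeal (PowerSeries ℂ) := by
    by_contra! hcon
    have hX : Qb.comp (X + C c) = X ^ n := by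
      ext j
      rw [Polynomial.coeff_X_pow]
      rcases lt_trichotomy j n with hj | hj | hj
      · rw [if_neg hj.ne, ← hcoef, ← mem_maximalIdeal_powerSeries]
        exact hcon j (by rwa [hQ2n])
      · rw [if_pos hj, ← hcoef, hj, ← hQ2n, hQ2m.coeff_natDegree, map_one]
      · rw [if_neg hj.ne', ← hcoef, Polynomial.coeff_eq_zero_of_natDegree_lt (by rwa [hQ2n]),
          map_zero]
    have hQb' : Qb = (X - C c) ^ n := by
      have := congrArg (fun p => p.comp (X - C c)) hX
      simpa [Polynomial.comp_assoc] using this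
    have h2 : Qb.coeff (n - 1) = 0 := by rw [hQb, Polynomial.coeff_map, htr, map_zero]
    have h3 : Qb.coeff (n - 1) = -c * n := by
      rw [hQb', sub_eq_add_neg, ← Polynomial.C_neg, Polynomial.coeff_X_add_C_pow]
      obtain ⟨k, hk⟩ : ∃ k, n = k + 1 := ⟨n - 1, by omega⟩
      rw [hk]
      simp
    have hc0 : c = 0 := by
      rw [h2] at h3
      have : (n : ℂ) ≠ 0 := by exact_mod_cast (by omega : n ≠ 0)
      have h4 := (mul_eq_zero.1 h3.symm).resolve_right this
      simpa using h4
    apply h1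
    have := congrArg (fun p => p.coeff i) hQb'
    simpa [hc0, Polynomial.coeff_X_pow, hi.ne, hQb] using this
  obtain ⟨j, hj, hj'⟩ := hex
  obtain ⟨f, hf, hf0, hfn, hfd⟩ := exists_monic_factor hQ2m hz hj hj'
  set T' : (PowerSeries ℂ)[X] := X - C (PowerSeries.C c) with hT'
  have hTT : T.comp T' = X := by simp [hT, hT']
  have hdeg : (f.comp T').natDegree = f.natDegree := by
    rw [Polynomial.natDegree_comp, hT', Polynomial.natDegree_X_sub_C, mul_one]
  refine ⟨f.comp T', ?_, by rwa [hdeg], by rw [hdeg]; omega, ?_⟩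
  · have := hf.comp_X_add_C (-PowerSeries.C c)
    simpa [hT', sub_eq_add_neg] using this
  · obtain ⟨g, hg⟩ := hfd
    refine ⟨g.comp T', ?_⟩
    rw [← Polynomial.mul_comp, ← hg, hQ2, Polynomial.comp_assoc, hTT, Polynomial.comp_X]

/-- `ℂ⟦t⟧ → ℂ⟦z^{1/s}⟧`, `t ↦ z^{1/s}`. -/
def ofPS {s : ℕ} (hs : 0 < s) : PowerSeries ℂ →+* H :=
  (ofLaurent hs).comp (HahnSeries.ofPowerSeries ℤ ℂ)

theorem coeff_ofPS {s : ℕ} (hs : 0 < s) (f : PowerSeries ℂ) (n : ℕ) :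
    (ofPS hs f).coeff ((n : ℚ) / s) = PowerSeries.coeff n f := by
  have := coeff_ofLaurent hs (HahnSeries.ofPowerSeries ℤ ℂ f) n
  rw [HahnSeries.ofPowerSeries_apply_coeff] at this
  rw [← this]
  rfl

theorem exists_ofPS {s : ℕ} (hs : 0 < s) {f : H} (hf : f ∈ lauFil s 0) :
    ∃ g, ofPS hs g = f := by
  obtain ⟨g, rfl⟩ := exists_ofLaurent hs (mem_lau.1 hf.1)
  have hs' : (0 : ℚ) < s := by exact_mod_cast hs
  refine ⟨PowerSeries.mk fun n => g.coeff n, ?_⟩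
  change ofLaurent hs _ = _
  congr 1
  ext k
  rcases lt_or_ge k 0 with hk | hk
  · have h1 : g.coeff k = 0 := by
      rw [← coeff_ofLaurent hs]
      exact mem_fil_iff.1 hf.2 _ (div_neg_of_neg_of_pos (by exact_mod_cast hk) hs')
    rw [h1]
    rw [HahnSeries.ofPowerSeries_apply]
    refine HahnSeries.embDomain_of_notMem_range ?_
    rintro ⟨n, hn⟩
    simp only [Nat.castOrderEmbedding_apply] at hn
    omega
  · obtain ⟨n, rfl⟩ := Int.eq_ofNat_of_zero_le hk
    rw [HahnSeries.ofPowerSeries_apply_coeff, PowerSeries.coeff_mk]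

theorem ofPS_mem {s : ℕ} (hs : 0 < s) (f : PowerSeries ℂ) : ofPS hs f ∈ puiseux :=
  ⟨s, hs, ofLaurent_mem hs _⟩

theorem ofPS_injective {s : ℕ} (hs : 0 < s) : Function.Injective (ofPS hs) := by
  intro f g h
  ext n
  rw [← coeff_ofPS hs, h, coeff_ofPS]

theorem exists_common_laurent {ι : Type*} [Finite ι] {f : ι → H} (hf : ∀ i, f i ∈ puiseux) :
    ∃ s : ℕ, 0 < s ∧ ∀ i, f i ∈ laurent s := by
  classical
  cases nonempty_fintype ι
  choose s hs h using hf
  refine ⟨∏ i, s i, Finset.prod_pos fun i _ => hs i, fun i => ?_⟩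
  rw [← Finset.mul_prod_erase _ _ (Finset.mem_univ i)]
  exact laurent_le_mul _ (Finset.prod_pos fun i _ => hs i) (h i)

theorem zpow_mem_puiseux (a : ℚ) : zpow a ∈ puiseux := by
  refine ⟨a.den, a.den_pos, ?_⟩
  have := zpow_mem_laurent a.den a.num
  rwa [Rat.num_div_den] at this

open Polynomial in
theorem comp_coeff_mem {S : Subalgebra ℂ H} {Q T : H[X]} (hQ : ∀ i, Q.coeff i ∈ S)
    (hT : ∀ i, T.coeff i ∈ S) : ∀ i, (Q.comp T).coeff i ∈ S := by
  have h1 : ∀ P : H[X], (∀ i, P.coeff i ∈ S) ↔ P ∈ Polynomial.lifts S.val.toRingHom := by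
    intro P
    rw [Polynomial.lifts_iff_coeff_lifts]
    refine forall_congr' fun i => ?_
    simp
  rw [h1] at *
  obtain ⟨q, rfl⟩ := hQ
  obtain ⟨t, rfl⟩ := hT
  exact ⟨q.comp t, by simp [Polynomial.map_comp]⟩

open Polynomial in
theorem coeff_comp_X_add_C {A : Type*} [CommRing A] {Q : A[X]} {k : ℕ} (hQ : Q.natDegree ≤ k + 1)
    {c : A} : (Q.comp (X + C c)).coeff k = Q.coeff k + (k + 1) * Q.coeff (k + 1) * c := by
  rw [← Polynomial.taylor_apply, Polynomial.taylor_coeff,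
    Polynomial.eval_eq_sum_range' (n := 2)]
  · rw [Finset.sum_range_succ, Finset.sum_range_one, Polynomial.hasseDeriv_coeff,
      Polynomial.hasseDeriv_coeff, add_comm 1 k, Nat.choose_succ_self_right]
    simp
  · have := Polynomial.natDegree_hasseDeriv_le Q k
    omega

open Polynomial in
/-- **Newton–Puiseux**: a monic polynomial of positive degree with coefficients in the field of
Puiseux series has a root there. -/
theorem exists_puiseux_root (n : ℕ) : ∀ Q : H[X], Q.Monic → Q.natDegree = n → 0 < n →
    (∀ i, Q.coeff i ∈ puiseux) → ∃ x ∈ puiseux, Q.eval x = 0 := by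
  induction n using Nat.strong_induction_on with
  | _ n ih =>
  classical
  intro Q hQ hn hn0 hcoef
  -- The case without term of degree `n - 1`; the general one follows by a translation.
  have key : ∀ Q : H[X], Q.Monic → Q.natDegree = n → Q.coeff (n - 1) = 0 →
      (∀ i, Q.coeff i ∈ puiseux) → ∃ x ∈ puiseux, Q.eval x = 0 := by
    clear! Q
    intro Q hQ hn htr hcoef
    by_cases hall : ∀ i < n, Q.coeff i = 0
    · refine ⟨0, puiseux.zero_mem, ?_⟩
      rw [← Polynomial.coeff_zero_eq_eval_zero]
      exact hall 0 hn0
    push Not at hall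
    obtain ⟨i1, hi1, hi1'⟩ := hall
    -- The extremal slope of the Newton polygon. Scaling the roots by `z^{-s}` makes all
    -- coefficients of order at least `0`, with order exactly `0` at `i0`, so the reduction is not
    -- `X^n` and Hensel-type factorization applies.
    obtain ⟨i0, hi0, hmin⟩ := Finset.exists_min_image
      ((Finset.range n).filter fun i => Q.coeff i ≠ 0)
      (fun i => (Q.coeff i).order / ((n - i : ℕ) : ℚ))
      ⟨i1, by simp [hi1, hi1']⟩
    simp only [Finset.mem_filter, Finset.mem_range] at hi0 hmin
    set s := (Q.coeff i0).order / ((n - i0 : ℕ) : ℚ) with hs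
    set t := zpow (-s) with ht
    set Q1 := Q.scaleRoots t with hQ1
    have hQ1m : Q1.Monic := (monic_scaleRoots_iff t).2 hQ
    have hQ1n : Q1.natDegree = n := by rw [hQ1, natDegree_scaleRoots, hn]
    have hQ1c : ∀ i, Q1.coeff i = Q.coeff i * zpow (((n - i : ℕ) : ℚ) * -s) := by
      intro i
      rw [hQ1, coeff_scaleRoots, hn, ht, zpow_natCast_mul]
    have hQ1p : ∀ i, Q1.coeff i ∈ puiseux := fun i => by
      rw [hQ1c]
      exact puiseux.mul_mem (hcoef i) (zpow_mem_puiseux _)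
    have hfil : ∀ i, Q1.coeff i ∈ fil 0 := by
      intro i
      by_cases h0 : Q.coeff i = 0
      · rw [hQ1c, h0, zero_mul]
        exact (fil 0).zero_mem
      rcases lt_or_ge i n with hi | hi
      · have hle := hmin i ⟨hi, h0⟩
        have hpos : (0 : ℚ) < ((n - i : ℕ) : ℚ) := by exact_mod_cast (by omega)
        rw [hQ1c]
        have := mul_mem_fil (mem_fil_order (Q.coeff i)) (zpow_mem_fil (((n - i : ℕ) : ℚ) * -s))
        refine fil_anti ?_ this
        rw [le_div_iff₀ hpos] at hle
        linarith
      · have hin : i = n := by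
          refine le_antisymm ?_ hi
          rw [← hn]
          exact Polynomial.le_natDegree_of_ne_zero h0
        rw [hin, ← hQ1n, hQ1m.coeff_natDegree, mem_fil]
        simp
    obtain ⟨S, hS, hlau⟩ := exists_common_laurent (f := fun i : Fin (n + 1) => Q1.coeff i)
      fun i => hQ1p i
    have hlift : Q1 ∈ Polynomial.lifts (ofPS hS) := by
      rw [Polynomial.lifts_iff_coeff_lifts]
      intro i
      rcases lt_or_ge i (n + 1) with hi | hi
      · exact exists_ofPS hS ⟨hlau ⟨i, hi⟩, hfil i⟩
      · rw [Polynomial.coeff_eq_zero_of_natDegree_lt (by omega)]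
        exact ⟨0, map_zero _⟩
    obtain ⟨Qh, hQh, hQhn, hQhm⟩ := Polynomial.lifts_and_natDegree_eq_and_monic hlift hQ1m
    have hc1 : ∀ i, ofPS hS (Qh.coeff i) = Q1.coeff i := fun i => by
      rw [← hQh, Polynomial.coeff_map]
    have htr1 : Qh.coeff (Qh.natDegree - 1) = 0 := by
      apply ofPS_injective hS
      rw [hc1, hQhn, hQ1n, hQ1c, htr, zero_mul, map_zero]
    have hne : PowerSeries.constantCoeff (Qh.coeff i0) ≠ 0 := by
      have h1 := coeff_ofPS hS (Qh.coeff i0) 0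
      have hpos : (0 : ℚ) < ((n - i0 : ℕ) : ℚ) := by exact_mod_cast (by omega)
      have he : ((n - i0 : ℕ) : ℚ) * -s = -(Q.coeff i0).order := by
        rw [hs]; field_simp
      rw [hc1, hQ1c, mul_comm, coeff_zpow_mul, he] at h1
      rw [← PowerSeries.coeff_zero_eq_constantCoeff_apply, ← h1]
      simpa using HahnSeries.coeff_order_eq_zero.not.2 hi0.2
    obtain ⟨f, hf, hf0, hfn, g, hg⟩ := exists_monic_factor_powerSeries hQhm htr1
      (by rw [hQhn, hQ1n]; exact hi0.1) hne
    obtain ⟨x, hx, hx0⟩ := ih f.natDegree (by omega) (f.map (ofPS hS)) (hf.map _)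
      (hf.natDegree_map _) hf0 (fun i => by rw [Polynomial.coeff_map]; exact ofPS_mem hS _)
    refine ⟨x * zpow s, puiseux.mul_mem hx (zpow_mem_puiseux _), ?_⟩
    have h1 : Q1.eval x = 0 := by
      rw [← hQh, hg, Polynomial.map_mul, Polynomial.eval_mul, hx0, zero_mul]
    have h2 := scaleRoots_eval_mul Q (x * zpow s) t
    have h3 : t * (x * zpow s) = x := by
      have := zpow_mul (-s) s
      rw [neg_add_cancel, zpow_zero] at this
      rw [ht]
      linear_combination x * this
    rw [h3, ← hQ1, h1] at h2
    exact (mul_eq_zero.1 h2.symm).resolve_left (pow_ne_zero _ (zpow_ne_zero _))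
  set b : ℂ := (n : ℂ)⁻¹ with hb
  -- Tschirnhaus translation by `-a_{n-1}/n`.
  set c : H := -(algebraMap ℂ H b * Q.coeff (n - 1)) with hc
  have hcm : c ∈ puiseux :=
    puiseux.neg_mem (puiseux.mul_mem (puiseux.algebraMap_mem b) (hcoef _))
  have hTm : ∀ i, (X + C c : H[X]).coeff i ∈ puiseux := by
    intro i
    rw [coeff_add, coeff_X, coeff_C]
    refine puiseux.add_mem ?_ ?_
    · split_ifs
      exacts [puiseux.one_mem, puiseux.zero_mem]
    · split_ifs
      exacts [hcm, puiseux.zero_mem]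
  obtain ⟨x, hx, hx0⟩ := key (Q.comp (X + C c)) (hQ.comp_X_add_C c)
    (by rw [natDegree_comp, natDegree_X_add_C, mul_one, hn]) (by
      obtain ⟨k, rfl⟩ : ∃ k, n = k + 1 := ⟨n - 1, by omega⟩
      have hk : algebraMap ℂ H b * ((k : H) + 1) = 1 := by
        have h1 : ((k : H) + 1) = algebraMap ℂ H ((k : ℂ) + 1) := by
          rw [map_add, map_natCast, map_one]
        have h2 : (k : ℂ) + 1 ≠ 0 := Nat.cast_add_one_ne_zero k
        rw [h1, ← map_mul, hb]
        rw [Nat.cast_succ, inv_mul_cancel₀ h2, map_one]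
      have hl : Q.coeff (k + 1) = 1 := by rw [← hn]; exact hQ.coeff_natDegree
      have := coeff_comp_X_add_C (c := c) hn.le
      rw [Nat.add_sub_cancel] at hc ⊢
      rw [this, hl, hc]
      linear_combination (-Q.coeff k) * hk)
    (comp_coeff_mem hcoef hTm)
  exact ⟨x + c, puiseux.add_mem hx hcm, by simpa [eval_comp] using hx0⟩

open Polynomial in
-- Linear factors are split off one at a time. The induction runs over polynomials with coefficients
-- in `Puiseux`, so that the cofactor again has Puiseux coefficients.
theorem splits_of_coeff_mem_puiseux {Q : H[X]} (hQ : Q.Monic) (hc : ∀ i, Q.coeff i ∈ puiseux) :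
    Q.Splits := by
  have key : ∀ (n : ℕ) (p : Puiseux[X]), p.Monic → p.natDegree = n →
      (p.map Puiseux.val.toRingHom).Splits := by
    intro n
    induction n with
    | zero =>
      intro p hp hn
      rw [hp.natDegree_eq_zero.1 hn, Polynomial.map_one]
      exact Splits.one
    | succ n ih =>
      intro p hp hn
      obtain ⟨x, hx, hx0⟩ := exists_puiseux_root (n + 1) (p.map Puiseux.val.toRingHom) (hp.map _)
        (by rw [hp.natDegree_map, hn]) n.succ_pos (fun i => by
          rw [coeff_map]
          exact (p.coeff i).2)
      set y : Puiseux := (⟨x, hx⟩ : puiseux)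
      have hroot : p.IsRoot y := by
        apply Subtype.val_injective
        have h1 : Puiseux.val.toRingHom (p.eval y) = 0 := by
          rw [← Polynomial.eval_map_apply]
          exact hx0
        exact h1
      obtain ⟨g, hg⟩ := dvd_iff_isRoot.2 hroot
      have hgm : g.Monic := (monic_X_sub_C _).of_mul_monic_left (hg ▸ hp)
      have hnt : Nontrivial Puiseux := inferInstanceAs (Nontrivial puiseux)
      have hgn : g.natDegree = n := by
        rw [hg, (monic_X_sub_C _).natDegree_mul hgm, natDegree_X_sub_C] at hn
        omega
      rw [hg, Polynomial.map_mul, Polynomial.map_sub, map_X, map_C]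
      exact (Splits.X_sub_C _).mul (ih g hgm hgn)
  have hl : Q ∈ Polynomial.lifts Puiseux.val.toRingHom := by
    rw [Polynomial.lifts_iff_coeff_lifts]
    exact fun i => ⟨(⟨_, hc i⟩ : puiseux), rfl⟩
  obtain ⟨p, rfl, -, hp⟩ := Polynomial.lifts_and_natDegree_eq_and_monic hl hQ
  exact key _ p hp rfl

end IrregularSpectral

end

/-! ### Resultants over convergent power series and intersection multiplicities -/

noncomputable section

namespace IrregularSpectral

/-- Over a principal ideal domain `A` in which `dim A/a` is the value at `a` of a valuation, the
dimension of the cokernel of a nonsingular square matrix is the value at its determinant. -/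
theorem finrank_coker_eq_of_det_ne_zero {A M N ι : Type*} [CommRing A] [IsDomain A]
    [IsPrincipalIdealRing A] [Algebra ℂ A] {ord : A → ℚ}
    (hmul : ∀ a b : A, a ≠ 0 → b ≠ 0 → ord (a * b) = ord a + ord b)
    (hfin : ∀ a : A, a ≠ 0 → Module.Finite ℂ (A ⧸ Ideal.span {a}) ∧
      (Module.finrank ℂ (A ⧸ Ideal.span {a}) : ℚ) = ord a)
    [AddCommGroup M] [Module A M] [AddCommGroup N] [Module A N] [Module ℂ N]
    [IsScalarTower ℂ A N] [Fintype ι] [DecidableEq ι] (b : Module.Basis ι A M)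
    (c : Module.Basis ι A N) (φ : M →ₗ[A] N) (hdet : (LinearMap.toMatrix b c φ).det ≠ 0) :
    Module.Finite ℂ (N ⧸ LinearMap.range φ) ∧
      (Module.finrank ℂ (N ⧸ LinearMap.range φ) : ℚ) = ord (LinearMap.toMatrix b c φ).det := by
  classical
  set e := c.equiv b (Equiv.refl ι) with he
  -- Identifying `M` with `N` along the bases changes neither the image nor the determinant, and
  -- makes the Smith normal form of a submodule applicable.
  set ψ : N →ₗ[A] N := φ ∘ₗ e.toLinearMap with hψ
  have hrange : LinearMap.range ψ = LinearMap.range φ := by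
    rw [hψ, LinearMap.range_comp_of_range_eq_top _ (LinearEquiv.range e)]
  have hdetψ : LinearMap.det ψ = (LinearMap.toMatrix b c φ).det := by
    rw [← LinearMap.det_toMatrix c, hψ, LinearMap.toMatrix_comp c b c]
    have : LinearMap.toMatrix c b e.toLinearMap = 1 := by
      ext i j
      rw [LinearMap.toMatrix_apply]
      simp [he, Matrix.one_apply, Finsupp.single_apply, eq_comm]
    rw [this, mul_one]
  rw [← hrange, ← hdetψ]
  rw [← hdetψ] at hdet
  have hinj : Function.Injective ψ := by
    have := Module.Free.of_basis c
    have := Module.Finite.of_basis c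
    rw [← LinearMap.ker_eq_bot]
    exact not_not.1 (LinearMap.det_eq_zero_iff_ker_ne_bot.not.1 hdet)
  set P := LinearMap.range ψ with hP
  set e₁ : N ≃ₗ[A] P := LinearEquiv.ofInjective ψ hinj with he₁
  have hrk : Module.finrank A P = Module.finrank A N := e₁.finrank_eq.symm
  set a := Submodule.smithNormalFormCoeffs c hrk
  have ha := Submodule.smithNormalFormCoeffs_ne_zero c hrk
  set b' := Submodule.smithNormalFormTopBasis c hrk with hb'
  set ab := Submodule.smithNormalFormBotBasis c hrk
  have hab := Submodule.smithNormalFormBotBasis_def c hrk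
  -- The diagonal map of invariant factors differs from `ψ` by an automorphism, so the determinants
  -- agree up to a unit; units have value `0` because their quotient is zero.
  have hass : Associated (∏ i, a i) (LinearMap.det ψ) := by
    rw [← Matrix.det_diagonal, ← LinearMap.det_toLin b']
    refine LinearMap.associated_det_of_eq_comp
      ((b'.equiv ab (Equiv.refl _)).trans e₁.symm) _ _ ?_
    have key : Matrix.toLin b' b' (Matrix.diagonal a) =
        ψ ∘ₗ ((b'.equiv ab (Equiv.refl _)).trans e₁.symm).toLinearMap := by
      refine b'.ext fun i => ?_
      have h1 : ψ (e₁.symm (ab i)) = ab i := by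
        have := congrArg Subtype.val (e₁.apply_symm_apply (ab i))
        rwa [he₁, LinearEquiv.ofInjective_apply] at this
      simp only [LinearMap.comp_apply, LinearEquiv.coe_coe, LinearEquiv.trans_apply,
        Module.Basis.equiv_apply, Equiv.refl_apply, h1]
      rw [Matrix.toLin_self]
      simp only [Matrix.diagonal_apply, ite_smul, zero_smul, Finset.sum_ite_eq',
        Finset.mem_univ, if_true]
      exact (hab i).symm
    intro x
    rw [key]
    rfl
  have hordunit : ∀ u : Aˣ, ord u = 0 := by
    intro u
    rw [← (hfin u u.ne_zero).2, Ideal.span_singleton_eq_top.2 u.isUnit]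
    have : Subsingleton (A ⧸ (⊤ : Ideal A)) := Ideal.Quotient.subsingleton_iff.2 rfl
    rw [Module.finrank_zero_of_subsingleton, Nat.cast_zero]
  have hprod : ∀ s : Finset ι, ord (∏ i ∈ s, a i) = ∑ i ∈ s, ord (a i) := by
    intro s
    induction s using Finset.induction_on with
    | empty => simpa using hordunit 1
    | insert i s hi ih =>
      rw [Finset.prod_insert hi, Finset.sum_insert hi,
        hmul _ _ (ha i) (Finset.prod_ne_zero_iff.2 fun i _ => ha i), ih]
  have hordet : ord (LinearMap.det ψ) = ∑ i, ord (a i) := by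
    obtain ⟨u, hu⟩ := hass
    rw [← hu, hmul _ _ (Finset.prod_ne_zero_iff.2 fun i _ => ha i) u.ne_zero, hordunit, add_zero,
      hprod]
  have hf : ∀ i, Module.Finite ℂ (A ⧸ Ideal.span ({a i} : Set A)) := fun i => (hfin _ (ha i)).1
  refine ⟨?_, ?_⟩
  · exact Module.Finite.equiv ((P.quotientEquivPiSpan c hrk).restrictScalars ℂ).symm
  · rw [Submodule.finrank_quotient_eq_sum ℂ c hrk, hordet]
    push_cast
    exact Finset.sum_congr rfl fun i _ => (hfin _ (ha i)).2

/-- `ℂ{z}`, as a subalgebra of the ambient field. -/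
def convPower : Subalgebra ℂ H where
  carrier := {f | f ∈ convLaurent 1 ∧ f ∈ fil 0}
  mul_mem' := fun hf hg => ⟨mul_mem hf.1 hg.1, by simpa using mul_mem_fil hf.2 hg.2⟩
  add_mem' := fun hf hg => ⟨add_mem hf.1 hg.1, add_mem hf.2 hg.2⟩
  algebraMap_mem' := fun c => ⟨Subalgebra.algebraMap_mem _ c, by
    rw [Algebra.algebraMap_eq_smul_one]
    exact (fil 0).smul_mem c (zpow_mem_fil 0)⟩

/-- `ℂ{z}`, as a type. -/
def ConvP : Type := convPower

instance : CommRing ConvP := inferInstanceAs (CommRing convPower)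
instance : IsDomain ConvP := inferInstanceAs (IsDomain convPower)
instance : Algebra ℂ ConvP := inferInstanceAs (Algebra ℂ convPower)

/-- The inclusion of `ℂ{z}` into the ambient field. -/
def ConvP.val : ConvP →ₐ[ℂ] H := convPower.val

theorem ConvP.val_injective : Function.Injective ConvP.val := Subtype.val_injective

theorem ConvP.val_mem (f : ConvP) : ConvP.val f ∈ convPower := f.2

theorem ConvP.exists_val {f : H} (hf : f ∈ convPower) : ∃ g : ConvP, ConvP.val g = f :=
  ⟨(⟨f, hf⟩ : convPower), rfl⟩

theorem ConvP.val_ne_zero {f : ConvP} (hf : f ≠ 0) : ConvP.val f ≠ 0 := fun h =>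
  hf (ConvP.val_injective (h.trans (map_zero _).symm))

theorem ConvP.mem_lauFil (f : ConvP) : ConvP.val f ∈ lauFil 1 0 := ⟨f.2.1.1, f.2.2⟩

theorem ConvP.exists_nat_of_coeff_ne_zero (f : ConvP) {a : ℚ} (ha : (ConvP.val f).coeff a ≠ 0) :
    ∃ n : ℕ, a = n := by
  have := exists_nat_of_mem (m := 0) (by simpa using f.mem_lauFil) ha
  simpa using this

theorem ConvP.exists_order_eq {f : ConvP} (hf : f ≠ 0) : ∃ n : ℕ, (ConvP.val f).order = n :=
  f.exists_nat_of_coeff_ne_zero (HahnSeries.coeff_order_eq_zero.not.2 (ConvP.val_ne_zero hf))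

/-- The quotient of convergent series is convergent, so only its order can obstruct divisibility. -/
theorem ConvP.dvd_iff {f g : ConvP} (hf : f ≠ 0) :
    f ∣ g ↔ ConvP.val g ∈ fil (ConvP.val f).order := by
  have h0 := ConvP.val_ne_zero hf
  constructor
  · rintro ⟨h, rfl⟩
    rw [map_mul]
    have := mul_mem_fil (mem_fil_order (ConvP.val f)) h.2.2
    rwa [add_zero] at this
  · intro hg
    have h1 : (ConvP.val f)⁻¹ * ConvP.val g ∈ convPower := by
      refine ⟨mul_mem (inv_mem_convLaurent one_pos f.2.1) g.2.1, ?_⟩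
      have := mul_mem_fil (mem_fil_order (ConvP.val f)⁻¹) hg
      rwa [order_inv, neg_add_cancel] at this
    obtain ⟨h, hh⟩ := ConvP.exists_val h1
    refine ⟨h, ConvP.val_injective ?_⟩
    rw [map_mul, hh, mul_inv_cancel_left₀ h0]

theorem zpow_natCast_mem_convPower (n : ℕ) : zpow n ∈ convPower :=
  ⟨by simpa using zpow_int_mem_convLaurent n, fil_anti (Nat.cast_nonneg n) (zpow_mem_fil _)⟩

/-- The coordinate `z` of `ℂ{z}`. -/
def ConvP.z : ConvP := (⟨zpow ((1 : ℕ) : ℚ), zpow_natCast_mem_convPower 1⟩ : convPower)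

theorem ConvP.val_z : ConvP.val ConvP.z = zpow 1 := by
  change zpow ((1 : ℕ) : ℚ) = _
  rw [Nat.cast_one]

theorem ConvP.val_z_pow (n : ℕ) : ConvP.val (ConvP.z ^ n) = zpow n := by
  rw [map_pow, ConvP.val_z, zpow_natCast_mul, mul_one]

theorem ConvP.z_pow_ne_zero (n : ℕ) : ConvP.z ^ n ≠ 0 := by
  intro h
  have := congrArg ConvP.val h
  rw [ConvP.val_z_pow, map_zero] at this
  exact zpow_ne_zero _ this

theorem ConvP.dvd_iff_order_le {f g : ConvP} (hf : f ≠ 0) (hg : g ≠ 0) :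
    f ∣ g ↔ (ConvP.val f).order ≤ (ConvP.val g).order := by
  rw [ConvP.dvd_iff hf, mem_fil_iff_order (ConvP.val_ne_zero hg)]

/-- Every nonzero element is associated to a power of `z`, so `ℂ{z}` is a discrete valuation ring.
-/
instance : IsPrincipalIdealRing ConvP := by
  have : IsDiscreteValuationRing ConvP := by
    apply IsDiscreteValuationRing.ofHasUnitMulPowIrreducibleFactorization
    have hass : ∀ {x : ConvP} (n : ℕ), x ≠ 0 → (ConvP.val x).order = n →
        Associated (ConvP.z ^ n) x := by
      intro x n hx hn
      refine associated_of_dvd_dvd ?_ ?_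
      · rw [ConvP.dvd_iff_order_le (ConvP.z_pow_ne_zero n) hx, ConvP.val_z_pow, order_zpow, hn]
      · rw [ConvP.dvd_iff_order_le hx (ConvP.z_pow_ne_zero n), ConvP.val_z_pow, order_zpow, hn]
    refine ⟨ConvP.z, ⟨?_, ?_⟩, fun {x} hx => ?_⟩
    · intro h
      have h1 := h.dvd (a := (1 : ConvP))
      rw [ConvP.dvd_iff_order_le (by simpa using ConvP.z_pow_ne_zero 1) one_ne_zero,
        ConvP.val_z, order_zpow, map_one, HahnSeries.order_one] at h1
      norm_num at h1
    · intro a b hab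
      have ha : a ≠ 0 := by
        rintro rfl
        exact ConvP.z_pow_ne_zero 1 (by rw [pow_one, hab, zero_mul])
      have hb : b ≠ 0 := by
        rintro rfl
        exact ConvP.z_pow_ne_zero 1 (by rw [pow_one, hab, mul_zero])
      obtain ⟨m, hm⟩ := ConvP.exists_order_eq ha
      obtain ⟨n, hn⟩ := ConvP.exists_order_eq hb
      have h1 : (ConvP.val ConvP.z).order = (ConvP.val a).order + (ConvP.val b).order := by
        rw [hab, map_mul, HahnSeries.order_mul (ConvP.val_ne_zero ha) (ConvP.val_ne_zero hb)]
      rw [ConvP.val_z, order_zpow, hm, hn] at h1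
      have h2 : 1 = m + n := by exact_mod_cast h1
      have hu : ∀ {x : ConvP}, x ≠ 0 → (ConvP.val x).order = (0 : ℕ) → IsUnit x := by
        intro x hx hx0
        have := hass 0 hx hx0
        rw [pow_zero] at this
        exact this.isUnit isUnit_one
      rcases Nat.eq_zero_or_pos m with h | h
      · exact Or.inl (hu ha (h ▸ hm))
      · exact Or.inr (hu hb ((by omega : n = 0) ▸ hn))
    · obtain ⟨n, hn⟩ := ConvP.exists_order_eq hx
      exact ⟨n, hass n hx hn⟩
  infer_instance

/-- Modulo `f` only the Taylor coefficients below `ord f` survive. -/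
theorem ConvP.finrank_quotient {f : ConvP} (hf : f ≠ 0) :
    Module.Finite ℂ (ConvP ⧸ Ideal.span {f}) ∧
      (Module.finrank ℂ (ConvP ⧸ Ideal.span {f}) : ℚ) = (ConvP.val f).order := by
  obtain ⟨n, hn⟩ := ConvP.exists_order_eq hf
  set T : ConvP →ₗ[ℂ] (Fin n → ℂ) :=
    { toFun := fun g i => (ConvP.val g).coeff ((i : ℕ) : ℚ)
      map_add' := fun g h => by ext i; simp
      map_smul' := fun c g => by ext i; simp } with hT
  have hsurj : LinearMap.range T = ⊤ := by
    rw [eq_top_iff]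
    rintro c -
    refine ⟨∑ i : Fin n, c i • ConvP.z ^ (i : ℕ), ?_⟩
    ext j
    simp only [map_sum, map_smul, Finset.sum_apply]
    change ∑ i, c i * (ConvP.val (ConvP.z ^ (i : ℕ))).coeff ((j : ℕ) : ℚ) = c j
    simp only [ConvP.val_z_pow]
    rw [Finset.sum_eq_single j]
    · simp [zpow]
    · intro i _ hij
      have : ((j : ℕ) : ℚ) ≠ ((i : ℕ) : ℚ) := by
        intro h
        exact hij (Fin.ext (by exact_mod_cast h.symm))
      rw [zpow, HahnSeries.coeff_single_of_ne this, mul_zero]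
    · simp
  have hker : LinearMap.ker T = (Ideal.span {f}).restrictScalars ℂ := by
    ext g
    rw [LinearMap.mem_ker, Submodule.restrictScalars_mem, Ideal.mem_span_singleton,
      ConvP.dvd_iff hf, hn, mem_fil_iff]
    constructor
    · intro h x hx
      by_contra hne
      obtain ⟨k, rfl⟩ := g.exists_nat_of_coeff_ne_zero hne
      exact hne (congrFun h ⟨k, by exact_mod_cast hx⟩)
    · intro h
      ext i
      exact h _ (by exact_mod_cast i.2)
  have e : (ConvP ⧸ Ideal.span {f}) ≃ₗ[ℂ] (Fin n → ℂ) :=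
    (Submodule.Quotient.restrictScalarsEquiv ℂ (Ideal.span {f})).symm.trans
      ((Submodule.quotEquivOfEq _ _ hker.symm).trans
        (T.quotKerEquivOfSurjective (LinearMap.range_eq_top.1 hsurj)))
  refine ⟨Module.Finite.equiv e.symm, ?_⟩
  rw [e.finrank_eq, Module.finrank_fin_fun, hn]

theorem ConvP.order_mul (f g : ConvP) (hf : f ≠ 0) (hg : g ≠ 0) :
    (ConvP.val (f * g)).order = (ConvP.val f).order + (ConvP.val g).order := by
  rw [map_mul, HahnSeries.order_mul (ConvP.val_ne_zero hf) (ConvP.val_ne_zero hg)]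

open Polynomial in
-- In `a P + b G` the cofactor `b` may be reduced modulo the monic `P`; the degree bound on the
-- other cofactor is then automatic. Hence the cokernel of the Sylvester map is the quotient by the
-- ideal `(P, G)`.
theorem range_sylvesterMap {A : Type*} [CommRing A] {P G : A[X]} (hP : P.Monic) {n : ℕ}
    (hG : G.natDegree ≤ n) :
    LinearMap.range (sylvesterMap (m := P.natDegree) P G le_rfl hG) =
      LinearMap.ker (((Submodule.mkQ (Ideal.span {P, G})).restrictScalars A) ∘ₗ
        (degreeLT A (P.natDegree + n)).subtype) := by
  nontriviality A
  ext ⟨f, hf⟩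
  rw [LinearMap.mem_ker, LinearMap.comp_apply, Submodule.subtype_apply,
    LinearMap.restrictScalars_apply, Submodule.mkQ_apply, Submodule.Quotient.mk_eq_zero,
    Ideal.mem_span_pair, LinearMap.mem_range]
  constructor
  · rintro ⟨⟨u, v⟩, h⟩
    have := congrArg Subtype.val h
    rw [sylvesterMap_apply_coe] at this
    exact ⟨v, u, by rw [← this]; ring⟩
  · rintro ⟨a, b, rfl⟩
    rw [mem_degreeLT] at hf
    have hb := modByMonic_add_div b P
    set b' := b %ₘ P
    have hb' : b'.degree < P.natDegree := by
      rw [← degree_eq_natDegree hP.ne_zero]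
      exact degree_modByMonic_lt _ hP
    set w := a + G * (b /ₘ P) with hw
    have heq : P * w + G * b' = a * P + b * G := by
      rw [hw]
      nth_rw 2 [← hb]
      ring
    have hdeg : (G * b').degree < ((P.natDegree + n : ℕ) : WithBot ℕ) := by
      by_cases hG0 : G = 0
      · simp only [hG0, zero_mul, degree_zero]
        exact WithBot.bot_lt_coe _
      refine (degree_mul_le _ _).trans_lt ?_
      rw [add_comm P.natDegree, Nat.cast_add]
      exact WithBot.add_lt_add_of_le_of_lt (by simpa using hG0) (degree_le_of_natDegree_le hG) hb'
    have hPw : (P * w).degree < ((P.natDegree + n : ℕ) : WithBot ℕ) := by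
      have : P * w = (a * P + b * G) - G * b' := by rw [← heq]; ring
      rw [this]
      exact (degree_sub_le _ _).trans_lt (max_lt hf hdeg)
    have hwn : w.degree < n := by
      by_cases hw0 : w = 0
      · rw [hw0, degree_zero]
        exact WithBot.bot_lt_coe _
      rw [degree_eq_natDegree (hP.mul_right_ne_zero hw0), hP.natDegree_mul' hw0] at hPw
      rw [degree_eq_natDegree hw0]
      have : P.natDegree + w.natDegree < P.natDegree + n := by exact_mod_cast hPw
      exact_mod_cast (by omega : w.natDegree < n)
    refine ⟨⟨⟨b', mem_degreeLT.2 hb'⟩, ⟨w, mem_degreeLT.2 hwn⟩⟩, Subtype.ext ?_⟩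
    rw [sylvesterMap_apply_coe]
    exact heq

open Polynomial in
theorem mkQ_degreeLT_surjective {A : Type*} [CommRing A] [Nontrivial A] {P G : A[X]}
    (hP : P.Monic) (n : ℕ) :
    Function.Surjective (((Submodule.mkQ (Ideal.span {P, G})).restrictScalars A) ∘ₗ
        (degreeLT A (P.natDegree + n)).subtype) := by
  intro x
  obtain ⟨f, rfl⟩ := Submodule.mkQ_surjective _ x
  refine ⟨⟨f %ₘ P, mem_degreeLT.2 ?_⟩, ?_⟩
  · refine (degree_modByMonic_lt _ hP).trans_le ?_
    rw [degree_eq_natDegree hP.ne_zero]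
    exact_mod_cast Nat.le_add_right _ _
  · rw [LinearMap.comp_apply, Submodule.subtype_apply, LinearMap.restrictScalars_apply,
      Submodule.mkQ_apply, Submodule.mkQ_apply, Submodule.Quotient.eq, Ideal.mem_span_pair]
    refine ⟨-(f /ₘ P), 0, ?_⟩
    have := modByMonic_add_div f P
    linear_combination -this

open Polynomial in
/-- The intersection multiplicity of a monic polynomial `P` with a polynomial `G` over `ℂ{z}`, in
terms of the Puiseux roots of `P`. -/
theorem finrank_quotient_span_pair {P G : ConvP[X]} (hP : P.Monic)
    (hs : (P.map ConvP.val.toRingHom).Splits)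
    (hG : ∀ x ∈ (P.map ConvP.val.toRingHom).roots, (G.map ConvP.val.toRingHom).eval x ≠ 0) :
    (∃ k : ℕ, C (ConvP.z ^ k) ∈ Ideal.span {P, G}) ∧
    Module.Finite ℂ (ConvP[X] ⧸ Ideal.span {P, G}) ∧
      (Module.finrank ℂ (ConvP[X] ⧸ Ideal.span {P, G}) : ℚ) =
        ((P.map ConvP.val.toRingHom).roots.map fun x =>
          ((G.map ConvP.val.toRingHom).eval x).order).sum := by
  -- Exceeding the degree by one keeps the Sylvester format nonempty when both polynomials are
  -- constant; as `P` is monic, the resultant is unchanged.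
  set n := G.natDegree + 1 with hn
  have hGn : G.natDegree ≤ n := by omega
  set ρ := resultant P G P.natDegree n with hρ
  have hval : ConvP.val ρ = ((P.map ConvP.val.toRingHom).roots.map
      (G.map ConvP.val.toRingHom).eval).prod := by
    have h1 := resultant_eq_prod_eval (P.map ConvP.val.toRingHom) (G.map ConvP.val.toRingHom) n
      (natDegree_map_le.trans hGn) hs
    rw [resultant_map_map, (hP.map _).leadingCoeff, one_pow, one_mul, hP.natDegree_map] at h1
    exact h1
  have hne : ConvP.val ρ ≠ 0 := by
    rw [hval]
    refine Multiset.prod_ne_zero fun h0 => ?_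
    obtain ⟨x, hx, hx0⟩ := Multiset.mem_map.1 h0
    exact hG x hx hx0
  have hρ0 : ρ ≠ 0 := by
    intro h
    exact hne (by rw [h, map_zero])
  have hord : (ConvP.val ρ).order = ((P.map ConvP.val.toRingHom).roots.map fun x =>
      ((G.map ConvP.val.toRingHom).eval x).order).sum := by
    rw [hval]
    generalize (P.map ConvP.val.toRingHom).roots = s at hG
    induction s using Multiset.induction_on with
    | empty => simp
    | cons x s ih =>
      have hs' : ∀ x ∈ s, (G.map ConvP.val.toRingHom).eval x ≠ 0 := fun y hy =>
        hG y (Multiset.mem_cons_of_mem hy)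
      rw [Multiset.map_cons, Multiset.map_cons, Multiset.prod_cons, Multiset.sum_cons,
        HahnSeries.order_mul (hG x (Multiset.mem_cons_self x s)) (Multiset.prod_ne_zero fun h0 => by
          obtain ⟨y, hy, hy0⟩ := Multiset.mem_map.1 h0
          exact hs' y hy hy0), ih hs']
  constructor
  · obtain ⟨k, hk⟩ := ConvP.exists_order_eq hρ0
    have hdvd : ρ ∣ ConvP.z ^ k := by
      rw [ConvP.dvd_iff_order_le hρ0 (ConvP.z_pow_ne_zero k), ConvP.val_z_pow, order_zpow, hk]
    obtain ⟨u, hu⟩ := hdvd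
    -- The resultant lies in the ideal, and being nonzero it divides a power of `z`.
    obtain ⟨a, b, -, -, hab⟩ := exists_mul_add_mul_eq_C_resultant P G le_rfl hGn
      (Or.inr (by omega))
    refine ⟨k, Ideal.mem_span_pair.2 ⟨a * C u, b * C u, ?_⟩⟩
    rw [hu, C_mul, hρ, ← hab]
    ring
  · have hdet : (LinearMap.toMatrix
        (((degreeLT.basis ConvP P.natDegree).prod (degreeLT.basis ConvP n)).reindex finSumFinEquiv)
        (degreeLT.basis ConvP (P.natDegree + n))
        (sylvesterMap (m := P.natDegree) P G le_rfl hGn)).det = ρ := by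
      rw [toMatrix_sylvesterMap']
      rfl
    have h1 := finrank_coker_eq_of_det_ne_zero (ord := fun f => (ConvP.val f).order)
      ConvP.order_mul (fun a ha => ConvP.finrank_quotient ha) _ _ _ (hdet.symm ▸ hρ0)
    rw [hdet, hord] at h1
    have e := ((Submodule.quotEquivOfEq _ _ (range_sylvesterMap hP hGn)).trans
      (LinearMap.quotKerEquivOfSurjective _ (mkQ_degreeLT_surjective (G := G) hP n))).restrictScalars ℂ
    have := h1.1
    exact ⟨Module.Finite.equiv e, by rw [← e.finrank_eq]; exact h1.2⟩

end IrregularSpectral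

end

/-! ### From `ℂ{z}[ζ]` to convergent power series in two variables -/

noncomputable section

namespace IrregularSpectral

section mapCoeffs

open Polynomial

/-- Apply an additive map to the coefficients of a polynomial. -/
def mapCoeffs {A : Type*} [CommRing A] (δ : A →+ A) (p : A[X]) : A[X] :=
  p.sum fun i a => monomial i (δ a)

theorem coeff_mapCoeffs {A : Type*} [CommRing A] (δ : A →+ A) (p : A[X]) (i : ℕ) :
    (mapCoeffs δ p).coeff i = δ (p.coeff i) := by
  rw [mapCoeffs, sum_def, finsetSum_coeff]
  simp only [coeff_monomial, Finset.sum_ite_eq']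
  split_ifs with h
  · rfl
  · rw [notMem_support_iff.1 h, map_zero]

theorem map_mapCoeffs {A B : Type*} [CommRing A] [CommRing B] (f : A →+* B) (δ : A →+ A)
    (ε : B →+ B) (h : ∀ a, f (δ a) = ε (f a)) (p : A[X]) :
    (mapCoeffs δ p).map f = mapCoeffs ε (p.map f) := by
  ext i
  rw [coeff_map, coeff_mapCoeffs, coeff_mapCoeffs, coeff_map, h]

/-- The chain rule `d/dz F(x(z), z) = F_z + F_ζ x'`. -/
theorem derivation_eval (p : H[X]) (x : H) :
    ddz (p.eval x) =
      (mapCoeffs (ddz : H →ₗ[ℂ] H).toAddMonoidHom p).eval x + p.derivative.eval x * ddz x := by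
  induction p using Polynomial.induction_on' with
  | add p q hp hq =>
    have : mapCoeffs (ddz : H →ₗ[ℂ] H).toAddMonoidHom (p + q) =
        mapCoeffs (ddz : H →ₗ[ℂ] H).toAddMonoidHom p +
        mapCoeffs (ddz : H →ₗ[ℂ] H).toAddMonoidHom q := by
      ext1 i
      simp only [coeff_mapCoeffs, coeff_add, map_add]
    rw [this, eval_add, eval_add, derivative_add, eval_add, map_add, hp, hq]
    ring
  | monomial n a =>
    have : mapCoeffs (ddz : H →ₗ[ℂ] H).toAddMonoidHom (monomial n a) = monomial n (ddz a) := by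
      ext1 i
      rw [coeff_mapCoeffs, coeff_monomial, coeff_monomial]
      split_ifs
      · rfl
      · exact map_zero _
    rw [this, derivative_monomial, eval_monomial, eval_monomial, eval_monomial,
      Derivation.leibniz, Derivation.leibniz_pow]
    simp only [smul_eq_mul, nsmul_eq_mul]
    ring

end mapCoeffs

theorem ddz_mem_convPower {f : H} (hf : f ∈ convPower) : ddz f ∈ convPower := by
  refine ⟨⟨ddz_mem_laurent one_pos hf.1.1, ddz_mem_convergent hf.1.2⟩, ?_⟩
  rw [mem_fil_iff]
  intro a ha
  rw [coeff_ddz]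
  by_cases h0 : f.coeff (a + 1) = 0
  · rw [h0, mul_zero]
  obtain ⟨n, hn⟩ := ConvP.exists_nat_of_coeff_ne_zero (⟨f, hf⟩ : convPower) h0
  -- The only exponent that could produce a pole is that of the constant term, which the derivative
  -- kills.
  have h1 : n = 0 := by
    have : (n : ℚ) < 1 := by rw [← hn]; linarith
    have : n < 1 := by exact_mod_cast this
    omega
  rw [hn, h1]
  simp

/-- `d/dz` on `ℂ{z}`. -/
def ddzP : ConvP →+ ConvP where
  toFun f := (⟨ddz f.1, ddz_mem_convPower f.2⟩ : convPower)
  map_zero' := Subtype.ext (map_zero ddz)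
  map_add' f g := Subtype.ext (ddz.map_add f.1 g.1)

theorem val_ddzP (f : ConvP) : ConvP.val (ddzP f) = ddz (ConvP.val f) := rfl

/-- The Taylor series at the origin. -/
def ConvP.toPS : ConvP →+* PowerSeries ℂ where
  toFun f := PowerSeries.mk fun n => (ConvP.val f).coeff (n : ℚ)
  map_one' := by
    ext n
    rw [PowerSeries.coeff_mk, map_one, PowerSeries.coeff_one, HahnSeries.coeff_one]
    norm_cast
  map_zero' := by
    ext n
    simp
  map_add' f g := by
    ext n
    simp
  map_mul' f g := by
    ext n
    rw [PowerSeries.coeff_mk, map_mul, PowerSeries.coeff_mul,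
      Finset.Nat.sum_antidiagonal_eq_sum_range_succ_mk, Finset.sum_flip
      (fun k => PowerSeries.coeff k _ * PowerSeries.coeff (n - k) _) |>.symm]
    have := coeff_mul_of_mem (m := 0) (by simpa using f.mem_lauFil) g.mem_lauFil n
    simp only [Nat.cast_zero, sub_zero] at this
    rw [this]
    refine Finset.sum_congr rfl fun l hl => ?_
    have hl' : l ≤ n := by
      have := Finset.mem_range.1 hl
      omega
    rw [Nat.sub_sub_self hl', PowerSeries.coeff_mk, PowerSeries.coeff_mk]

/-- A convergent power series in `z`, as a power series in `x₀ = ζ` and `x₁ = z`. -/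
def ConvP.toMvPS : ConvP →+* MvPowerSeries (Fin 2) ℂ :=
  (MvPowerSeries.rename (R := ℂ) (⇑(⟨fun _ => 1, fun _ _ _ => rfl⟩ : Unit ↪ Fin 2))).toRingHom.comp
    ConvP.toPS

theorem ConvP.coeff_toMvPS (f : ConvP) (n : Fin 2 →₀ ℕ) :
    MvPowerSeries.coeff n (ConvP.toMvPS f) = if n 0 = 0 then (ConvP.val f).coeff ((n 1 : ℕ) : ℚ)
      else 0 := by
  set e : Unit ↪ Fin 2 := ⟨fun _ => 1, fun _ _ _ => rfl⟩ with he
  change MvPowerSeries.coeff n (MvPowerSeries.rename e (ConvP.toPS f)) = _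
  split_ifs with h
  · have hn : n = Finsupp.embDomain e (Finsupp.single () (n 1)) := by
      rw [Finsupp.embDomain_single]
      change n = Finsupp.single 1 (n 1)
      ext i
      fin_cases i
      · simpa using h
      · simp
    have h2 := MvPowerSeries.coeff_embDomain_rename (R := ℂ) e (ConvP.toPS f)
      (Finsupp.single () (n 1))
    rw [← hn] at h2
    rw [h2]
    exact PowerSeries.coeff_mk (n 1) fun n => (ConvP.val f).coeff (n : ℚ)
  · refine MvPowerSeries.coeff_rename_eq_zero _ _ ?_
    rintro ⟨m, rfl⟩
    apply h
    rw [Finsupp.mapDomain_of_notMem_range]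
    rintro ⟨x, hx⟩
    exact one_ne_zero hx

theorem ConvP.toMvPS_mem (f : ConvP) : ConvP.toMvPS f ∈ convPS := by
  obtain ⟨ρ, hρ, hs⟩ := f.2.1.2
  refine ⟨ρ, hρ, ?_⟩
  have h1 := (summableAt_iff (m := 0) (f := ConvP.val f) (by simpa using f.mem_lauFil) hρ).1 hs
  have hinj : Function.Injective fun j : ℕ => (Finsupp.single 1 j : Fin 2 →₀ ℕ) :=
    Finsupp.single_injective _
  refine (hinj.summable_iff fun n hn => ?_).1 ?_
  · rw [ConvP.coeff_toMvPS, if_neg, norm_zero, zero_mul]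
    intro h0
    refine hn ⟨n 1, ?_⟩
    ext i
    fin_cases i
    · simpa using h0.symm
    · simp
  · refine h1.congr fun j => ?_
    simp only [Function.comp_apply, ConvP.coeff_toMvPS]
    simp

theorem X_mem_convPS (i : Fin 2) : (MvPowerSeries.X i : MvPowerSeries (Fin 2) ℂ) ∈ convPS := by
  classical
  refine ⟨1, one_pos, summable_of_ne_finset_zero (s := {Finsupp.single i 1}) fun a ha => ?_⟩
  rw [MvPowerSeries.coeff_X, if_neg (by simpa using ha)]
  simp

/-- The coordinate `x₀ = ζ` in `ℂ{x₀, x₁}`. -/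
def zeta : convPS := ⟨MvPowerSeries.X 0, X_mem_convPS 0⟩

open Polynomial

/-- The inclusion `ℂ{z}[ζ] → ℂ{ζ, z}`. -/
def expand : ConvP[X] →+* convPS :=
  eval₂RingHom (ConvP.toMvPS.codRestrict convPS ConvP.toMvPS_mem) zeta

theorem coeff_expand (p : ConvP[X]) (n : Fin 2 →₀ ℕ) :
    MvPowerSeries.coeff n (expand p : MvPowerSeries (Fin 2) ℂ) =
      (ConvP.val (p.coeff (n 0))).coeff ((n 1 : ℕ) : ℚ) := by
  classical
  induction p using Polynomial.induction_on' with
  | add p q hp hq =>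
    rw [map_add, Subalgebra.coe_add, map_add, hp, hq, coeff_add, map_add, HahnSeries.coeff_add]
  | monomial i a =>
    have h1 : (expand (monomial i a) : MvPowerSeries (Fin 2) ℂ) =
        ConvP.toMvPS a * MvPowerSeries.X 0 ^ i := by
      rw [expand, coe_eval₂RingHom, eval₂_monomial]
      rfl
    rw [h1, MvPowerSeries.X_pow_eq, MvPowerSeries.coeff_mul_monomial, mul_one, coeff_monomial]
    by_cases hi : i = n 0
    · have hle : Finsupp.single 0 i ≤ n := by
        rw [Finsupp.single_le_iff, hi]
      rw [if_pos hle, if_pos hi, ConvP.coeff_toMvPS, if_pos (by simp [hi])]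
      simp
    · rw [if_neg hi, map_zero, HahnSeries.coeff_zero]
      split_ifs with hle
      · rw [ConvP.coeff_toMvPS, if_neg]
        rw [Finsupp.single_le_iff] at hle
        simp
        omega
      · rfl

theorem pd_zero_expand (p : ConvP[X]) : pd 0 (expand p) = expand (derivative p) := by
  apply Subtype.ext
  ext n
  change MvPowerSeries.coeff n (MvPowerSeries.pderiv ℂ 0 _) = _
  rw [MvPowerSeries.coeff_pderiv, coeff_expand, coeff_expand, coeff_derivative]
  have h1 : ConvP.val (p.coeff (n 0 + 1) * ((n 0 : ConvP) + 1)) =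
      ((n 0 : ℂ) + 1) • ConvP.val (p.coeff (n 0 + 1)) := by
    rw [← map_smul, Algebra.smul_def, map_add, map_natCast, map_one, mul_comm]
  rw [h1, HahnSeries.coeff_smul, smul_eq_mul, mul_comm]
  simp

theorem pd_one_expand (p : ConvP[X]) : pd 1 (expand p) = expand (mapCoeffs ddzP p) := by
  apply Subtype.ext
  ext n
  change MvPowerSeries.coeff n (MvPowerSeries.pderiv ℂ 1 _) = _
  rw [MvPowerSeries.coeff_pderiv, coeff_expand, coeff_expand, coeff_mapCoeffs, val_ddzP,
    coeff_ddz, mul_comm]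
  simp

theorem X_pow_dvd_of_zeta_pow_dvd {p : ConvP[X]} {N : ℕ} (h : zeta ^ N ∣ expand p) :
    X ^ N ∣ p := by
  obtain ⟨u, hu⟩ := h
  have h1 : (MvPowerSeries.X 0 : MvPowerSeries (Fin 2) ℂ) ^ N ∣ expand p := ⟨u, by rw [hu]; rfl⟩
  rw [MvPowerSeries.X_pow_dvd_iff] at h1
  rw [X_pow_dvd_iff]
  intro d hd
  apply ConvP.val_injective
  rw [map_zero]
  ext a
  rw [HahnSeries.coeff_zero]
  by_contra hne
  obtain ⟨j, rfl⟩ := ConvP.exists_nat_of_coeff_ne_zero _ hne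
  apply hne
  have := h1 (Finsupp.single 0 d + Finsupp.single 1 j) (by simpa using hd)
  rw [coeff_expand] at this
  simpa using this

/-- Truncation in `ζ`: each coefficient of a power of `ζ` in a convergent series is a convergent
series in `z`, and the tail divided by `ζ^N` still converges. -/
theorem exists_eq_expand_add (F : convPS) (N : ℕ) :
    ∃ (p : ConvP[X]) (u : convPS), F = expand p + zeta ^ N * u := by
  obtain ⟨ρ, hρ, hF⟩ := F.2
  set c : ℕ → ℕ → ℂ := fun i j =>
    MvPowerSeries.coeff (Finsupp.single 0 i + Finsupp.single 1 j) (F : MvPowerSeries (Fin 2) ℂ)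
    with hc
  have hmem : ∀ i, ofSeq 0 (c i) ∈ convPower := by
    intro i
    have h0 : ofSeq 0 (c i) ∈ lauFil 1 (-((0 : ℕ) : ℚ)) := ofSeq_mem 0 (c i)
    refine ⟨⟨h0.1, ρ, hρ, (summableAt_iff h0 hρ).2 ?_⟩, by simpa using h0.2⟩
    have hinj : Function.Injective fun j : ℕ =>
        (Finsupp.single 0 i + Finsupp.single 1 j : Fin 2 →₀ ℕ) := by
      intro j k hjk
      exact Finsupp.single_injective 1 (add_left_cancel hjk)
    refine ((hF.comp_injective hinj).mul_left (ρ ^ i)⁻¹).congr fun j => ?_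
    rw [coeff_ofSeq]
    simp only [Function.comp_apply, map_add, Finsupp.degree_single, pow_add]
    field_simp
    rfl
  set a : ℕ → ConvP := fun i => (⟨ofSeq 0 (c i), hmem i⟩ : convPower) with ha
  set p : ConvP[X] := ∑ i ∈ Finset.range N, monomial i (a i) with hp
  have hpc : ∀ i < N, p.coeff i = a i := by
    intro i hi
    rw [hp, finsetSum_coeff]
    simp [coeff_monomial, hi]
  have hdvd : (MvPowerSeries.X 0 : MvPowerSeries (Fin 2) ℂ) ^ N ∣ (F - expand p : convPS) := by
    rw [MvPowerSeries.X_pow_dvd_iff]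
    intro m hm
    rw [Subalgebra.coe_sub, map_sub, coeff_expand, hpc _ hm, sub_eq_zero]
    have h1 := coeff_ofSeq 0 (c (m 0)) (m 1)
    rw [Nat.cast_zero, sub_zero] at h1
    have h2 : (ConvP.val (a (m 0))).coeff ((m 1 : ℕ) : ℚ) = c (m 0) (m 1) := h1
    rw [h2]
    have h3 : m = Finsupp.single 0 (m 0) + Finsupp.single 1 (m 1) := by
      ext i
      fin_cases i <;> simp
    change _ = MvPowerSeries.coeff (Finsupp.single 0 (m 0) + Finsupp.single 1 (m 1)) _
    rw [← h3]
  obtain ⟨u, hu⟩ := hdvd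
  have hum : u ∈ convPS := by
    obtain ⟨σ, hσ, hG⟩ := (F - expand p : convPS).2
    refine ⟨σ, hσ, ?_⟩
    have hinj : Function.Injective fun n : Fin 2 →₀ ℕ => n + Finsupp.single 0 N :=
      add_left_injective _
    refine ((hG.comp_injective hinj).mul_left (σ ^ N)⁻¹).congr fun n => ?_
    simp only [Function.comp_apply, map_add, Finsupp.degree_single, pow_add]
    rw [hu, mul_comm (MvPowerSeries.X 0 ^ N), MvPowerSeries.X_pow_eq,
      MvPowerSeries.coeff_add_mul_monomial, mul_one]
    field_simp
  refine ⟨p, ⟨u, hum⟩, ?_⟩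
  rw [← sub_eq_iff_eq_add']
  exact Subtype.ext hu

/-- Over an ideal containing a power of `ζ`, passing from `ℂ{z}[ζ]` to `ℂ{ζ, z}` does not change
the quotient. -/
theorem nonempty_quotient_equiv {P G : ConvP[X]} {N : ℕ} (hN : X ^ N ∈ Ideal.span {P, G}) :
    Nonempty ((ConvP[X] ⧸ Ideal.span {P, G}) ≃ₗ[ℂ]
      (convPS ⧸ Ideal.span {expand P, expand G})) := by
  have hzeta : zeta ^ N ∈ Ideal.span {expand P, expand G} := by
    obtain ⟨a, b, hab⟩ := Ideal.mem_span_pair.1 hN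
    refine Ideal.mem_span_pair.2 ⟨expand a, expand b, ?_⟩
    rw [← map_mul, ← map_mul, ← map_add, hab, map_pow]
    congr 1
    rw [expand, coe_eval₂RingHom, eval₂_X]
  set T : ConvP[X] →ₗ[ℂ] (convPS ⧸ Ideal.span {expand P, expand G}) :=
    { toFun := fun p => Ideal.Quotient.mk _ (expand p)
      map_add' := fun p q => by rw [map_add, map_add]
      map_smul' := fun c p => by
        have : expand (c • p) = c • expand p := by
          apply Subtype.ext
          ext n
          rw [coeff_expand, coeff_smul, map_smul, HahnSeries.coeff_smul, Subalgebra.coe_smul,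
            MvPowerSeries.coeff_smul, coeff_expand, smul_eq_mul]
        rw [this]
        rfl } with hT
  have hsurj : Function.Surjective T := by
    intro x
    obtain ⟨F, rfl⟩ := Ideal.Quotient.mk_surjective x
    obtain ⟨p, u, rfl⟩ := exists_eq_expand_add F N
    refine ⟨p, ?_⟩
    change Ideal.Quotient.mk _ (expand p) = _
    rw [eq_comm, Ideal.Quotient.eq, add_sub_cancel_left]
    exact Ideal.mul_mem_right _ _ hzeta
  have hker : LinearMap.ker T = (Ideal.span {P, G}).restrictScalars ℂ := by
    ext f
    rw [LinearMap.mem_ker, Submodule.restrictScalars_mem]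
    change Ideal.Quotient.mk _ (expand f) = 0 ↔ _
    rw [Ideal.Quotient.eq_zero_iff_mem]
    constructor
    · intro h
      obtain ⟨A, B, hAB⟩ := Ideal.mem_span_pair.1 h
      -- Truncating the cofactors at `ζ^N` leaves an error divisible by `ζ^N`, hence lying in the
      -- polynomial ideal already.
      obtain ⟨a, A', rfl⟩ := exists_eq_expand_add A N
      obtain ⟨b, B', rfl⟩ := exists_eq_expand_add B N
      have hd : zeta ^ N ∣ expand (f - (a * P + b * G)) := by
        refine ⟨A' * expand P + B' * expand G, ?_⟩
        rw [map_sub, ← hAB, map_add, map_mul, map_mul]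
        ring
      obtain ⟨w, hw⟩ := X_pow_dvd_of_zeta_pow_dvd hd
      rw [sub_eq_iff_eq_add.1 hw]
      exact add_mem (Ideal.mul_mem_right _ _ hN) (Ideal.mem_span_pair.2 ⟨a, b, rfl⟩)
    · intro h
      obtain ⟨a, b, rfl⟩ := Ideal.mem_span_pair.1 h
      refine Ideal.mem_span_pair.2 ⟨expand a, expand b, ?_⟩
      rw [map_add, map_mul, map_mul]
  exact ⟨(Submodule.Quotient.restrictScalarsEquiv ℂ (Ideal.span {P, G})).symm.trans
      ((Submodule.quotEquivOfEq _ _ hker.symm).trans (T.quotKerEquivOfSurjective hsurj))⟩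

end IrregularSpectral

end

/-! ### The Milnor number in terms of Puiseux roots -/

noncomputable section

namespace IrregularSpectral

open Polynomial

/-- Up to sign the coefficient of degree `i` is the elementary symmetric function of degree `n - i`
of the roots. -/
theorem coeff_prod_X_sub_C_mem_fil {ζ : ℕ → H} {ε : ℚ} {n : ℕ} (hζ : ∀ k < n, ζ k ∈ fil ε) (i : ℕ) :
    (∏ k ∈ Finset.range n, (X - C (ζ k))).coeff i ∈ fil (ε * ((n : ℚ) - i)) := by
  induction n generalizing i with
  | zero =>
    rw [Finset.prod_range_zero, coeff_one]
    split_ifs with h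
    · rw [h]
      rw [Nat.cast_zero, sub_self, mul_zero]
      exact zpow_mem_fil 0
    · exact zero_mem _
  | succ n ih =>
    have ih' := ih fun k hk => hζ k (by omega)
    have hn := hζ n (by omega)
    rw [Finset.prod_range_succ]
    have h2 : ∀ i : ℕ, (∏ k ∈ Finset.range n, (X - C (ζ k))).coeff i * ζ n ∈
        fil (ε * (((n + 1 : ℕ) : ℚ) - i)) := by
      intro i
      have := mul_mem_fil (ih' i) hn
      convert this using 2
      push_cast
      ring
    rcases i with _ | i
    · rw [mul_coeff_zero, coeff_sub, coeff_X_zero, coeff_C_zero, zero_sub]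
      convert neg_mem (h2 0) using 1
      ring
    · rw [coeff_mul_X_sub_C]
      refine sub_mem ?_ (h2 _)
      have := ih' i
      convert this using 2
      push_cast
      ring

theorem ConvP.z_dvd_of_mem_fil {f : ConvP} {ε : ℚ} (hε : 0 < ε) (hf : ConvP.val f ∈ fil ε) :
    ConvP.z ∣ f := by
  have h0 := ConvP.z_pow_ne_zero 1
  rw [pow_one] at h0
  rw [ConvP.dvd_iff h0, ConvP.val_z, order_zpow, mem_fil_iff]
  intro x hx
  by_contra hne
  obtain ⟨n, rfl⟩ := f.exists_nat_of_coeff_ne_zero hne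
  have hn : n < 1 := by exact_mod_cast hx
  have hn0 : n = 0 := by omega
  subst hn0
  exact hne (mem_fil_iff.1 hf _ (by simpa using hε))

/-- A root of a monic polynomial whose lower coefficients have positive order has positive order. -/
theorem exists_mem_fil_of_root {Q : H[X]} (hQ : Q.Monic)
    (hc : ∀ i < Q.natDegree, Q.coeff i ∈ fil 1) {x : H} (hx : Q.eval x = 0) :
    ∃ δ : ℚ, 0 < δ ∧ x ∈ fil δ := by
  by_cases h0 : x = 0
  · exact ⟨1, one_pos, h0 ▸ zero_mem _⟩
  refine ⟨x.order, ?_, mem_fil_order x⟩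
  -- If `x` had order at most `0`, the leading term `x^n` would have order at least one below that
  -- of every other term.
  by_contra! hneg
  have hpow : ∀ n : ℕ, x ^ n ∈ fil (n * x.order) := by
    intro n
    have := mem_fil_order (x ^ n)
    rwa [HahnSeries.order_pow, nsmul_eq_mul] at this
  rw [eval_eq_sum_range, Finset.sum_range_succ, hQ.coeff_natDegree, one_mul] at hx
  have h1 : x ^ Q.natDegree ∈ fil (1 + Q.natDegree * x.order) := by
    rw [← neg_eq_of_add_eq_zero_right hx]
    refine neg_mem (sum_mem fun i hi => ?_)
    have hi' := Finset.mem_range.1 hi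
    refine fil_anti ?_ (mul_mem_fil (hc i hi') (hpow i))
    have : (i : ℚ) ≤ Q.natDegree := by exact_mod_cast hi'.le
    nlinarith
  rw [mem_fil_iff_order (pow_ne_zero _ h0), HahnSeries.order_pow, nsmul_eq_mul] at h1
  linarith

/-- The Milnor number of a reduced Weierstrass polynomial in terms of its Puiseux roots. -/
theorem finrank_milnorAlgebra {r : ℕ} (hr : 0 < r) {ζ : ℕ → H} {ε : ℚ} (hε : 0 < ε)
    (hζ : ∀ k < r, ζ k ∈ fil ε) (hinj : ∀ k < r, ∀ l < r, k ≠ l → ζ k ≠ ζ l) {Φ : ConvP[X]}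
    (hΦ : Φ.map ConvP.val.toRingHom = ∏ k ∈ Finset.range r, (X - C (ζ k))) :
    Module.Finite ℂ (MilnorAlgebra (expand Φ)) ∧
      (Module.finrank ℂ (MilnorAlgebra (expand Φ)) : ℚ) =
        ∑ k ∈ Finset.range r, ∑ l ∈ (Finset.range r).erase k, (ζ k - ζ l).order - (r - 1) := by
  have hvi : Function.Injective ConvP.val.toRingHom := ConvP.val_injective
  have hr0 : (r : ℂ) ≠ 0 := by exact_mod_cast hr.ne'
  have hmon : Φ.Monic := by
    rw [Function.Injective.monic_map_iff hvi, hΦ]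
    exact monic_prod_X_sub_C _ _
  have hdeg : Φ.natDegree = r := by
    rw [← natDegree_map_eq_of_injective hvi, hΦ, natDegree_prod_of_monic _ _ fun k _ => monic_X_sub_C _]
    simp
  -- `Φ = X ^ r` modulo `z`
  have hlow : ∀ i < r, ConvP.z ∣ Φ.coeff i := by
    intro i hi
    have h1 := coeff_prod_X_sub_C_mem_fil hζ i
    rw [← hΦ, coeff_map] at h1
    refine ConvP.z_dvd_of_mem_fil (mul_pos hε ?_) h1
    have : (i : ℚ) < r := by exact_mod_cast hi
    linarith
  set cr : ConvP := algebraMap ℂ ConvP (r : ℂ)⁻¹ with hcr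
  have hcr1 : cr * (r : ConvP) = 1 := by
    rw [hcr, ← map_natCast (algebraMap ℂ ConvP), ← map_mul, inv_mul_cancel₀ hr0, map_one]
  -- The derivative in `ζ` divided by `r`: monic, congruent to `X^(r-1)` modulo `z`, and generating
  -- the same ideal.
  set P : ConvP[X] := C cr * derivative Φ with hP
  have hPc : ∀ i, P.coeff i = cr * (Φ.coeff (i + 1) * (i + 1)) := fun i => by
    rw [hP, coeff_C_mul, coeff_derivative]
  have hPtop : P.coeff (r - 1) = 1 := by
    obtain ⟨n, rfl⟩ : ∃ n, r = n + 1 := ⟨r - 1, by omega⟩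
    have h1 : Φ.coeff (n + 1) = 1 := by
      rw [← hdeg]
      exact hmon.coeff_natDegree
    rw [hPc, Nat.add_sub_cancel, h1, one_mul, ← Nat.cast_succ]
    exact hcr1
  have hPdeg : P.natDegree ≤ r - 1 := by
    refine (natDegree_C_mul_le _ _).trans ?_
    have := natDegree_derivative_le Φ
    rwa [hdeg] at this
  have hPmon : P.Monic := monic_of_natDegree_le_of_coeff_eq_one _ hPdeg hPtop
  have hPnat : P.natDegree = r - 1 := by
    refine le_antisymm hPdeg (le_natDegree_of_ne_zero ?_)
    rw [hPtop]
    exact one_ne_zero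
  have hPlow : ∀ i < r - 1, ConvP.z ∣ P.coeff i := fun i hi => by
    rw [hPc]
    exact ((hlow (i + 1) (by omega)).mul_right _).mul_left _
  set G : ConvP[X] := mapCoeffs ddzP Φ with hG
  have hJ : Ideal.span {derivative Φ, G} = Ideal.span {P, G} := by
    have h1 : derivative Φ = C (r : ConvP) * P := by
      rw [hP, ← mul_assoc, ← C_mul, mul_comm (r : ConvP), hcr1, C_1, one_mul]
    apply le_antisymm
    · rw [Ideal.span_le]
      rintro x (rfl | rfl)
      · rw [h1]
        exact Ideal.mul_mem_left _ _ (Ideal.subset_span (by simp))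
      · exact Ideal.subset_span (by simp)
    · rw [Ideal.span_le]
      rintro x (rfl | rfl)
      · exact Ideal.mul_mem_left _ _ (Ideal.subset_span (by simp))
      · exact Ideal.subset_span (by simp)
  -- the Puiseux roots of `P`
  set Pv : H[X] := P.map ConvP.val.toRingHom with hPv
  set Φv : H[X] := Φ.map ConvP.val.toRingHom with hΦv
  have hPvmon : Pv.Monic := hPmon.map _
  have hPvnat : Pv.natDegree = r - 1 := by rw [hPv, hPmon.natDegree_map, hPnat]
  have hsplit : Pv.Splits := splits_of_coeff_mem_puiseux hPvmon fun i => by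
    rw [hPv, coeff_map]
    exact laurent_le_puiseux one_pos (ConvP.val_mem (P.coeff i)).1.1
  have hder : Φv.derivative = C (r : H) * Pv := by
    rw [hPv, hP, Polynomial.map_mul, map_C, ← derivative_map, ← mul_assoc, ← C_mul]
    have : (r : H) * ConvP.val.toRingHom cr = 1 := by
      rw [← map_natCast ConvP.val.toRingHom, ← map_mul, mul_comm, hcr1, map_one]
    rw [this, C_1, one_mul]
  have hGv : G.map ConvP.val.toRingHom = mapCoeffs (ddz : H →ₗ[ℂ] H).toAddMonoidHom Φv :=
    map_mapCoeffs _ _ _ (fun a => val_ddzP a) Φ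
  have hcard : Multiset.card Pv.roots = r - 1 := by
    rw [← hPvnat]
    exact hsplit.natDegree_eq_card_roots.symm
  have hroot : ∀ x ∈ Pv.roots, Pv.eval x = 0 := fun x hx => (mem_roots'.1 hx).2
  have heval : ∀ x, Φv.eval x = ∏ k ∈ Finset.range r, (x - ζ k) := by
    intro x
    rw [hΦ, eval_prod]
    simp
  have hderζ : ∀ k < r, Φv.derivative.eval (ζ k) = ∏ l ∈ (Finset.range r).erase k, (ζ k - ζ l) := by
    intro k hk
    have h1 : Φv = Lagrange.nodal (Finset.range r) ζ := hΦ
    rw [h1, Lagrange.eval_nodal_derivative_eval_node_eq (Finset.mem_range.2 hk), Lagrange.eval_nodal]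
  have hderne : ∀ k < r, Φv.derivative.eval (ζ k) ≠ 0 := by
    intro k hk
    rw [hderζ k hk, Finset.prod_ne_zero_iff]
    intro l hl
    rw [Finset.mem_erase, Finset.mem_range] at hl
    exact sub_ne_zero.2 (hinj k hk l hl.2 (Ne.symm hl.1))
  have hsubne : ∀ x ∈ Pv.roots, ∀ k < r, x - ζ k ≠ 0 := by
    intro x hx k hk h
    apply hderne k hk
    rw [hder, eval_mul, ← sub_eq_zero.1 h, hroot x hx, mul_zero]
  -- At a root of the derivative `Φ` is nonzero because its roots are simple, and of positive order
  -- because all roots involved have positive order. A nonzero order is what makes `d/dz` lower it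
  -- by exactly one.
  have hpos : ∀ x ∈ Pv.roots, Φv.eval x ≠ 0 ∧ 0 < (Φv.eval x).order ∧
      (Φv.eval x).order = ∑ k ∈ Finset.range r, (x - ζ k).order := by
    intro x hx
    have hne : ∀ k ∈ Finset.range r, x - ζ k ≠ 0 := fun k hk => hsubne x hx k (Finset.mem_range.1 hk)
    have hord := order_prod (Finset.range r) hne
    rw [← heval] at hord
    refine ⟨by rw [heval]; exact Finset.prod_ne_zero_iff.2 hne, ?_, hord⟩
    obtain ⟨δ, hδ, hxδ⟩ := exists_mem_fil_of_root hPvmon (fun i hi => by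
      rw [hPvnat] at hi
      have h0 := ConvP.z_pow_ne_zero 1
      rw [pow_one] at h0
      have := (ConvP.dvd_iff h0).1 (hPlow i hi)
      rw [ConvP.val_z, order_zpow] at this
      rw [hPv, coeff_map]
      exact this) (hroot x hx)
    rw [hord]
    refine Finset.sum_pos (fun k hk => ?_) ⟨0, Finset.mem_range.2 hr⟩
    have h1 : x - ζ k ∈ fil (min δ ε) := sub_mem (fil_anti (min_le_left _ _) hxδ)
      (fil_anti (min_le_right _ _) (hζ k (Finset.mem_range.1 hk)))
    rw [mem_fil_iff_order (hne k hk)] at h1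
    exact (lt_min hδ hε).trans_le h1
  have hGx : ∀ x ∈ Pv.roots, (G.map ConvP.val.toRingHom).eval x ≠ 0 ∧
      ((G.map ConvP.val.toRingHom).eval x).order = (Φv.eval x).order - 1 := by
    intro x hx
    -- Where the derivative in `ζ` vanishes, the chain rule identifies `F_z(x)` with the derivative
    -- of `F(x)`.
    have h1 := derivation_eval Φv x
    rw [← hGv, hder, eval_mul, hroot x hx, mul_zero, zero_mul, add_zero] at h1
    rw [← h1]
    exact order_ddz (hpos x hx).1 (hpos x hx).2.1.ne'
  obtain ⟨⟨k, hk⟩, hfin, hrank⟩ := finrank_quotient_span_pair hPmon hsplit fun x hx => (hGx x hx).1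
  -- `X^(r-1)` is a multiple of `z` modulo `P`, and `z^k` lies in the ideal. So the quotient is
  -- supported at the origin and does not change on passing to `ℂ{ζ, z}`.
  have hN : (X : ConvP[X]) ^ ((r - 1) * k) ∈ Ideal.span {P, G} := by
    have hzdvd : C ConvP.z ∣ P - X ^ (r - 1) := by
      rw [C_dvd_iff_dvd_coeff]
      intro i
      rw [coeff_sub, coeff_X_pow]
      rcases lt_trichotomy i (r - 1) with h | h | h
      · rw [if_neg h.ne, sub_zero]
        exact hPlow i h
      · rw [if_pos h, h, hPtop, sub_self]
        exact dvd_zero _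
      · rw [if_neg h.ne', coeff_eq_zero_of_natDegree_lt (by omega), sub_zero]
        exact dvd_zero _
    obtain ⟨u, hu⟩ := hzdvd
    have hX : (X : ConvP[X]) ^ (r - 1) = P - C ConvP.z * u := by rw [← hu]; ring
    have hsub : P - C ConvP.z * u - (-(C ConvP.z * u)) ∣
        (P - C ConvP.z * u) ^ k - (-(C ConvP.z * u)) ^ k := sub_dvd_pow_sub_pow _ _ _
    obtain ⟨w, hw⟩ := hsub
    have h3 : (X : ConvP[X]) ^ ((r - 1) * k) = P * w + C (ConvP.z ^ k) * (-u) ^ k := by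
      rw [pow_mul, hX, C_pow, ← mul_pow]
      have : P - C ConvP.z * u - (-(C ConvP.z * u)) = P := by ring
      rw [this] at hw
      rw [← hw]
      have : C ConvP.z * -u = -(C ConvP.z * u) := by ring
      rw [this]
      ring
    rw [h3]
    exact add_mem (Ideal.mul_mem_right _ _ (Ideal.subset_span (by simp)))
      (Ideal.mul_mem_right _ _ hk)
  rw [← hJ] at hN hfin hrank
  obtain ⟨e⟩ := nonempty_quotient_equiv hN
  unfold MilnorAlgebra
  rw [pd_zero_expand, pd_one_expand]
  refine ⟨Module.Finite.equiv e, ?_⟩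
  rw [← e.finrank_eq, hrank]
  have hs1 : (Pv.roots.map fun x => ((G.map ConvP.val.toRingHom).eval x).order).sum =
      (Pv.roots.map fun x => ∑ k ∈ Finset.range r, (x - ζ k).order - 1).sum := by
    congr 1
    refine Multiset.map_congr rfl fun x hx => ?_
    rw [(hGx x hx).2, (hpos x hx).2.2]
  -- Reciprocity: up to sign, the product of `x - ζ_k` over the roots `x` of `P` is `P(ζ_k)`, a
  -- constant multiple of `Φ'(ζ_k) = ∏_{l ≠ k} (ζ_k - ζ_l)`.
  have hs2 : ∀ k ∈ Finset.range r, (Pv.roots.map fun x => (x - ζ k).order).sum =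
      ∑ l ∈ (Finset.range r).erase k, (ζ k - ζ l).order := by
    intro k hk
    have hk' := Finset.mem_range.1 hk
    have h1 : (Φv.derivative.eval (ζ k)).order = ∑ l ∈ (Finset.range r).erase k, (ζ k - ζ l).order := by
      rw [hderζ k hk', order_prod]
      intro l hl
      rw [Finset.mem_erase, Finset.mem_range] at hl
      exact sub_ne_zero.2 (hinj k hk' l hl.2 (Ne.symm hl.1))
    have hPne : Pv.eval (ζ k) ≠ 0 := by
      intro h
      apply hderne k hk'
      rw [hder, eval_mul, h, mul_zero]
    have hrH : (r : H) = HahnSeries.C (r : ℂ) := (map_natCast _ _).symm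
    have hrH0 : (r : H) ≠ 0 := by
      rw [hrH]
      exact HahnSeries.C_ne_zero hr0
    rw [← h1, hder, eval_mul, eval_C, HahnSeries.order_mul hrH0 hPne, hrH,
      HahnSeries.order_C, zero_add]
    have h2 : Pv.eval (ζ k) = (Pv.roots.map fun x => ζ k - x).prod := by
      conv_lhs => rw [hsplit.eq_prod_roots_of_monic hPvmon]
      rw [eval_multiset_prod, Multiset.map_map]
      simp
    rw [h2]
    have hne := fun x hx => hsubne x hx k hk'
    generalize Pv.roots = s at hne
    induction s using Multiset.induction_on with
    | empty => simp
    | cons x s ih =>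
      have hne' : ∀ y ∈ s, y - ζ k ≠ 0 := fun y hy => hne y (Multiset.mem_cons_of_mem hy)
      have hx : ζ k - x ≠ 0 := sub_ne_zero.2 (Ne.symm (sub_ne_zero.1 (hne x (Multiset.mem_cons_self x s))))
      rw [Multiset.map_cons, Multiset.map_cons, Multiset.prod_cons, Multiset.sum_cons,
        HahnSeries.order_mul hx (Multiset.prod_ne_zero fun h0 => by
          obtain ⟨y, hy, hy0⟩ := Multiset.mem_map.1 h0
          exact hne' y hy (by rw [← neg_sub, hy0, neg_zero])), ih hne', ← neg_sub, HahnSeries.order_neg]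
  have hcomm : ∀ s : Multiset H, (s.map fun x => ∑ k ∈ Finset.range r, (x - ζ k).order).sum =
      ∑ k ∈ Finset.range r, (s.map fun x => (x - ζ k).order).sum := by
    intro s
    induction s using Multiset.induction_on with
    | empty => simp
    | cons x s ih => simp [ih, Finset.sum_add_distrib]
  rw [hs1, Multiset.sum_map_sub, hcomm, Finset.sum_congr rfl hs2]
  rw [Multiset.map_const', Multiset.sum_replicate, hcard, nsmul_eq_mul, mul_one, Nat.cast_sub hr,
    Nat.cast_one]

end IrregularSpectral

end

/-! ### Orders of the branches and the germ of `q̃` -/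

noncomputable section

namespace IrregularSpectral

theorem order_eq_of_coeff_eq_of_polar {f g : H} (h : ∀ a < 0, f.coeff a = g.coeff a)
    (hg : ∀ a ∈ g.support, a < 0) (h0 : g ≠ 0) : f ≠ 0 ∧ f.order = g.order := by
  have hlt := order_lt_zero_of_polar hg h0
  have h1 : f.coeff g.order ≠ 0 := by
    rw [h _ hlt]
    exact HahnSeries.coeff_order_eq_zero.not.2 h0
  have hf : f ≠ 0 := by
    rintro rfl
    exact h1 rfl
  have hle : f.order ≤ g.order := HahnSeries.order_le_of_coeff_ne_zero h1
  refine ⟨hf, le_antisymm hle (HahnSeries.order_le_of_coeff_ne_zero ?_)⟩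
  rw [← h _ (hle.trans_lt hlt)]
  exact HahnSeries.coeff_order_eq_zero.not.2 hf

section Branches

variable {q qt : H} {p : ℤ}

theorem coeff_eq_of_prMinus_eq (hpr : prMinus qt = q) {a : ℚ} (ha : a < 0) :
    qt.coeff a = q.coeff a := by
  rw [← hpr]
  exact (HahnSeries.coeff_truncLT_of_lt ha qt).symm

/-- For `q ≠ 0` the leading terms of `q̃` and `q` coincide. For `q = 0` one has `r = 1` and `p = 0`;
then `q̃` is an integral power series of order less than `1` by `hord`, hence of order `0`. -/
theorem order_of_prMinus_eq (hq : q ∈ polarAll) (hp : q.order = -(p : ℚ) / ramificationIndex q)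
    (hqt : qt ∈ convLaurent (ramificationIndex q)) (hpr : prMinus qt = q) (hord : (qt / zpow 1).orderTop < 0) :
    qt ≠ 0 ∧ qt.order = -(p : ℚ) / ramificationIndex q ∧ 0 ≤ p := by
  obtain ⟨hr, -, hq2⟩ := ramificationIndex_spec hq
  have hr' : (0 : ℚ) < ramificationIndex q := by exact_mod_cast hr
  have hqt0 : qt ≠ 0 := by
    rintro rfl
    rw [zero_div, HahnSeries.orderTop_zero] at hord
    exact not_top_lt hord
  by_cases h0 : q = 0
  · have hr1 : ramificationIndex q = 1 := by
      refine le_antisymm (ramificationIndex_le one_pos ?_) hr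
      rw [h0]
      exact ⟨zero_mem _, fun a ha => absurd rfl ha⟩
    have hp0 : p = 0 := by
      have h1 : q.order = 0 := by rw [h0, HahnSeries.order_zero]
      rw [h1, eq_comm, div_eq_zero_iff] at hp
      have := hp.resolve_right hr'.ne'
      rw [neg_eq_zero] at this
      exact_mod_cast this
    refine ⟨hqt0, ?_, hp0.ge⟩
    have hz := zpow_ne_zero 1
    rw [← HahnSeries.order_eq_orderTop_of_ne_zero (div_ne_zero hqt0 hz), order_div hqt0 hz,
      order_zpow] at hord
    have hlt : qt.order < 1 := by
      have : qt.order - 1 < 0 := by exact_mod_cast hord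
      linarith
    have hge : 0 ≤ qt.order := by
      by_contra! hneg
      have h2 := coeff_eq_of_prMinus_eq hpr hneg
      rw [h0, HahnSeries.coeff_zero] at h2
      exact hqt0 (HahnSeries.coeff_order_eq_zero.1 h2)
    obtain ⟨k, hk⟩ := hqt.1 _ (HahnSeries.coeff_order_eq_zero.not.2 hqt0)
    rw [hr1, Nat.cast_one, div_one] at hk
    rw [hk] at hlt hge ⊢
    have h3 : k < 1 := by exact_mod_cast hlt
    have h4 : 0 ≤ k := by exact_mod_cast hge
    have h5 : k = 0 := by omega
    rw [h5, hp0]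
    simp
  · obtain ⟨-, h1⟩ := order_eq_of_coeff_eq_of_polar
      (fun a ha => coeff_eq_of_prMinus_eq hpr ha) hq2 h0
    refine ⟨hqt0, h1.trans hp, ?_⟩
    have h2 := order_lt_zero_of_polar hq2 h0
    rw [hp, div_lt_iff₀ hr', zero_mul, neg_lt_zero] at h2
    exact_mod_cast h2.le

theorem xi_iterate_zpow_one (l : ℕ) : xi^[l] (zpow 1) = zpow 1 := by
  have h1 : zpow 1 ∈ laurent 1 := by simpa using zpow_mem_laurent 1 1
  induction l with
  | zero => rfl
  | succ l ih => rw [Function.iterate_succ_apply', ih, xi_eq_self_of_laurent_one h1]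

theorem xi_iterate_div (l : ℕ) (f g : H) : xi^[l] (f / g) = xi^[l] f / xi^[l] g := by
  simp only [xi_iterate_eq]
  exact map_div₀ (xiHom ^ l) f g

theorem xi_iterate_sub (l : ℕ) (f g : H) : xi^[l] (f - g) = xi^[l] f - xi^[l] g := by
  simp only [xi_iterate_eq]
  exact map_sub (xiHom ^ l) f g

/-- Write `z/a - z/b = -z (a - b)/(a b)`. Both conjugates have order `-p/r`, and the order of their
difference is read off from the polar parts, which are distinct. -/
theorem order_branch_sub (hq : q ∈ polarAll) (hpr : prMinus qt = q) (hqt0 : qt ≠ 0)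
    (hqo : qt.order = -(p : ℚ) / ramificationIndex q) {k l : ℕ} (hk : k < ramificationIndex q) (hl : l < ramificationIndex q) (hkl : k ≠ l) :
    zpow 1 / xi^[k] qt ≠ zpow 1 / xi^[l] qt ∧
    (zpow 1 / xi^[k] qt - zpow 1 / xi^[l] qt).order =
      1 + 2 * p / ramificationIndex q + (xi^[k] q - xi^[l] q).order := by
  obtain ⟨-, -, hq2⟩ := ramificationIndex_spec hq
  have hx : ∀ l, xi^[l] qt ≠ 0 := by
    intro l h
    rw [← HahnSeries.orderTop_eq_top, orderTop_xi_iterate, HahnSeries.orderTop_eq_top] at h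
    exact hqt0 h
  have hne : xi^[k] q - xi^[l] q ≠ 0 := by
    refine sub_ne_zero.2 (xi_iterate_ne_of_mod_ne hq ?_)
    rwa [Nat.mod_eq_of_lt hk, Nat.mod_eq_of_lt hl]
  obtain ⟨h1, h2⟩ := order_eq_of_coeff_eq_of_polar (f := xi^[k] qt - xi^[l] qt) (fun a ha => by
    rw [HahnSeries.coeff_sub, HahnSeries.coeff_sub, coeff_xi_iterate, coeff_xi_iterate,
      coeff_xi_iterate, coeff_xi_iterate, coeff_eq_of_prMinus_eq hpr ha])
    (sub_polar (xi_iterate_polar hq2 k) (xi_iterate_polar hq2 l)) hne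
  have hprod : xi^[k] qt * xi^[l] qt ≠ 0 := mul_ne_zero (hx k) (hx l)
  have heq : zpow 1 / xi^[k] qt - zpow 1 / xi^[l] qt =
      -(zpow 1 * (xi^[k] qt - xi^[l] qt) / (xi^[k] qt * xi^[l] qt)) := by
    have hk0 := hx k
    have hl0 := hx l
    rw [div_sub_div _ _ hk0 hl0]
    ring
  have hnum : zpow 1 * (xi^[k] qt - xi^[l] qt) ≠ 0 := mul_ne_zero (zpow_ne_zero 1) h1
  constructor
  · rw [← sub_ne_zero, heq]
    exact neg_ne_zero.2 (div_ne_zero hnum hprod)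
  · rw [heq, HahnSeries.order_neg, order_div hnum hprod,
      HahnSeries.order_mul (zpow_ne_zero 1) h1, HahnSeries.order_mul (hx k) (hx l), order_zpow,
      order_xi_iterate, order_xi_iterate, hqo, h2]
    ring

open Polynomial in
-- `ξ` permutes the linear factors cyclically, so the coefficients are fixed by `ξ` and lie in
-- `ℂ((z))`. Convergence is inherited from the factors, and nonnegative order from that of the
-- roots.
theorem coeff_branchPoly_mem (hq : q ∈ polarAll) (hqt : qt ∈ convLaurent (ramificationIndex q))
    {ε : ℚ} (hε : 0 ≤ ε) (hζ : ∀ k < ramificationIndex q, zpow 1 / xi^[k] qt ∈ fil ε) (i : ℕ) :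
    (branchPoly (ramificationIndex q) qt).coeff i ∈ convPower := by
  have hr := (ramificationIndex_spec hq).1
  refine ⟨⟨?_, ?_⟩, ?_⟩
  · refine (xi_iterate_eq_self_iff one_pos).1 ?_
    change xiHom.toRingHom ((branchPoly (ramificationIndex q) qt).coeff i) = _
    rw [← coeff_map]
    congr 1
    have hmap : ∀ k, (X - C (zpow 1 / xi^[k] qt) : H[X]).map xiHom.toRingHom =
        X - C (zpow 1 / xi^[k + 1] qt) := by
      intro k
      rw [Polynomial.map_sub, map_X, map_C]
      congr 2
      change xi^[1] (zpow 1 / xi^[k] qt) = _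
      rw [xi_iterate_div, xi_iterate_zpow_one, Function.iterate_succ_apply' xi k]
      rfl
    rw [branchPoly, Polynomial.map_prod, Finset.prod_congr rfl fun k _ => hmap k]
    obtain ⟨n, hn⟩ : ∃ n, (ramificationIndex q) = n + 1 := ⟨(ramificationIndex q) - 1, by omega⟩
    have hfix : xi^[n + 1] qt = qt := by
      rw [← hn]
      exact (xi_iterate_eq_self_iff hr).2 hqt.1
    rw [hn, Finset.prod_range_succ, Finset.prod_range_succ', hfix]
    rfl
  · have hmem : ∀ k, zpow 1 / xi^[k] qt ∈ convergent := by
      intro k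
      rw [div_eq_mul_inv]
      exact mul_mem (single_mem_convergent 1 1)
        (inv_mem_convergent (xi_iterate_mem_convergent hqt.2 k))
    have hl : branchPoly (ramificationIndex q) qt ∈ Polynomial.lifts convergent.val.toRingHom := by
      have hlk : ∀ k, (X - C (zpow 1 / xi^[k] qt) : H[X]) ∈
          Polynomial.lifts convergent.val.toRingHom := by
        intro k
        rw [Polynomial.lifts_iff_coeff_lifts]
        intro j
        rw [coeff_sub, coeff_X, coeff_C]
        have h1 : (if 1 = j then 1 else 0 : H) - (if j = 0 then zpow 1 / xi^[k] qt else 0) ∈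
            convergent := by
          refine sub_mem ?_ ?_ <;> split_ifs
          exacts [one_mem _, zero_mem _, hmem k, zero_mem _]
        exact ⟨⟨_, h1⟩, rfl⟩
      rw [branchPoly]
      exact prod_mem fun k _ => hlk k
    obtain ⟨x, hx⟩ := (Polynomial.lifts_iff_coeff_lifts _).1 hl i
    rw [← hx]
    exact x.2
  · rcases le_or_gt i (ramificationIndex q) with hi | hi
    · refine fil_anti ?_ (coeff_prod_X_sub_C_mem_fil hζ i)
      have : (i : ℚ) ≤ (ramificationIndex q) := by exact_mod_cast hi
      exact mul_nonneg hε (by linarith)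
    · rw [coeff_eq_zero_of_natDegree_lt]
      · exact zero_mem _
      · rwa [branchPoly, natDegree_prod_of_monic _ _ fun k _ => monic_X_sub_C _,
          Finset.sum_congr rfl fun k _ => natDegree_X_sub_C _, Finset.sum_const, Finset.card_range,
          smul_eq_mul, mul_one]

/-- Apply `ξ^k`, which preserves orders, and translate the index by `k` modulo `r`. -/
theorem sum_order_sub (hq : q ∈ polarAll) {k : ℕ} (hk : k < ramificationIndex q) :
    ∑ l ∈ Finset.range (ramificationIndex q), (xi^[k] q - xi^[l] q).order =
      ∑ l ∈ Finset.range (ramificationIndex q), (q - xi^[l] q).order := by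
  have : NeZero (ramificationIndex q) := ⟨(ramificationIndex_spec hq).1.ne'⟩
  rw [Finset.sum_range, Finset.sum_range,
    ← Equiv.sum_comp (Equiv.addLeft (⟨k, hk⟩ : Fin (ramificationIndex q)))]
  refine Finset.sum_congr rfl fun l _ => ?_
  rw [Equiv.coe_addLeft, Fin.val_add, xi_iterate_mod hq, Function.iterate_add_apply,
    ← xi_iterate_sub, order_xi_iterate]

/-- The Milnor number of the germ with branches `ξ^k(z / q̃)`. -/
theorem finrank_milnorAlgebra_branchPoly (hq : q ∈ polarAll) (hp : q.order = -(p : ℚ) / ramificationIndex q)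
    (hqt : qt ∈ convLaurent (ramificationIndex q)) (hpr : prMinus qt = q) (hord : (qt / zpow 1).orderTop < 0) :
    ∃ F : convPS, IsExpansion (F : MvPowerSeries (Fin 2) ℂ) (branchPoly (ramificationIndex q) qt) ∧
      Module.Finite ℂ (MilnorAlgebra F) ∧
      (Module.finrank ℂ (MilnorAlgebra F) : ℚ) = (2 * p + (ramificationIndex q) - 1) * ((ramificationIndex q) - 1) +
        (ramificationIndex q) * ∑ l ∈ Finset.range (ramificationIndex q), (q - xi^[l] q).order := by
  obtain ⟨hqt0, hqo, hp0⟩ := order_of_prMinus_eq hq hp hqt hpr hord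
  have hr := (ramificationIndex_spec hq).1
  have hr' : (0 : ℚ) < ramificationIndex q := by exact_mod_cast hr
  -- The common order of all branches `z / ξ^k(q̃)`.
  set ε : ℚ := 1 + p / ramificationIndex q with hε
  have hεpos : 0 < ε := by
    have : (0 : ℚ) ≤ p / ramificationIndex q := div_nonneg (by exact_mod_cast hp0) hr'.le
    linarith
  have hζ : ∀ k < ramificationIndex q, zpow 1 / xi^[k] qt ∈ fil ε := by
    intro k _
    have hx : xi^[k] qt ≠ 0 := by
      rw [← HahnSeries.orderTop_ne_top, orderTop_xi_iterate, HahnSeries.orderTop_ne_top]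
      exact hqt0
    rw [mem_fil_iff_order (div_ne_zero (zpow_ne_zero 1) hx), order_div (zpow_ne_zero 1) hx,
      order_zpow, order_xi_iterate, hqo, hε]
    apply le_of_eq
    ring
  have hl : branchPoly (ramificationIndex q) qt ∈ Polynomial.lifts ConvP.val.toRingHom := by
    rw [Polynomial.lifts_iff_coeff_lifts]
    exact fun i => ConvP.exists_val (coeff_branchPoly_mem hq hqt hεpos.le hζ i)
  obtain ⟨Φ, hΦ⟩ := hl
  have hΦ' : Φ.map ConvP.val.toRingHom = branchPoly (ramificationIndex q) qt := hΦ
  have hc : ∀ i, (branchPoly (ramificationIndex q) qt).coeff i = ConvP.val (Φ.coeff i) := fun i => by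
    rw [← hΦ', Polynomial.coeff_map]
    rfl
  obtain ⟨hfin, hrank⟩ := finrank_milnorAlgebra hr hεpos hζ
    (fun k hk l hl hkl => (order_branch_sub hq hpr hqt0 hqo hk hl hkl).1) hΦ'
  refine ⟨expand Φ, ⟨fun i j => ?_, fun i a ha => ?_⟩, hfin, ?_⟩
  · rw [coeff_expand, hc]
    simp
  · rw [hc] at ha
    exact ConvP.exists_nat_of_coeff_ne_zero _ ha
  · rw [hrank]
    have h1 : ∀ k ∈ Finset.range (ramificationIndex q), ∑ l ∈ (Finset.range (ramificationIndex q)).erase k,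
        (zpow 1 / xi^[k] qt - zpow 1 / xi^[l] qt).order =
        ((ramificationIndex q) - 1) * (1 + 2 * p / ramificationIndex q) + ∑ l ∈ Finset.range (ramificationIndex q), (q - xi^[l] q).order := by
      intro k hk
      have hk' := Finset.mem_range.1 hk
      rw [← sum_order_sub hq hk', ← Finset.add_sum_erase _ _ hk, sub_self, HahnSeries.order_zero,
        zero_add]
      rw [Finset.sum_congr rfl fun l hl => (order_branch_sub hq hpr hqt0 hqo hk'
        (Finset.mem_range.1 (Finset.mem_of_mem_erase hl)) (Finset.ne_of_mem_erase hl).symm).2,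
        Finset.sum_add_distrib, Finset.sum_const, Finset.card_erase_of_mem hk, Finset.card_range,
        nsmul_eq_mul, Nat.cast_sub hr, Nat.cast_one]
    rw [Finset.sum_congr rfl h1, Finset.sum_const, Finset.card_range, nsmul_eq_mul]
    field_simp
    ring

end Branches

end IrregularSpectral

end

/-! ### Combination of the two computations -/

open IrregularSpectral in
theorem mainTheorem7 (q : Puiseux) (hq : q.val ∈ polarAll) (R : Matrix (Fin 1) (Fin 1) ℂ)
    (r : ℕ) (hr : r = ramificationIndex (Puiseux.val q))
    (p : ℤ) (hp : q.val.order = -(p : ℚ) / (r : ℚ))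
    (qt : H) (hqt : qt ∈ convLaurent r) (hpr : prMinus qt = q.val)
    (hord : (qt / zpow 1).orderTop < 0)
    {M : Type*} [AddCommGroup M] [Module ConvL M] [Module ℂ M]
    [IsScalarTower ℂ ConvL M] [Module.Finite ConvL M]
    (nablaM : Connection dConv M) (hM : HasNormalForm nablaM (htlCell q R)) :
    HasIrr nablaM.endConn ∧
      ∃ F : convPS, IsExpansion (F : MvPowerSeries (Fin 2) ℂ) (branchPoly r qt) ∧
        Module.Finite ℂ (MilnorAlgebra F) ∧
        (Module.finrank ℂ (MilnorAlgebra F) : ℤ) =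
          (2 * p + r - 1) * (r - 1) - irr nablaM.endConn := by
  subst hr
  choose a ha using exists_order_sub_xi hq
  obtain ⟨h1, h2⟩ := irr_endConn hq R hM (p := fun l => a l) fun l => ha l
  obtain ⟨F, hF, hfin, hrank⟩ := finrank_milnorAlgebra_branchPoly hq hp hqt hpr hord
  refine ⟨h1, F, hF, hfin, ?_⟩
  have hr : (ramificationIndex (Puiseux.val q) : ℚ) ≠ 0 := by
    exact_mod_cast (ramificationIndex_spec hq).1.ne'
  -- The link between the two sides: each `a l` equals `-r ord(q - ξ^l(q))`, and these numbers add
  -- up to the irregularity.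
  have hsum : (ramificationIndex (Puiseux.val q) : ℚ) *
      ∑ l ∈ Finset.range (ramificationIndex (Puiseux.val q)), (q.val - xi^[l] q.val).order =
      -((irr nablaM.endConn : ℤ) : ℚ) := by
    rw [h2, Finset.mul_sum, Finset.sum_range]
    push_cast
    rw [← Finset.sum_neg_distrib]
    refine Finset.sum_congr rfl fun l _ => ?_
    rw [ha]
    field_simp
  rw [hsum] at hrank
  have h3 : ((Module.finrank ℂ (MilnorAlgebra F) : ℤ) : ℚ) =
      (((2 * p + ramificationIndex (Puiseux.val q) - 1) * (ramificationIndex (Puiseux.val q) - 1) -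
        irr nablaM.endConn : ℤ) : ℚ) := by
    rw [Int.cast_natCast, hrank]
    push_cast
    ring
  exact_mod_cast h3
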